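/- For $k\ge 1$ let $\gamma^{(k)}(\mathbf x_k;\mathbf x_k')\in L^2(\mathbb R^k\times\mathbb R^k;\mathbb C)$ be $k$-particle kernels that are symmetric in $x_1,\dots,x_k$ and, separately, in $x_1',\dots,x_k'$, and put $R^{(k)}_\varepsilon=\prod_{j=1}^k\langle\partial_{x_j}\rangle^\varepsilon\langle\partial_{x_j'}\rangle^\varepsilon$. For $0<\xi<1$ let $H^\varepsilon_\xi$ be the space of sequences $\Gamma=(\gamma^{(k)})_{k\ge1}$ of such kernels with $$\|\Gamma\|_{H^\varepsilon_\xi}=\sum_{k\ge1}\xi^k\,\|R^{(k)}_\varepsilon\gamma^{(k)}\|_{L^2}<\infty .$$ A sequence lies in $H^\varepsilon$ if it lies in $H^\varepsilon_\xi$ for some $\xi\in(0,1)$. No factorization of the kernels is assumed. Consider the one-dimensional Gross–Pitaevskii hierarchy, with $b_0\in\mathbb R$ of either sign, $$i\partial_t\gamma^{(k)}=\Big[-\tfrac12\Delta_{\mathbf x_k},\gamma^{(k)}\Big]+b_0\sum_{j=1}^kB_{j,k+1}\gamma^{(k+1)},\qquad B_{j,k+1}\gamma^{(k+1)}=\mathrm{Tr}_{k+1}\big[\delta(x_j-x_{k+1}),\gamma^{(k+1)}\big],\qquad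 k\ge1 .$$ Here $B_{j,k+1}\gamma^{(k+1)}=F$ on $[0,T]$ means the following: for every $\rho\in C_c^\infty(\mathbb R;\mathbb R)$ with $\int\rho=1$ and $\rho_a(x)=a^{-1}\rho(x/a)$, the regularized terms $$\iint\big[\rho_a(x_j-y)\rho_a(x_j-y')-\rho_a(x_j'-y)\rho_a(x_j'-y')\big]\gamma^{(k+1)}(t,\mathbf x_k,y;\mathbf x_k',y')\,dy\,dy',$$ paired with any Schwartz function of $(\mathbf x_k;\mathbf x_k')$, converge in $L^1([0,T])$ as $a\to0^+$ to the pairing with $F(t)$. A solution in $H^\varepsilon_\xi$ on $[0,T]$ with initial datum $\Gamma_0$ is a curve $\Gamma\in C([0,T];H^\varepsilon_\xi)$ for which the collision terms $B_{j,k+1}\gamma^{(k+1)}$ exist as strongly measurable $L^2$-valued functions of $t$ with $$\sum_{k\ge1}\xi^k\sum_{j=1}^k\int_0^T\|R^{(k)}_\varepsilon B_{j,k+1}\gamma^{(k+1)}(t)\|_{L^2}\,dt<\infty ,$$ and for which, with $U^{(k)}(t)=\prod_{j=1}^ke^{\frac{it}{2}\partial_{x_j}^2}e^{-\frac{it}{2}\partial_{x_j'}^2}$,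 $$\gamma^{(k)}(t)=U^{(k)}(t)\gamma^{(k)}_0-ib_0\sum_{j=1}^k\int_0^tU^{(k)}(t-s)B_{j,k+1}\gamma^{(k+1)}(s)\,ds\qquad(0\le t\le T,\ k\ge1).$$ **Corollary.** Let $\varepsilon>0$, $b_0\in\mathbb R$, $\xi_1\in(0,1)$ and $\Gamma_0\in H^\varepsilon_{\xi_1}$. Then there are $T>0$, $\xi_2\in(0,\xi_1]$ and a solution $\Gamma$ in $H^\varepsilon_{\xi_2}$ on $[0,T]$ with initial datum $\Gamma_0$. It is unique in $H^\varepsilon$: for every $\xi\in(0,1)$, every solution in $H^\varepsilon_\xi$ on $[0,T]$ with initial datum $\Gamma_0$ coincides with $\Gamma$ on $[0,T]$. If moreover every $\gamma_0^{(k)}$ is Hermitian, that is, $\gamma_0^{(k)}(\mathbf x';\mathbf x)=\overline{\gamma_0^{(k)}(\mathbf x;\mathbf x')}$, then so is every $\gamma^{(k)}(t)$, $0\le t\le T$. -/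

import Mathlib

open MeasureTheory Filter Topology
open scoped ENNReal FourierTransform SchwartzMap

noncomputable section

namespace GPHierarchy

/-- The configuration space `ℝ^k × ℝ^k` of a `k`-particle density kernel `γ(x; x')` in one space
dimension: the coordinate `Sum.inl j` is `x_j`, the coordinate `Sum.inr j` is `x'_j`. -/
abbrev Pts (k : ℕ) : Type := EuclideanSpace ℝ (Fin k ⊕ Fin k)

/-- `k`-particle density kernels: the space `L²(ℝ^k × ℝ^k; ℂ)`. -/
abbrev Kernel (k : ℕ) : Type := Lp (α := Pts k) ℂ 2

/-- A sequence `Γ = (γ^(1), γ^(2), …)` of density kernels; the entry `Γ n` is `γ^(n+1)`. -/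
abbrev KernelSeq : Type := ∀ n : ℕ, Kernel (n + 1)

/-- The point `(x_{σ(1)}, …, x_{σ(k)}; x'_{τ(1)}, …, x'_{τ(k)})`. -/
def permPts {k : ℕ} (σ τ : Equiv.Perm (Fin k)) (z : Pts k) : Pts k :=
  WithLp.toLp 2 (fun i => z (Sum.map σ τ i))

/-- The point `(x'; x)` obtained from `(x; x')`. -/
def swapPts {k : ℕ} (z : Pts k) : Pts k :=
  WithLp.toLp 2 (fun i => z (Sum.swap i))

/-- The point `(x_1, …, x_k; x'_1, …, x'_k)` obtained from a `(k+1)`-particle point. -/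
def initPts {k : ℕ} (w : Pts (k + 1)) : Pts k :=
  WithLp.toLp 2 (fun i => w (Sum.map Fin.castSucc Fin.castSucc i))

/-- Bosonic symmetry: `γ` is symmetric in the variables `x_1, …, x_k` and, separately, in the
variables `x'_1, …, x'_k`. -/
def IsBosonic {k : ℕ} (γ : Kernel k) : Prop :=
  ∀ σ τ : Equiv.Perm (Fin k), ∀ᵐ z : Pts k, γ (permPts σ τ z) = γ z

/-- Hermitian kernels: `γ(x'; x)` is the complex conjugate of `γ(x; x')`. -/
def IsHermitianKernel {k : ℕ} (γ : Kernel k) : Prop :=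
  ∀ᵐ z : Pts k, γ (swapPts z) = (starRingEnd ℂ) (γ z)

/-- The Fourier symbol of `R_ε^(k) = ∏_j ⟨∂_{x_j}⟩^ε ⟨∂_{x'_j}⟩^ε`. With the Fourier transform
`∫ e^{-2πi z·ζ} f(z) dz`, the operator `∂_j` has symbol `2πi ζ_j`, so `⟨∂_j⟩^ε` has symbol
`(1 + (2π ζ_j)²)^{ε/2}`. -/
def sobolevSymbol (ε : ℝ) {k : ℕ} (ζ : Pts k) : ℝ :=
  ∏ i, (1 + (2 * Real.pi * ζ i) ^ 2) ^ (ε / 2)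

/-- The norm `‖R_ε^(k) γ‖_{L²}`, with value `∞` if `γ` is not in the corresponding space. -/
def sobolevNorm (ε : ℝ) {k : ℕ} (γ : Kernel k) : ℝ≥0∞ :=
  eLpNorm (fun ζ : Pts k => (sobolevSymbol ε ζ : ℂ) * (𝓕 γ : Kernel k) ζ) 2 volume

/-- The norm `‖Γ‖_{H^ε_ξ} = ∑_{k ≥ 1} ξ^k ‖R_ε^(k) γ^(k)‖_{L²}`. -/
def seqNorm (ε ξ : ℝ) (Γ : KernelSeq) : ℝ≥0∞ :=
  ∑' n : ℕ, ENNReal.ofReal (ξ ^ (n + 1)) * sobolevNorm ε (Γ n)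

/-- The space `H^ε_ξ` of sequences of bosonic kernels of finite norm. -/
def MemH (ε ξ : ℝ) (Γ : KernelSeq) : Prop :=
  (∀ n, IsBosonic (Γ n)) ∧ seqNorm ε ξ Γ < ∞

/-- The Fourier symbol `exp(-i t/2 · (2π)² (|ζ|² - |ζ'|²))` of the free evolution
`∏_j exp(i t/2 ∂²_{x_j}) exp(-i t/2 ∂²_{x'_j})`. -/
def freeSymbol (t : ℝ) {k : ℕ} (ζ : Pts k) : ℂ :=
  Complex.exp (-(Complex.I * ((t / 2 * ((2 * Real.pi) ^ 2 *
    ((∑ j : Fin k, ζ (Sum.inl j) ^ 2) - ∑ j : Fin k, ζ (Sum.inr j) ^ 2)) : ℝ) : ℂ)))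

theorem norm_freeSymbol (t : ℝ) {k : ℕ} (ζ : Pts k) : ‖freeSymbol t ζ‖ = 1 := by
  rw [freeSymbol, ← mul_neg, ← Complex.ofReal_neg]
  exact Complex.norm_exp_I_mul_ofReal _

theorem continuous_freeSymbol (t : ℝ) (k : ℕ) :
    Continuous (fun ζ : Pts k => freeSymbol t ζ) := by
  unfold freeSymbol
  fun_prop

theorem memLp_freeSymbol_mul (t : ℝ) {k : ℕ} (f : Kernel k) :
    MemLp (fun ζ : Pts k => freeSymbol t ζ * f ζ) 2 volume := by
  refine (Lp.memLp f).of_le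
    ((continuous_freeSymbol t k).aestronglyMeasurable.mul (Lp.aestronglyMeasurable f)) ?_
  filter_upwards with ζ
  simp [norm_freeSymbol]

/-- The free evolution `U^(k)(t)` on kernels, that is, the solution operator of
`i ∂_t γ = [-½ Δ, γ] = -½ (Δ_x - Δ_{x'}) γ`. -/
def freeEvolution (t : ℝ) {k : ℕ} (γ : Kernel k) : Kernel k :=
  𝓕⁻ ((memLp_freeSymbol_mul t (𝓕 γ : Kernel k)).toLp : Kernel k)

/-- Admissible profiles for approximating the delta function: `ρ` smooth, compactly supported, of
integral one. -/
structure IsProfile (ρ : ℝ → ℝ) : Prop where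
  smooth : ContDiff ℝ (⊤ : ℕ∞) ρ
  compact : HasCompactSupport ρ
  integral_eq_one : ∫ x, ρ x = 1

/-- The approximate delta function `ρ_a(x) = a⁻¹ ρ(x / a)`. -/
def approxDelta (ρ : ℝ → ℝ) (a : ℝ) (x : ℝ) : ℝ := a⁻¹ * ρ (x / a)

/-- The pairing with a test function `Φ` of the regularized collision term
`∫∫ [ρ_a(x_j - y) ρ_a(x_j - y') - ρ_a(x'_j - y) ρ_a(x'_j - y')] γ(x, y; x', y') dy dy'`,
where `y = x_{k+1}`, `y' = x'_{k+1}`. With delta functions in place of `ρ_a` the collision term is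
the kernel of `Tr_{k+1} [δ(x_j - x_{k+1}), γ]`, namely `γ(x, x_j; x', x_j) - γ(x, x'_j; x', x'_j)`.
-/
def collisionPairing (ρ : ℝ → ℝ) (a : ℝ) {k : ℕ} (j : Fin k) (γ : Kernel (k + 1))
    (Φ : 𝓢(Pts k, ℂ)) : ℂ :=
  ∫ w : Pts (k + 1),
    Φ (initPts w) *
      ((approxDelta ρ a (w (Sum.inl j.castSucc) - w (Sum.inl (Fin.last k))) *
          approxDelta ρ a (w (Sum.inl j.castSucc) - w (Sum.inr (Fin.last k)))
        - approxDelta ρ a (w (Sum.inr j.castSucc) - w (Sum.inl (Fin.last k))) *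
          approxDelta ρ a (w (Sum.inr j.castSucc) - w (Sum.inr (Fin.last k))) : ℝ) : ℂ) *
      γ w

/-- `F(t) = B_{j,k+1} γ(t) = Tr_{k+1} [δ(x_j - x_{k+1}), γ(t)]` on `[0,T]`, in the sense of
distributions: for every profile of the delta function the regularized collision terms, paired with
any Schwartz function, converge to `F` in `L¹([0,T])`. -/
def IsCollision (T : ℝ) {k : ℕ} (j : Fin k) (γ : ℝ → Kernel (k + 1)) (F : ℝ → Kernel k) : Prop :=
  ∀ ρ : ℝ → ℝ, IsProfile ρ → ∀ Φ : 𝓢(Pts k, ℂ),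
    Tendsto
      (fun a : ℝ => ∫⁻ t in Set.Icc 0 T,
        ‖collisionPairing ρ a j (γ t) Φ - ∫ z : Pts k, Φ z * F t z‖ₑ)
      (𝓝[>] 0) (𝓝 0)

/-- `Γ` is a solution in `H^ε_ξ` on `[0,T]` of the one-dimensional Gross-Pitaevskii hierarchy
`i ∂_t γ^(k) = [-½ Δ, γ^(k)] + b₀ ∑_{j ≤ k} Tr_{k+1} [δ(x_j - x_{k+1}), γ^(k+1)]`, `k ≥ 1`, with
initial datum `Γ₀`: `Γ` is a continuous curve in `H^ε_ξ`, its collision terms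
`F n j = B_{j,k+1} γ^(k+1)` with `k = n + 1` exist and form an element of `L¹([0,T]; H^ε_ξ)`, and Duhamel's formula holds. -/
def IsSolution (ε ξ b₀ T : ℝ) (Γ₀ : KernelSeq) (Γ : ℝ → KernelSeq) : Prop :=
  (∀ t ∈ Set.Icc 0 T, MemH ε ξ (Γ t)) ∧
  (∀ t ∈ Set.Icc 0 T,
    Tendsto (fun s => seqNorm ε ξ (Γ s - Γ t)) (𝓝[Set.Icc 0 T] t) (𝓝 0)) ∧
  ∃ F : ∀ n : ℕ, Fin (n + 1) → ℝ → Kernel (n + 1),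
    (∀ n j, AEStronglyMeasurable (F n j) (volume.restrict (Set.Icc 0 T))) ∧
    (∑' n : ℕ, ENNReal.ofReal (ξ ^ (n + 1)) *
      ∑ j : Fin (n + 1), ∫⁻ t in Set.Icc 0 T, sobolevNorm ε (F n j t)) < ∞ ∧
    (∀ n j, IsCollision T j (fun t => Γ t (n + 1)) (F n j)) ∧
    ∀ n, ∀ t ∈ Set.Icc 0 T,
      Γ t n = freeEvolution t (Γ₀ n)
        - (Complex.I * (b₀ : ℂ)) •
          ∑ j : Fin (n + 1), ∫ s in (0 : ℝ)..t, freeEvolution (t - s) (F n j s)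

end GPHierarchy

end

/-! Conjugation with the free evolution and division by the Sobolev weights on the Fourier side turn
the hierarchy into an equation for plain square integrable functions: the `k`-particle unknown has
derivative `β ∑_i A_i(t)` applied to the `(k+1)`-particle unknown, with `β = -i b₀`. The index `i`
runs over the `2k` variables, and `A_i(t)` integrates out two frequencies against a symbol that
oscillates with the change of kinetic energy.

The analytic input is the collapse estimate `exists_collapse_estimate`: for a fixed `f`, the
integral of `‖A_i(r) f‖` over `(a, b]` is at most a constant times `√(b - a) ‖f‖`. Expanding the
square and integrating in time against a Gaussian reduces it to `exists_lintegral_sq_kappa_le`, a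
bound for the squared weights near the level sets of the phase. The phase is affine in one
contracted frequency, with slope proportional to some `u`, so a Gaussian in the phase integrates to
`1/|u|` in that frequency. Every `ε > 0` gains a power that makes this integrable in `u`, at `0` and
at infinity.

The combinatorial input defeats the factorial number of terms of the Duhamel expansion. Every
particle gets a final time of its own (`CollisionFamily.multi`). Collisions with different particles
commute on symmetric sequences, so the time of one particle can be run while all others keep theirs
(`multi_succ_eq_update`). Induction on the number of running particles then yields the bound `4^k
(8c)^n` (`lintegral_multi_le`), in which the collapse estimate is only ever applied to
time-independent vectors.

For small `ε` the contraction is not a bounded operator at a fixed time, so everything is done with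
a square integrable multiplier in the contracted frequencies. The time-integrated bounds see only
its supremum and survive the removal of the multiplier (`dataLim`). The limit is the same for sharp
cut-offs and for the mollifiers that regularize the delta functions, and so `dataLim` is the
collision term in the distributional sense of `IsCollision`.

For short times the constant `c`, of order `√T`, is small compared with `ξ`. The Neumann series of
`picard` then converges in a space with smaller `ξ`, which gives existence (`exists_source`,
`isSolution_solution`). The difference of two solutions equals its own `m`-th iterate for every `m`
and hence vanishes on short steps; finitely many steps cover the interval (`eq_zero_of_hierarchy`,
`IsMild.eq`). The adjoint exchanges the two halves of the commutator and reverses its sign, which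
the imaginary `β` compensates, so Hermitian data stay Hermitian. -/

open scoped NNReal

noncomputable section

namespace GPHierarchy

set_option linter.unusedSectionVars false

/-! ### Duhamel expansion with a separate time for each particle. -/

section

/-- The particles of a `k`-particle kernel: `Sum.inl j` is `x_j`, `Sum.inr j` is `x'_j`. -/
abbrev Idx (k : ℕ) : Type := Fin k ⊕ Fin k

/-- A particle of a `k`-particle kernel, seen in a `(k+1)`-particle kernel. -/
def up {k : ℕ} (i : Idx k) : Idx (k + 1) := Sum.map Fin.castSucc Fin.castSucc i

/-- The family `x` extended by `a` and `b` at the two new particles. -/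
def snoc2 {α : Type*} {k : ℕ} (x : Idx k → α) (a b : α) : Idx (k + 1) → α :=
  Sum.elim (Fin.snoc (α := fun _ => α) (fun j => x (Sum.inl j)) a)
    (Fin.snoc (α := fun _ => α) (fun j => x (Sum.inr j)) b)

section snoc2

variable {α β : Type*} {k : ℕ}

@[simp] theorem up_inl (j : Fin k) : up (Sum.inl j) = Sum.inl j.castSucc := rfl

@[simp] theorem up_inr (j : Fin k) : up (Sum.inr j) = Sum.inr j.castSucc := rfl

@[simp] theorem snoc2_up (x : Idx k → α) (a b : α) (i : Idx k) : snoc2 x a b (up i) = x i := by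
  rcases i with i | i <;> simp [snoc2]

@[simp] theorem snoc2_inl_castSucc (x : Idx k → α) (a b : α) (i : Fin k) :
    snoc2 x a b (Sum.inl i.castSucc) = x (Sum.inl i) := by
  simp [snoc2]

@[simp] theorem snoc2_inr_castSucc (x : Idx k → α) (a b : α) (i : Fin k) :
    snoc2 x a b (Sum.inr i.castSucc) = x (Sum.inr i) := by
  simp [snoc2]

@[simp] theorem snoc2_inl_last (x : Idx k → α) (a b : α) :
    snoc2 x a b (Sum.inl (Fin.last k)) = a := by
  simp [snoc2]

@[simp] theorem snoc2_inr_last (x : Idx k → α) (a b : α) :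
    snoc2 x a b (Sum.inr (Fin.last k)) = b := by
  simp [snoc2]

theorem up_injective : Function.Injective (up : Idx k → Idx (k + 1)) :=
  Sum.map_injective.2 ⟨Fin.castSucc_injective _, Fin.castSucc_injective _⟩

/-- Case distinction between old and new particles. -/
theorem Idx.cases {P : Idx (k + 1) → Prop} (h : ∀ i : Idx k, P (up i))
    (hl : P (Sum.inl (Fin.last k))) (hr : P (Sum.inr (Fin.last k))) (i : Idx (k + 1)) : P i := by
  rcases i with i | i
  · exact Fin.lastCases (motive := fun i => P (Sum.inl i)) hl (fun j => h (Sum.inl j)) i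
  · exact Fin.lastCases (motive := fun i => P (Sum.inr i)) hr (fun j => h (Sum.inr j)) i

theorem snoc2_ext {x y : Idx (k + 1) → α} (h : ∀ i : Idx k, x (up i) = y (up i))
    (hl : x (Sum.inl (Fin.last k)) = y (Sum.inl (Fin.last k)))
    (hr : x (Sum.inr (Fin.last k)) = y (Sum.inr (Fin.last k))) : x = y :=
  funext fun i => Idx.cases (P := fun i => x i = y i) h hl hr i

theorem sum_idx_succ [AddCommMonoid β] (f : Idx (k + 1) → β) :
    ∑ i, f i = ∑ i : Idx k, f (up i) + f (Sum.inl (Fin.last k)) + f (Sum.inr (Fin.last k)) := by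
  simp only [Fintype.sum_sum_type, Fin.sum_univ_castSucc, up_inl, up_inr]
  abel

theorem continuous_snoc2 [TopologicalSpace α] [TopologicalSpace β] {x : β → Idx k → α}
    {a b : β → α} (hx : Continuous x) (ha : Continuous a) (hb : Continuous b) :
    Continuous fun y => snoc2 (x y) (a y) (b y) := by
  refine continuous_pi fun i => ?_
  refine Idx.cases (P := fun i => Continuous fun y => snoc2 (x y) (a y) (b y) i) ?_ ?_ ?_ i
  · intro i
    simp only [snoc2_up]
    exact (continuous_apply i).comp hx
  · simpa using ha
  · simpa using hb

end snoc2

/-- A permutation of `Fin k`, extended to `Fin (k + 1)` by fixing the last element. -/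
def extPerm {k : ℕ} (σ : Equiv.Perm (Fin k)) : Equiv.Perm (Fin (k + 1)) :=
  (finSuccEquivLast.trans (Equiv.optionCongr σ)).trans finSuccEquivLast.symm

@[simp] theorem extPerm_castSucc {k : ℕ} (σ : Equiv.Perm (Fin k)) (i : Fin k) :
    extPerm σ i.castSucc = (σ i).castSucc := by
  simp [extPerm]

@[simp] theorem extPerm_last {k : ℕ} (σ : Equiv.Perm (Fin k)) :
    extPerm σ (Fin.last k) = Fin.last k := by
  simp [extPerm]

/-- The transposition of the last two elements of `Fin (k + 2)`. -/
def swapLast (k : ℕ) : Equiv.Perm (Fin (k + 2)) :=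
  Equiv.swap (Fin.last (k + 1)) (Fin.castSucc (Fin.last k))

@[simp] theorem swapLast_castSucc_castSucc {k : ℕ} (i : Fin k) :
    swapLast k i.castSucc.castSucc = i.castSucc.castSucc := by
  refine Equiv.swap_apply_of_ne_of_ne (Fin.castSucc_lt_last _).ne ?_
  exact fun h => (Fin.castSucc_lt_last i).ne (Fin.castSucc_injective _ h)

@[simp] theorem swapLast_castSucc_last {k : ℕ} :
    swapLast k (Fin.last k).castSucc = Fin.last (k + 1) := Equiv.swap_apply_right _ _

@[simp] theorem swapLast_last {k : ℕ} :
    swapLast k (Fin.last (k + 1)) = (Fin.last k).castSucc := Equiv.swap_apply_left _ _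

/-- Collision operators in the interaction picture, `op k i s : E (k+1) → E k` contracting the two
new particles with particle `i` at time `s`, together with the action of the permutations of the
particles. -/
structure CollisionFamily (E : ℕ → Type) [∀ k, NormedAddCommGroup (E k)]
    [∀ k, NormedSpace ℂ (E k)] where
  op : ∀ k, Idx k → ℝ → E (k + 1) →L[ℂ] E k
  perm : ∀ k, Equiv.Perm (Fin k) → Equiv.Perm (Fin k) → E k →L[ℂ] E k
  continuous_op : ∀ k i, Continuous fun p : ℝ × E (k + 1) => op k i p.1 p.2
  perm_op : ∀ k σ τ i s x,
    perm k σ τ (op k i s x) = op k (Sum.map σ τ i) s (perm (k + 1) (extPerm σ) (extPerm τ) x)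
  -- The two orders of contraction append their pairs of new particles in opposite order. `swapLast`
  -- corrects this and becomes invisible on symmetric data.
  op_comm : ∀ k i j, i ≠ j → ∀ r s x, op k i r (op (k + 1) (up j) s x) =
    op k j s (op (k + 1) (up i) r (perm (k + 2) (swapLast k) (swapLast k) x))

variable {E : ℕ → Type} [∀ k, NormedAddCommGroup (E k)] [∀ k, NormedSpace ℂ (E k)]

namespace CollisionFamily

variable (A : CollisionFamily E)

/-- The term of order `n` of the Duhamel expansion from time `s₀` on, where particle `i` evolves up
to its own time `τ i`. -/
def multi (s₀ : ℝ) (f : ∀ k, E k) : ℕ → ∀ k : ℕ, (Idx k → ℝ) → E k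
  | 0, k, _ => f k
  | n + 1, k, τ => ∑ i, ∫ s in s₀..τ i,
      -- Collision times decrease along the expansion, so after a collision at `s` all particles,
      -- the two new ones included, may collide only before `s`. Unequal times are what allows the
      -- particles to be treated one at a time.
      A.op k i s (multi s₀ f n (k + 1) (snoc2 (fun j => min (τ j) s) s s))

theorem multi_zero (s₀ : ℝ) (f : ∀ k, E k) (k : ℕ) (τ : Idx k → ℝ) :
    A.multi s₀ f 0 k τ = f k := rfl

theorem multi_succ (s₀ : ℝ) (f : ∀ k, E k) (n k : ℕ) (τ : Idx k → ℝ) :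
    A.multi s₀ f (n + 1) k τ = ∑ i, ∫ s in s₀..τ i,
      A.op k i s (A.multi s₀ f n (k + 1) (snoc2 (fun j => min (τ j) s) s s)) := rfl

/-- Continuity jointly in the initial time, the data and the times is needed because later the data
are sources released at a variable initial time, and measurability in that time is deduced from it.
-/
theorem continuous_multi (n : ℕ) : ∀ k : ℕ, Continuous fun q : (ℝ × (∀ k, E k)) × (Idx k → ℝ) =>
    A.multi q.1.1 q.1.2 n k q.2 := by
  induction n with
  | zero =>
    intro k
    simp only [multi_zero]
    fun_prop
  | succ n ih =>
    intro k
    simp only [multi_succ]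
    refine continuous_finsetSum _ fun i _ => ?_
    have hG : Continuous (Function.uncurry
        fun (q : (ℝ × (∀ k, E k)) × (Idx k → ℝ)) (s : ℝ) => A.op k i s
          (A.multi q.1.1 q.1.2 n (k + 1) (snoc2 (fun j => min (q.2 j) s) s s))) := by
      refine (A.continuous_op k i).comp (continuous_snd.prodMk ((ih (k + 1)).comp
        ((continuous_fst.comp continuous_fst).prodMk ?_)))
      exact continuous_snoc2 (x := fun (y : ((ℝ × (∀ k, E k)) × (Idx k → ℝ)) × ℝ) j =>
        min (y.1.2 j) y.2) (by fun_prop) continuous_snd continuous_snd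
    have h1 : ∀ q : (ℝ × (∀ k, E k)) × (Idx k → ℝ), (∫ s in q.1.1..q.2 i, A.op k i s
          (A.multi q.1.1 q.1.2 n (k + 1) (snoc2 (fun j => min (q.2 j) s) s s))) =
        (∫ s in (0 : ℝ)..q.2 i, A.op k i s
          (A.multi q.1.1 q.1.2 n (k + 1) (snoc2 (fun j => min (q.2 j) s) s s))) -
        ∫ s in (0 : ℝ)..q.1.1, A.op k i s
          (A.multi q.1.1 q.1.2 n (k + 1) (snoc2 (fun j => min (q.2 j) s) s s)) := by
      intro q
      have hq : Continuous fun s => A.op k i s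
          (A.multi q.1.1 q.1.2 n (k + 1) (snoc2 (fun j => min (q.2 j) s) s s)) :=
        hG.comp (Continuous.prodMk_right q)
      exact (intervalIntegral.integral_interval_sub_left (hq.intervalIntegrable _ _)
        (hq.intervalIntegrable _ _)).symm
    simp only [h1]
    exact (intervalIntegral.continuous_parametric_intervalIntegral_of_continuous hG
      (by fun_prop)).sub (intervalIntegral.continuous_parametric_intervalIntegral_of_continuous hG
      (by fun_prop))

theorem continuous_multi_time (s₀ : ℝ) (f : ∀ k, E k) (n k : ℕ) :
    Continuous fun τ : Idx k → ℝ => A.multi s₀ f n k τ :=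
  (A.continuous_multi n k).comp (Continuous.prodMk_right (s₀, f))

theorem continuous_op_comp {X : Type*} [TopologicalSpace X] {k : ℕ} (i : Idx k) {s : X → ℝ}
    {g : X → E (k + 1)} (hs : Continuous s) (hg : Continuous g) :
    Continuous fun y => A.op k i (s y) (g y) :=
  (A.continuous_op k i).comp (hs.prodMk hg)

theorem continuous_integrand (s₀ : ℝ) (f : ∀ k, E k) (n k : ℕ) (τ : Idx k → ℝ) (i : Idx k) :
    Continuous fun s => A.op k i s
      (A.multi s₀ f n (k + 1) (snoc2 (fun j => min (τ j) s) s s)) :=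
  A.continuous_op_comp i continuous_id ((A.continuous_multi_time s₀ f n (k + 1)).comp
    (continuous_snoc2 (by fun_prop) continuous_id continuous_id))

/-- A sequence that is invariant under the permutations of the particles. -/
def Symm (f : ∀ k, E k) : Prop := ∀ k σ τ, A.perm k σ τ (f k) = f k

theorem snoc2_comp_extPerm {k : ℕ} (σ σ' : Equiv.Perm (Fin k)) (x : Idx k → ℝ) (a b : ℝ) :
    (snoc2 x a b) ∘ Sum.map (extPerm σ) (extPerm σ') = snoc2 (x ∘ Sum.map σ σ') a b := by
  refine snoc2_ext (fun i => ?_) (by simp) (by simp)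
  rcases i with i | i <;> simp

/-- Symmetry of the data passes to each term as long as the times are permuted along with the
particles: `perm_op` moves the permutation through the collision and the sum over the colliding
particle is reindexed. -/
theorem perm_multi [∀ k, CompleteSpace (E k)] {s₀ : ℝ} {f : ∀ k, E k} (hf : A.Symm f) (n : ℕ) :
    ∀ (k : ℕ) (σ σ' : Equiv.Perm (Fin k)) (τ : Idx k → ℝ),
      A.perm k σ σ' (A.multi s₀ f n k (τ ∘ Sum.map σ σ')) = A.multi s₀ f n k τ := by
  induction n with
  | zero => exact fun k σ σ' _ => hf k σ σ'
  | succ n ih =>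
    intro k σ σ' τ
    rw [multi_succ, multi_succ, map_sum]
    conv_rhs => rw [← Equiv.sum_comp (Equiv.sumCongr σ σ')]
    refine Finset.sum_congr rfl fun i _ => ?_
    rw [← ContinuousLinearMap.intervalIntegral_comp_comm _
      ((A.continuous_integrand s₀ f n k _ i).intervalIntegrable _ _)]
    refine intervalIntegral.integral_congr fun s _ => ?_
    have h := ih (k + 1) (extPerm σ) (extPerm σ') (snoc2 (fun j => min (τ j) s) s s)
    rw [snoc2_comp_extPerm] at h
    exact (A.perm_op k σ σ' i s _).trans (congrArg _ h)

/-- The order `n + 1` term at times `θ`, compared with times stopped at `r`. -/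
theorem multi_succ_sub_min {s₀ r : ℝ} (hr : s₀ ≤ r) (f : ∀ k, E k) (n k : ℕ) {θ : Idx k → ℝ}
    (hθ : ∀ i, s₀ ≤ θ i) :
    A.multi s₀ f (n + 1) k θ = A.multi s₀ f (n + 1) k (fun j => min (θ j) r) +
      ∑ i, ∫ s in min (θ i) r..θ i,
        A.op k i s (A.multi s₀ f n (k + 1) (snoc2 (fun j => min (θ j) s) s s)) := by
  rw [multi_succ, multi_succ, ← Finset.sum_add_distrib]
  refine Finset.sum_congr rfl fun i _ => ?_
  have hc := A.continuous_integrand s₀ f n k θ i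
  rw [← intervalIntegral.integral_add_adjacent_intervals (hc.intervalIntegrable s₀ (min (θ i) r))
    (hc.intervalIntegrable _ _)]
  congr 1
  refine intervalIntegral.integral_congr fun s hs => ?_
  rw [Set.uIcc_of_le (le_min (hθ i) hr)] at hs
  have hsr : s ≤ r := hs.2.trans (min_le_right _ _)
  simp only [min_assoc, min_eq_right hsr]

end CollisionFamily

/-- Fubini's theorem on a truncated triangle. -/
theorem integral_triangle_swap {F : Type*} [NormedAddCommGroup F] [NormedSpace ℝ F]
    {H : ℝ → ℝ → F} (hH : Continuous (Function.uncurry H)) {s₀ a b : ℝ} (ha : s₀ ≤ a)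
    (hb : s₀ ≤ b) :
    ∫ s in s₀..b, ∫ r in s₀..min a s, H r s = ∫ r in s₀..a, ∫ s in min b r..b, H r s := by
  have hint : Integrable (Function.uncurry fun s r : ℝ =>
      (Set.indicator {q : ℝ × ℝ | q.2 ≤ q.1} (fun q : ℝ × ℝ => H q.2 q.1)) (s, r))
      ((volume.restrict (Set.Ioc s₀ b)).prod (volume.restrict (Set.Ioc s₀ a))) := by
    refine Integrable.indicator ?_ (measurableSet_le measurable_snd measurable_fst)
    rw [Measure.prod_restrict]
    refine IntegrableOn.mono_set ?_ (Set.prod_mono Set.Ioc_subset_Icc_self Set.Ioc_subset_Icc_self)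
    exact (hH.comp continuous_swap).continuousOn.integrableOn_compact
      (isCompact_Icc.prod isCompact_Icc)
  have hsw := integral_integral_swap hint
  rw [intervalIntegral.integral_of_le hb, intervalIntegral.integral_of_le ha]
  have h1 : ∀ s ∈ Set.Ioc s₀ b, ∫ r in s₀..min a s, H r s =
      ∫ r in Set.Ioc s₀ a, (Set.indicator {q : ℝ × ℝ | q.2 ≤ q.1}
        (fun q : ℝ × ℝ => H q.2 q.1)) (s, r) := by
    intro s hs
    rw [intervalIntegral.integral_of_le (le_min ha hs.1.le)]
    have : (fun r => (Set.indicator {q : ℝ × ℝ | q.2 ≤ q.1}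
        (fun q : ℝ × ℝ => H q.2 q.1)) (s, r)) = Set.indicator (Set.Iic s) (fun r => H r s) := by
      ext r
      simp [Set.indicator_apply]
    rw [this, setIntegral_indicator measurableSet_Iic]
    congr 2
    ext r
    simp only [Set.mem_Ioc, Set.mem_inter_iff, Set.mem_Iic, le_min_iff]
    tauto
  have h2 : ∀ r ∈ Set.Ioc s₀ a, ∫ s in min b r..b, H r s =
      ∫ s in Set.Ioc s₀ b, (Set.indicator {q : ℝ × ℝ | q.2 ≤ q.1}
        (fun q : ℝ × ℝ => H q.2 q.1)) (s, r) := by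
    intro r hr
    rw [intervalIntegral.integral_of_le (min_le_left _ _)]
    have : (fun s => (Set.indicator {q : ℝ × ℝ | q.2 ≤ q.1}
        (fun q : ℝ × ℝ => H q.2 q.1)) (s, r)) = Set.indicator (Set.Ici r) (fun s => H r s) := by
      ext s
      simp [Set.indicator_apply]
    rw [this, setIntegral_indicator measurableSet_Ici]
    rcases le_total r b with hrb | hrb
    · rw [min_eq_right hrb]
      refine setIntegral_congr_set (Ioc_ae_eq_Icc.trans ?_)
      refine Eq.eventuallyEq (Set.ext fun s => ?_)
      simp only [Set.mem_Icc, Set.mem_inter_iff, Set.mem_Ioc, Set.mem_Ici]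
      exact ⟨fun h => ⟨⟨hr.1.trans_le h.1, h.2⟩, h.1⟩, fun h => ⟨h.2, h.1.2⟩⟩
    · rw [min_eq_left hrb, Set.Ioc_self]
      refine setIntegral_congr_set ?_
      have : Set.Ioc s₀ b ∩ Set.Ici r ⊆ {b} := fun s hs => le_antisymm hs.1.2 (hrb.trans hs.2)
      exact (ae_eq_empty.2 (measure_mono_null this (by simp))).symm
  rw [setIntegral_congr_fun measurableSet_Ioc h1, setIntegral_congr_fun measurableSet_Ioc h2]
  exact hsw

end

/-! ### Commutation of collisions: running the time of one particle. -/

section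

variable {E : ℕ → Type} [∀ k, NormedAddCommGroup (E k)] [∀ k, NormedSpace ℂ (E k)]

theorem update_snoc2_up {α : Type*} {k : ℕ} (x : Idx k → α) (a b c : α) (i : Idx k) :
    Function.update (snoc2 x a b) (up i) c = snoc2 (Function.update x i c) a b := by
  refine snoc2_ext (fun j => ?_) ?_ ?_
  · by_cases h : j = i
    · subst h; simp
    · simp [Function.update_of_ne (up_injective.ne h), Function.update_of_ne h]
  · rw [Function.update_of_ne (by rcases i with i | i <;> simp [Fin.ext_iff, i.2.ne'])]; simp
  · rw [Function.update_of_ne (by rcases i with i | i <;> simp [Fin.ext_iff, i.2.ne'])]; simp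

theorem min_update {k : ℕ} (x : Idx k → ℝ) (i : Idx k) (c s : ℝ) :
    (fun j => min (Function.update x i c j) s) =
      Function.update (fun j => min (x j) s) i (min c s) := by
  ext j
  by_cases h : j = i
  · subst h; simp
  · simp [Function.update_of_ne h]

theorem min_snoc2 {k : ℕ} (x : Idx k → ℝ) (a b s : ℝ) :
    (fun j => min (snoc2 x a b j) s) = snoc2 (fun j => min (x j) s) (min a s) (min b s) :=
  snoc2_ext (fun i => by simp) (by simp) (by simp)

theorem snoc2_snoc2_comp_swapLast {α : Type*} {k : ℕ} (x : Idx k → α) (a a' b b' : α) :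
    snoc2 (snoc2 x a a') b b' ∘ Sum.map (swapLast k) (swapLast k) =
      snoc2 (snoc2 x b b') a a' := by
  refine snoc2_ext (fun i => ?_) (by simp) (by simp)
  refine Idx.cases (P := fun i => (snoc2 (snoc2 x a a') b b' ∘
    Sum.map (swapLast k) (swapLast k)) (up i) = snoc2 (snoc2 x b b') a a' (up i)) ?_ ?_ ?_ i
  · rintro (i | i) <;> simp
  · simp
  · simp

namespace CollisionFamily

variable (A : CollisionFamily E)

/-- The time of a single particle can be run separately. -/
theorem multi_succ_eq_update [∀ k, CompleteSpace (E k)] {s₀ : ℝ} {f : ∀ k, E k} (hf : A.Symm f) (n : ℕ) :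
    ∀ (k : ℕ) (i : Idx k) (τ : Idx k → ℝ), (∀ j, s₀ ≤ τ j) →
      A.multi s₀ f (n + 1) k τ = A.multi s₀ f (n + 1) k (Function.update τ i s₀) +
        ∫ r in s₀..τ i, A.op k i r
          (A.multi s₀ f n (k + 1) (snoc2 (Function.update τ i r) r r)) := by
  have key : ∀ (m k : ℕ) (i : Idx k) (τ : Idx k → ℝ), A.multi s₀ f (m + 1) k τ =
      (∫ s in s₀..τ i, A.op k i s (A.multi s₀ f m (k + 1) (snoc2 (fun j => min (τ j) s) s s))) +
      ∑ j ∈ Finset.univ.erase i, ∫ s in s₀..τ j, A.op k j s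
        (A.multi s₀ f m (k + 1) (snoc2 (fun j => min (τ j) s) s s)) := by
    intro m k i τ
    rw [multi_succ]
    exact (Finset.add_sum_erase _ _ (Finset.mem_univ i)).symm
  induction n with
  | zero =>
    intro k i τ _
    rw [key 0 k i, key 0 k i, Function.update_self, intervalIntegral.integral_same, zero_add,
      add_comm]
    simp only [multi_zero]
    congr 1
    refine Finset.sum_congr rfl fun j hj => ?_
    rw [Function.update_of_ne (Finset.ne_of_mem_erase hj)]
  | succ n ih =>
    intro k i τ hτ
    rw [key (n + 1) k i, key (n + 1) k i, Function.update_self, intervalIntegral.integral_same,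
      zero_add]
    -- `H j r s` describes a collision of particle `i` at time `r` and one of `j` at a later time
    -- `s`. Both sides of the claim reduce to the same terms and the integrals of `H` over `r < s`,
    -- taken in the two orders of integration; Fubini on the truncated triangle concludes.
    set H : Idx k → ℝ → ℝ → E k := fun j r s => A.op k j s (A.op (k + 1) (up i) r
      (A.multi s₀ f n (k + 2)
        (snoc2 (snoc2 (Function.update (fun j => min (τ j) s) i r) s s) r r))) with hH
    have hcont0 : ∀ m : ℕ, Continuous fun q : ℝ × ℝ => A.op (k + 1) (up i) q.1
        (A.multi s₀ f m (k + 2)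
          (snoc2 (snoc2 (Function.update (fun j => min (τ j) q.2) i q.1) q.2 q.2) q.1 q.1)) := by
      intro m
      refine A.continuous_op_comp _ continuous_fst
        ((A.continuous_multi_time s₀ f m (k + 2)).comp ?_)
      exact continuous_snoc2 (continuous_snoc2 (Continuous.update (by fun_prop) i continuous_fst)
        continuous_snd continuous_snd) continuous_fst continuous_fst
    have hHc : ∀ j, Continuous (Function.uncurry (H j)) := fun j =>
      A.continuous_op_comp j continuous_snd (hcont0 n)
    -- If the latest collision is one of `j ≠ i` at time `s`, the induction hypothesis for particle
    -- `up i` splits off the collision of `i` at some `r` below `s`.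
    have c1 : ∀ j ∈ Finset.univ.erase i,
        (∫ s in s₀..τ j, A.op k j s
          (A.multi s₀ f (n + 1) (k + 1) (snoc2 (fun j => min (τ j) s) s s))) =
        (∫ s in s₀..Function.update τ i s₀ j, A.op k j s
          (A.multi s₀ f (n + 1) (k + 1)
            (snoc2 (fun j => min (Function.update τ i s₀ j) s) s s))) +
        ∫ s in s₀..τ j, ∫ r in s₀..min (τ i) s, H j r s := by
      intro j hj
      have hin : Continuous fun s => ∫ r in s₀..min (τ i) s, H j r s :=
        intervalIntegral.continuous_parametric_intervalIntegral_of_continuous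
          (f := fun s r => H j r s) ((hHc j).comp continuous_swap) (by fun_prop)
      rw [Function.update_of_ne (Finset.ne_of_mem_erase hj), ← intervalIntegral.integral_add
        ((A.continuous_integrand s₀ f (n + 1) k (Function.update τ i s₀) j).intervalIntegrable _ _)
        (hin.intervalIntegrable _ _)]
      refine intervalIntegral.integral_congr fun s hs => ?_
      rw [Set.uIcc_of_le (hτ j)] at hs
      have h := ih (k + 1) (up i) (snoc2 (fun j => min (τ j) s) s s) (fun l =>
        Idx.cases (P := fun l => s₀ ≤ snoc2 (fun j => min (τ j) s) s s l)
          (fun l => by simpa using ⟨hτ l, hs.1⟩) (by simpa using hs.1) (by simpa using hs.1) l)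
      simp only [update_snoc2_up, snoc2_up] at h
      simp only [h, map_add, min_update, min_eq_left hs.1]
      congr 1
      rw [← ContinuousLinearMap.intervalIntegral_comp_comm]
      exact ((hcont0 n).comp (Continuous.prodMk_left s)).intervalIntegrable _ _
    -- If `i` collides at `r` while the others keep their full times, then, compared with times
    -- stopped at `r`, the excess comes from collisions of some `j ≠ i` at times `s` after `r`.
    -- Commutation moves that later collision to the outside.
    have c2 : ∫ r in s₀..τ i, A.op k i r
          (A.multi s₀ f (n + 1) (k + 1) (snoc2 (Function.update τ i r) r r)) =
        (∫ s in s₀..τ i, A.op k i s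
          (A.multi s₀ f (n + 1) (k + 1) (snoc2 (fun j => min (τ j) s) s s))) +
        ∑ j ∈ Finset.univ.erase i, ∫ r in s₀..τ i, ∫ s in min (τ j) r..τ j, H j r s := by
      have hHi : ∀ j, Continuous fun r => ∫ s in min (τ j) r..τ j, H j r s := by
        intro j
        have : ∀ r, ∫ s in min (τ j) r..τ j, H j r s = -∫ s in τ j..min (τ j) r, H j r s :=
          fun r => intervalIntegral.integral_symm _ _
        simp only [this]
        exact (intervalIntegral.continuous_parametric_intervalIntegral_of_continuous
            (hHc j) (by fun_prop)).neg
      rw [← intervalIntegral.integral_finsetSum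
        (fun j _ => (hHi j).intervalIntegrable _ _), ← intervalIntegral.integral_add
        ((A.continuous_integrand s₀ f (n + 1) k _ i).intervalIntegrable _ _)
        (Continuous.intervalIntegrable (continuous_finsetSum _ fun j _ => hHi j) _ _)]
      refine intervalIntegral.integral_congr fun r hr => ?_
      rw [Set.uIcc_of_le (hτ i)] at hr
      have hmin : min (τ i) r = r := min_eq_right hr.2
      have h := A.multi_succ_sub_min hr.1 f n (k + 1) (θ := snoc2 (Function.update τ i r) r r)
        (fun l => Idx.cases (P := fun l => s₀ ≤ snoc2 (Function.update τ i r) r r l)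
          (fun l => by
            by_cases hl : l = i
            · subst hl; simpa using hr.1
            · simpa [Function.update_of_ne hl] using hτ l)
          (by simpa using hr.1) (by simpa using hr.1) l)
      have h0 : (fun j => min (snoc2 (Function.update τ i r) r r j) r) =
          snoc2 (fun j => min (τ j) r) r r := by
        rw [min_snoc2, min_update, min_self]
        congr 1
        rw [Function.update_eq_self_iff, hmin]
      rw [h0] at h
      simp only [h, map_add, sum_idx_succ, snoc2_up, snoc2_inl_last, snoc2_inr_last, min_self,
        intervalIntegral.integral_same, add_zero, map_sum]
      congr 1
      rw [← Finset.add_sum_erase _ _ (Finset.mem_univ i), Function.update_self, min_self,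
        intervalIntegral.integral_same, map_zero, zero_add]
      refine Finset.sum_congr rfl fun j hj => ?_
      have hji := Finset.ne_of_mem_erase hj
      rw [Function.update_of_ne hji, ← ContinuousLinearMap.intervalIntegral_comp_comm _
        ((A.continuous_integrand s₀ f n (k + 1) _ (up j)).intervalIntegrable _ _)]
      rcases le_total (τ j) r with hjr | hjr
      · rw [min_eq_left hjr, intervalIntegral.integral_same, intervalIntegral.integral_same]
      · rw [min_eq_right hjr]
        refine intervalIntegral.integral_congr fun s hs => ?_
        rw [Set.uIcc_of_le hjr] at hs
        simp only [hH]
        -- The swap of the two new pairs is absorbed by the symmetry of the data.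
        rw [A.op_comm k i j hji.symm, min_snoc2, min_update, min_eq_left hs.1,
          ← A.perm_multi hf n (k + 2) (swapLast k) (swapLast k)
            (snoc2 (snoc2 (Function.update (fun j => min (τ j) s) i r) s s) r r),
          snoc2_snoc2_comp_swapLast]
    rw [c2, Finset.sum_congr rfl c1, Finset.sum_add_distrib,
      Finset.sum_congr rfl fun j _ => integral_triangle_swap (hHc j) (hτ i) (hτ j)]
    abel

theorem multi_succ_base (s₀ : ℝ) (f : ∀ k, E k) (n k : ℕ) :
    A.multi s₀ f (n + 1) k (fun _ => s₀) = 0 := by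
  simp [multi_succ]

/-- At equal times all truncations agree and the usual time-ordered Duhamel recursion remains. -/
theorem multi_succ_diag {s₀ r : ℝ} (hr : s₀ ≤ r) (f : ∀ k, E k) (n k : ℕ) :
    A.multi s₀ f (n + 1) k (fun _ => r) =
      ∫ s in s₀..r, ∑ i, A.op k i s (A.multi s₀ f n (k + 1) (fun _ => s)) := by
  have hc : ∀ i, Continuous fun s => A.op k i s (A.multi s₀ f n (k + 1) (fun _ => s)) := fun i =>
    A.continuous_op_comp i continuous_id ((A.continuous_multi_time s₀ f n (k + 1)).comp
      (by fun_prop))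
  rw [multi_succ, intervalIntegral.integral_finsetSum
    fun i _ => (hc i).intervalIntegrable _ _]
  refine Finset.sum_congr rfl fun i _ => intervalIntegral.integral_congr fun s hs => ?_
  rw [Set.uIcc_of_le hr] at hs
  simp only [min_eq_right hs.2]
  congr 2
  exact snoc2_ext (by simp) (by simp) (by simp)

end CollisionFamily

end

/-! ### Exponential bound for the Duhamel terms. -/

section

variable {E : ℕ → Type} [∀ k, NormedAddCommGroup (E k)] [∀ k, NormedSpace ℂ (E k)]

namespace CollisionFamily

variable (A : CollisionFamily E) [∀ k, CompleteSpace (E k)]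

/-- Uniform bound on the Duhamel terms. The factor is exponential in `n`, although the number of
terms of the expansion is factorial. -/
theorem lintegral_multi_le {s₀ b : ℝ} {f : ∀ k, E k} (hf : A.Symm f) {c : ℝ≥0∞}
    (hop : ∀ k i x, ∫⁻ r in Set.Ioc s₀ b, ‖A.op k i r x‖ₑ ≤ c * ‖x‖ₑ)
    {G : Type} [NormedAddCommGroup G] [NormedSpace ℂ G] [CompleteSpace G] (n : ℕ) :
    ∀ (k : ℕ) (S : Finset (Idx k)) {α : Type} [TopologicalSpace α] [SecondCountableTopology α]
      [MeasurableSpace α] [BorelSpace α] (μ : Measure α) [SFinite μ] (K : α → E k →L[ℂ] G)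
      (κ : ℝ≥0∞) (τ : α → Idx k → ℝ), (Continuous fun p : α × E k => K p.1 p.2) →
      (∀ x, ∫⁻ ω, ‖K ω x‖ₑ ∂μ ≤ κ * ‖x‖ₑ) → Continuous τ →
      (∀ ω j, s₀ ≤ τ ω j ∧ τ ω j ≤ b) → (∀ ω, ∀ j ∉ S, τ ω j = s₀) →
      ∫⁻ ω, ‖K ω (A.multi s₀ f n k (τ ω))‖ₑ ∂μ ≤
        κ * 2 ^ S.card * (8 * c) ^ n * ‖f (k + n)‖ₑ := by
  -- Collision operators that have been split off are absorbed into the outer family `K`, and their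
  -- times into the parameter space. In the end the whole product acts on the constant vector `f (k
  -- + n)`, which is why an estimate for fixed vectors is enough.
  induction n with
  | zero =>
    intro k S α _ _ _ _ μ _ K κ τ hK hκ _ _ _
    refine (hκ _).trans ?_
    rw [pow_zero, mul_one]
    exact mul_le_mul' (le_mul_of_one_le_right' (one_le_pow₀ one_le_two)) le_rfl
  | succ n ih =>
    intro k S α _ _ _ _ μ _ K κ τ hK hκ
    -- `S` contains the particles whose time still runs. Either `i` is frozen at `s₀`, or it
    -- collides, and then `i` and two new particles run besides `S`. The resulting recursion `a(n+1,
    -- s+1) ≤ a(n+1, s) + c a(n, s+3)` is solved by `2^s (8c)^n`.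
    induction S using Finset.induction_on generalizing τ with
    | empty =>
      intro _ _ hS
      have : ∀ ω, τ ω = fun _ => s₀ := fun ω => funext fun j => hS ω j (by simp)
      simp [this, multi_succ_base]
    | insert i S hi ihS =>
      intro hτc hτ hS
      have hτi : Continuous fun ω => τ ω i := (continuous_apply i).comp hτc
      -- Clamping to `[s₀, b]` makes the hypotheses on the times hold for all real `r`; on the
      -- domain of integration it changes nothing.
      set cl : ℝ → ℝ := fun r => max s₀ (min r b) with hcl
      have hclc : Continuous cl := by fun_prop
      set θ : α × ℝ → Idx (k + 1) → ℝ := fun q =>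
        snoc2 (Function.update (τ q.1) i (cl q.2)) (cl q.2) (cl q.2) with hθ
      have hθc : Continuous θ := continuous_snoc2
        ((hτc.comp continuous_fst).update i (hclc.comp continuous_snd))
        (hclc.comp continuous_snd) (hclc.comp continuous_snd)
      set K' : α × ℝ → E (k + 1) →L[ℂ] G := fun q => (K q.1).comp (A.op k i q.2) with hK'
      have hK'c : Continuous fun p : (α × ℝ) × E (k + 1) => K' p.1 p.2 :=
        hK.comp ((continuous_fst.comp continuous_fst).prodMk
          (A.continuous_op_comp i (continuous_snd.comp continuous_fst) continuous_snd))
      have hK'F : Continuous fun q : α × ℝ => K' q (A.multi s₀ f n (k + 1) (θ q)) :=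
        hK'c.comp (continuous_id.prodMk ((A.continuous_multi_time s₀ f n (k + 1)).comp hθc))
      have hpt : ∀ ω, ‖K ω (A.multi s₀ f (n + 1) k (τ ω))‖ₑ ≤
          ‖K ω (A.multi s₀ f (n + 1) k (Function.update (τ ω) i s₀))‖ₑ +
          ∫⁻ r in Set.Ioc s₀ b, ‖K' (ω, r) (A.multi s₀ f n (k + 1) (θ (ω, r)))‖ₑ := by
        intro ω
        have hc : Continuous fun r => A.op k i r
            (A.multi s₀ f n (k + 1) (snoc2 (Function.update (τ ω) i r) r r)) :=
          A.continuous_op_comp i continuous_id ((A.continuous_multi_time s₀ f n (k + 1)).comp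
            (continuous_snoc2 (continuous_const.update i continuous_id) continuous_id
              continuous_id))
        rw [A.multi_succ_eq_update hf n k i (τ ω) (fun j => (hτ ω j).1), map_add]
        refine (enorm_add_le _ _).trans (add_le_add le_rfl ?_)
        rw [← ContinuousLinearMap.intervalIntegral_comp_comm _ (hc.intervalIntegrable _ _),
          intervalIntegral.integral_of_le (hτ ω i).1]
        refine (enorm_integral_le_lintegral_enorm _).trans ?_
        refine (lintegral_mono_set (Set.Ioc_subset_Ioc_right (hτ ω i).2)).trans_eq ?_
        refine setLIntegral_congr_fun measurableSet_Ioc fun r hr => ?_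
        have : cl r = r := by
          simp only [hcl, min_eq_left hr.2, max_eq_right hr.1.le]
        simp only [hK', hθ, this, ContinuousLinearMap.comp_apply]
      have hK'κ : ∀ x, ∫⁻ q, ‖K' q x‖ₑ ∂(μ.prod (volume.restrict (Set.Ioc s₀ b))) ≤
          κ * c * ‖x‖ₑ := by
        intro x
        have hm : Measurable fun q : α × ℝ => ‖K' q x‖ₑ :=
          (hK'c.comp (Continuous.prodMk_left x)).enorm.measurable
        rw [lintegral_prod_symm' _ hm]
        calc _ ≤ ∫⁻ r in Set.Ioc s₀ b, κ * ‖A.op k i r x‖ₑ :=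
              lintegral_mono fun r => hκ _
          _ = κ * ∫⁻ r in Set.Ioc s₀ b, ‖A.op k i r x‖ₑ :=
              lintegral_const_mul _
                (A.continuous_op_comp i continuous_id continuous_const).enorm.measurable
          _ ≤ κ * (c * ‖x‖ₑ) := by gcongr; exact hop k i x
          _ = _ := by ring
      have hup : ∀ ω j, s₀ ≤ Function.update (τ ω) i s₀ j ∧
          Function.update (τ ω) i s₀ j ≤ b := by
        intro ω j
        by_cases h : j = i
        · subst h; simpa using (hτ ω j).1.trans (hτ ω j).2
        · simpa [Function.update_of_ne h] using hτ ω j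
      have h1 := ihS (fun ω => Function.update (τ ω) i s₀) (hτc.update i continuous_const) hup
        (fun ω j hj => by
          by_cases h : j = i
          · subst h; simp
          · simpa [Function.update_of_ne h] using hS ω j (by simp [h, hj]))
      set S' : Finset (Idx (k + 1)) := (insert i S).map ⟨up, up_injective⟩ ∪
        {Sum.inl (Fin.last k), Sum.inr (Fin.last k)} with hS'
      have hcard : S'.card ≤ S.card + 3 := by
        refine (Finset.card_union_le _ _).trans ?_
        rw [Finset.card_map, Finset.card_insert_of_notMem hi]
        have := Finset.card_le_two (a := (Sum.inl (Fin.last k) : Idx (k + 1)))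
          (b := Sum.inr (Fin.last k))
        omega
      have hclb : ∀ ω r, s₀ ≤ cl r ∧ cl r ≤ b := fun ω r =>
        ⟨le_max_left _ _, max_le ((hτ ω i).1.trans (hτ ω i).2) (min_le_right _ _)⟩
      have h2 := ih (k + 1) S' (μ.prod (volume.restrict (Set.Ioc s₀ b))) K' (κ * c) θ hK'c hK'κ
        hθc (fun q j => Idx.cases (P := fun j => s₀ ≤ θ q j ∧ θ q j ≤ b)
          (fun j => by
            by_cases h : j = i
            · subst h; simpa [hθ] using hclb q.1 q.2
            · simpa [hθ, Function.update_of_ne h] using hτ q.1 j)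
          (by simpa [hθ] using hclb q.1 q.2) (by simpa [hθ] using hclb q.1 q.2) j)
        (fun q j => Idx.cases (P := fun j => j ∉ S' → θ q j = s₀)
          (fun j hj => by
            have hj' : j ∉ insert i S := fun h => hj (Finset.mem_union_left _
              (Finset.mem_map_of_mem ⟨up, up_injective⟩ h))
            have : j ≠ i := fun h => hj' (h ▸ Finset.mem_insert_self _ _)
            simpa [hθ, Function.update_of_ne this] using hS q.1 j hj')
          (fun h => absurd (Finset.mem_union_right _ (by simp)) h)
          (fun h => absurd (Finset.mem_union_right _ (by simp)) h) j)
      rw [lintegral_prod _ hK'F.enorm.measurable.aemeasurable] at h2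
      have hidx : ‖f (k + 1 + n)‖ₑ = ‖f (k + (n + 1))‖ₑ :=
        congrArg (fun m => ‖f m‖ₑ) (by omega)
      calc _ ≤ ∫⁻ ω, (‖K ω (A.multi s₀ f (n + 1) k (Function.update (τ ω) i s₀))‖ₑ +
          ∫⁻ r in Set.Ioc s₀ b, ‖K' (ω, r) (A.multi s₀ f n (k + 1) (θ (ω, r)))‖ₑ) ∂μ :=
            lintegral_mono hpt
        _ = _ := lintegral_add_left (hK.comp (continuous_id.prodMk
            ((A.continuous_multi_time s₀ f (n + 1) k).comp
              (hτc.update i continuous_const)))).enorm.measurable _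
        _ ≤ κ * 2 ^ S.card * (8 * c) ^ (n + 1) * ‖f (k + (n + 1))‖ₑ +
            κ * c * 2 ^ (S.card + 3) * (8 * c) ^ n * ‖f (k + (n + 1))‖ₑ := by
          refine add_le_add h1 (h2.trans ?_)
          rw [hidx]
          gcongr
          exact one_le_two
        _ = _ := by
          rw [Finset.card_insert_of_notMem hi]
          ring

end CollisionFamily

end

/-! ### Sources that are integrable in time, and operators on them. -/

section

/-- Lebesgue measure on the time interval `(a, b]`. -/
abbrev timeMeasure (a b : ℝ) : Measure ℝ := volume.restrict (Set.Ioc a b)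

/-- Integrable functions of time with values in the `k`-th space. -/
abbrev Source (E : ℕ → Type) [∀ k, NormedAddCommGroup (E k)] (a b : ℝ) (k : ℕ) : Type :=
  Lp (E k) 1 (timeMeasure a b)

theorem norm_le_of_enorm_le_mul {F G : Type*} [NormedAddCommGroup F] [NormedAddCommGroup G]
    {x : F} {y : G} {c : ℝ≥0} (h : ‖x‖ₑ ≤ c * ‖y‖ₑ) : ‖x‖ ≤ c * ‖y‖ := by
  rw [enorm_eq_nnnorm, enorm_eq_nnnorm] at h
  exact_mod_cast h

section primitive

variable {F G : Type} [NormedAddCommGroup F] [NormedSpace ℂ F] [NormedAddCommGroup G]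
  [NormedSpace ℂ G] {a b : ℝ}

/-- The primitive of an integrable function of time. -/
def primitive (e : Lp F 1 (timeMeasure a b)) (r : ℝ) : F := ∫ s in a..r, e s ∂(timeMeasure a b)

theorem intervalIntegrable_coe (e : Lp F 1 (timeMeasure a b)) (r r' : ℝ) :
    IntervalIntegrable e (timeMeasure a b) r r' :=
  (L1.integrable_coeFn e).intervalIntegrable

theorem continuous_primitive (e : Lp F 1 (timeMeasure a b)) : Continuous (primitive e) :=
  intervalIntegral.continuous_primitive (intervalIntegrable_coe e) a

theorem primitive_add (e e' : Lp F 1 (timeMeasure a b)) (r : ℝ) :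
    primitive (e + e') r = primitive e r + primitive e' r := by
  rw [primitive, primitive, primitive, ← intervalIntegral.integral_add
    (intervalIntegrable_coe e _ _) (intervalIntegrable_coe e' _ _)]
  refine intervalIntegral.integral_congr_ae ?_
  filter_upwards [Lp.coeFn_add e e'] with s hs _ using hs

theorem primitive_smul (z : ℂ) (e : Lp F 1 (timeMeasure a b)) (r : ℝ) :
    primitive (z • e) r = z • primitive e r := by
  rw [primitive, primitive, ← intervalIntegral.integral_smul]
  refine intervalIntegral.integral_congr_ae ?_
  filter_upwards [Lp.coeFn_smul z e] with s hs _ using hs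

theorem enorm_eq_lintegral (e : Lp F 1 (timeMeasure a b)) :
    ‖e‖ₑ = ∫⁻ s in Set.Ioc a b, ‖e s‖ₑ := by
  rw [Lp.enorm_def, eLpNorm_one_eq_lintegral_enorm]

theorem enorm_primitive_le (e : Lp F 1 (timeMeasure a b)) {r : ℝ} (hr : a ≤ r) :
    ‖primitive e r‖ₑ ≤ ∫⁻ s in Set.Ioc a r, ‖e s‖ₑ ∂(timeMeasure a b) := by
  rw [primitive, intervalIntegral.integral_of_le hr]
  exact enorm_integral_le_lintegral_enorm _

theorem norm_primitive_le (e : Lp F 1 (timeMeasure a b)) {r : ℝ} (hr : a ≤ r) :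
    ‖primitive e r‖ ≤ ‖e‖ := by
  rw [← enorm_le_iff_norm_le]
  refine (enorm_primitive_le e hr).trans ?_
  rw [enorm_eq_lintegral]
  exact setLIntegral_le_lintegral _ _

variable [CompleteSpace F] [CompleteSpace G]

theorem map_primitive (D : F →L[ℂ] G) (e : Lp F 1 (timeMeasure a b)) (r : ℝ) :
    D (primitive e r) = ∫ s in a..r, D (e s) ∂(timeMeasure a b) :=
  (D.intervalIntegral_comp_comm (intervalIntegrable_coe e _ _)).symm

/-- A family of operators, applied to the primitive of a source. -/
theorem lintegral_op_primitive_le {D : ℝ → F →L[ℂ] G} (hD : Continuous fun p : ℝ × F => D p.1 p.2)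
    (e : Lp F 1 (timeMeasure a b)) :
    ∫⁻ r in Set.Ioc a b, ‖D r (primitive e r)‖ₑ ≤
      ∫⁻ s in Set.Ioc a b, ∫⁻ r in Set.Ioc a b, ‖D r (e s)‖ₑ := by
  have hm : StronglyMeasurable (Function.uncurry fun r s : ℝ => D r (e s)) :=
    hD.comp_stronglyMeasurable (measurable_fst.stronglyMeasurable.prodMk
      ((Lp.stronglyMeasurable e).comp_measurable measurable_snd))
  rw [← lintegral_lintegral_swap hm.enorm.aemeasurable]
  refine setLIntegral_mono' measurableSet_Ioc fun r hr => ?_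
  rw [map_primitive, intervalIntegral.integral_of_le hr.1.le]
  -- Dropping the constraint `s ≤ r` leaves, for each `s`, the family `D r` applied to the fixed
  -- vector `e s`.
  exact (enorm_integral_le_lintegral_enorm _).trans (setLIntegral_le_lintegral _ _)

/-- The operator `e ↦ D(r) ∫_a^r e(s) ds` on sources, for a strongly continuous family `D`. -/
def primitiveOp (a b : ℝ) (D : ℝ → F →L[ℂ] G) (hD : Continuous fun p : ℝ × F => D p.1 p.2)
    (c : ℝ≥0) (hc : ∀ x, ∫⁻ r in Set.Ioc a b, ‖D r x‖ₑ ≤ c * ‖x‖ₑ) :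
    Lp F 1 (timeMeasure a b) →L[ℂ] Lp G 1 (timeMeasure a b) :=
  have hint : ∀ e : Lp F 1 (timeMeasure a b),
      Integrable (fun r => D r (primitive e r)) (timeMeasure a b) := fun e =>
    (hD.comp (continuous_id.prodMk (continuous_primitive e))).integrableOn_Ioc
  LinearMap.mkContinuous
    { toFun := fun e => (hint e).toL1 _
      map_add' := fun e e' => by
        rw [← Integrable.toL1_add]
        congr 1
        ext r
        simp [primitive_add]
      map_smul' := fun z e => by
        rw [RingHom.id_apply, ← Integrable.toL1_smul]
        congr 1
        ext r
        simp [primitive_smul] } c (fun e => by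
      refine norm_le_of_enorm_le_mul ?_
      rw [enorm_eq_lintegral, enorm_eq_lintegral e]
      calc _ = ∫⁻ r in Set.Ioc a b, ‖D r (primitive e r)‖ₑ := lintegral_congr_ae (by
            filter_upwards [Integrable.coeFn_toL1 (hint e)] with r hr
            rw [← hr]; rfl)
        _ ≤ _ := lintegral_op_primitive_le hD e
        _ ≤ ∫⁻ s in Set.Ioc a b, c * ‖e s‖ₑ := lintegral_mono fun s => hc _
        _ = c * ∫⁻ s in Set.Ioc a b, ‖e s‖ₑ :=
            lintegral_const_mul _ (Lp.stronglyMeasurable e).enorm)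

theorem primitiveOp_ae_eq {D : ℝ → F →L[ℂ] G} (hD : Continuous fun p : ℝ × F => D p.1 p.2)
    {c : ℝ≥0} (hc : ∀ x, ∫⁻ r in Set.Ioc a b, ‖D r x‖ₑ ≤ c * ‖x‖ₑ)
    (e : Lp F 1 (timeMeasure a b)) :
    primitiveOp a b D hD c hc e =ᵐ[timeMeasure a b] fun r => D r (primitive e r) :=
  Integrable.coeFn_toL1 (hD.comp (continuous_id.prodMk (continuous_primitive e))).integrableOn_Ioc

theorem norm_primitiveOp_le {D : ℝ → F →L[ℂ] G} (hD : Continuous fun p : ℝ × F => D p.1 p.2)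
    {c : ℝ≥0} (hc : ∀ x, ∫⁻ r in Set.Ioc a b, ‖D r x‖ₑ ≤ c * ‖x‖ₑ) :
    ‖primitiveOp a b D hD c hc‖ ≤ c := by
  unfold primitiveOp
  exact LinearMap.mkContinuous_norm_le _ c.2 _

/-- The function `r ↦ D(r) x` as a source. -/
def freeOp (a b : ℝ) (D : ℝ → F →L[ℂ] G) (hD : Continuous fun p : ℝ × F => D p.1 p.2)
    (c : ℝ≥0) (hc : ∀ x, ∫⁻ r in Set.Ioc a b, ‖D r x‖ₑ ≤ c * ‖x‖ₑ) :
    F →L[ℂ] Lp G 1 (timeMeasure a b) :=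
  have hint : ∀ x : F, Integrable (fun r => D r x) (timeMeasure a b) := fun x =>
    (hD.comp (continuous_id.prodMk continuous_const)).integrableOn_Ioc
  LinearMap.mkContinuous
    { toFun := fun x => (hint x).toL1 _
      map_add' := fun x y => by
        rw [← Integrable.toL1_add]
        congr 1
        ext r
        simp
      map_smul' := fun z x => by
        rw [RingHom.id_apply, ← Integrable.toL1_smul]
        congr 1
        ext r
        simp } c (fun x => by
      refine norm_le_of_enorm_le_mul ?_
      rw [enorm_eq_lintegral]
      exact (lintegral_congr_ae (by
            filter_upwards [Integrable.coeFn_toL1 (hint x)] with r hr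
            rw [← hr]; rfl)).trans_le (hc x))

theorem freeOp_ae_eq {D : ℝ → F →L[ℂ] G} (hD : Continuous fun p : ℝ × F => D p.1 p.2)
    {c : ℝ≥0} (hc : ∀ x, ∫⁻ r in Set.Ioc a b, ‖D r x‖ₑ ≤ c * ‖x‖ₑ) (x : F) :
    freeOp a b D hD c hc x =ᵐ[timeMeasure a b] fun r => D r x :=
  Integrable.coeFn_toL1 (hD.comp (continuous_id.prodMk continuous_const)).integrableOn_Ioc

theorem norm_freeOp_le {D : ℝ → F →L[ℂ] G} (hD : Continuous fun p : ℝ × F => D p.1 p.2)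
    {c : ℝ≥0} (hc : ∀ x, ∫⁻ r in Set.Ioc a b, ‖D r x‖ₑ ≤ c * ‖x‖ₑ) :
    ‖freeOp a b D hD c hc‖ ≤ c := by
  unfold freeOp
  exact LinearMap.mkContinuous_norm_le _ c.2 _

end primitive

end

/-! ### Iterated collision operators on sources. -/

section

variable {E : ℕ → Type} [∀ k, NormedAddCommGroup (E k)] [∀ k, NormedSpace ℂ (E k)]
  [∀ k, CompleteSpace (E k)] {a b : ℝ} {c : ℝ≥0}

/-- Iterates of the operator `∑_i B_i` that maps sequences of sources to sequences of sources. -/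
def iterSum (B : ∀ k, Idx k → (Source E a b (k + 1) →L[ℂ] Source E a b k))
    (h : ∀ k, Source E a b k) : ℕ → ∀ k, Source E a b k
  | 0 => h
  | m + 1 => fun k => ∑ i, B k i (iterSum B h m (k + 1))

namespace CollisionFamily

variable (A : CollisionFamily E)

/-- The collision estimate on the time interval `(a, b]` with constant `c`. -/
def Bound (a b : ℝ) (c : ℝ≥0) : Prop :=
  ∀ k i x, ∫⁻ r in Set.Ioc a b, ‖A.op k i r x‖ₑ ≤ c * ‖x‖ₑ

variable {A} in
theorem Bound.mono (hA : A.Bound a b c) {a' b' : ℝ} (ha : a ≤ a') (hb : b' ≤ b) :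
    A.Bound a' b' c := fun k i x =>
  (lintegral_mono_set (Set.Ioc_subset_Ioc ha hb)).trans (hA k i x)

/-- The collision applied last plays the role of the outer family, integrated over its own time. All
`2(k+1)` particles run, whence the factor `2^(2(k+1)) = 4^(k+1)`. -/
theorem lintegral_op_multi_le {s b : ℝ} {f : ∀ k, E k} (hf : A.Symm f) (hA : A.Bound s b c)
    (hsb : s ≤ b) (m k : ℕ) (i : Idx k) :
    ∫⁻ r in Set.Ioc s b, ‖A.op k i r (A.multi s f m (k + 1) (fun _ => r))‖ₑ ≤
      c * 4 ^ (k + 1) * (8 * c) ^ m * ‖f (k + 1 + m)‖ₑ := by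
  have h := A.lintegral_multi_le hf hA (G := E k) m (k + 1) Finset.univ
    (volume.restrict (Set.Ioc s b)) (fun r => A.op k i r) c (fun r _ => max s (min r b))
    (A.continuous_op k i) (hA k i) (by fun_prop)
    (fun r _ => ⟨le_max_left _ _, max_le hsb (min_le_right _ _)⟩)
    (fun _ _ h => absurd (Finset.mem_univ _) h)
  have hcard : (2 : ℝ≥0∞) ^ (Finset.univ : Finset (Idx (k + 1))).card = 4 ^ (k + 1) := by
    rw [Finset.card_univ, Fintype.card_sum, Fintype.card_fin, ← two_mul, pow_mul]
    norm_num
  rw [hcard] at h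
  refine le_trans (le_of_eq ?_) h
  refine setLIntegral_congr_fun measurableSet_Ioc fun r hr => ?_
  simp only [min_eq_left hr.2, max_eq_right hr.1.le]

/-- The pointwise bound is the case of a one-point parameter space with the identity as outer
operator. -/
theorem enorm_multi_le {s r : ℝ} {f : ∀ k, E k} (hf : A.Symm f) (hA : A.Bound s r c)
    (hsr : s ≤ r) (m k : ℕ) :
    ‖A.multi s f m k (fun _ => r)‖ₑ ≤ 4 ^ k * (8 * c) ^ m * ‖f (k + m)‖ₑ := by
  have h := A.lintegral_multi_le hf hA (G := E k) m k Finset.univ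
    (Measure.dirac ()) (fun _ => ContinuousLinearMap.id ℂ (E k)) 1 (fun _ _ => r)
    (by simpa using continuous_snd) (fun x => by simp) continuous_const
    (fun _ _ => ⟨hsr, le_rfl⟩) (fun _ _ h => absurd (Finset.mem_univ _) h)
  have hcard : (2 : ℝ≥0∞) ^ (Finset.univ : Finset (Idx k)).card = 4 ^ k := by
    rw [Finset.card_univ, Fintype.card_sum, Fintype.card_fin, ← two_mul, pow_mul]
    norm_num
  rw [hcard] at h
  simpa using h

/-- The operator `e ↦ A_i(r) ∫_a^r e(s) ds` on sources. -/
def collapse (hA : A.Bound a b c) (k : ℕ) (i : Idx k) :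
    Source E a b (k + 1) →L[ℂ] Source E a b k :=
  primitiveOp a b (A.op k i) (A.continuous_op k i) c (hA k i)

theorem ae_symm {h : ∀ k, Source E a b k}
    (hs : ∀ k σ τ, ∀ᵐ s ∂(timeMeasure a b), A.perm k σ τ (h k s) = h k s) :
    ∀ᵐ s ∂(timeMeasure a b), A.Symm (fun k => h k s) := by
  unfold Symm
  simpa only [ae_all_iff] using hs

/-- The term of order `m` at level `k` depends on the data only through the entry `k + m`. Keeping
just that entry reduces the claim to the joint continuity of `multi` and the measurability of one
source. -/
theorem stronglyMeasurable_multi (h : ∀ k, Source E a b k) (m k : ℕ) :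
    StronglyMeasurable fun q : ℝ × ℝ => A.multi q.1 (fun k => h k q.1) m k (fun _ => q.2) := by
  have hcomp : Continuous fun q : (ℝ × E (k + m)) × (Idx k → ℝ) =>
      A.multi q.1.1 (Function.update 0 (k + m) q.1.2) m k q.2 :=
    (A.continuous_multi m k).comp (((continuous_fst.comp continuous_fst).prodMk
      (continuous_const.update _ (continuous_snd.comp continuous_fst))).prodMk continuous_snd)
  have hdep : ∀ (m k : ℕ) (s : ℝ) (f g : ∀ k, E k) (τ : Idx k → ℝ), f (k + m) = g (k + m) →
      A.multi s f m k τ = A.multi s g m k τ := by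
    intro m
    induction m with
    | zero => exact fun k s f g τ hfg => hfg
    | succ m ih =>
      intro k s f g τ hfg
      have hfg' : f (k + 1 + m) = g (k + 1 + m) := by
        have : k + 1 + m = k + (m + 1) := by omega
        rw [this]; exact hfg
      simp only [multi_succ, ih (k + 1) s f g _ hfg']
  have : (fun q : ℝ × ℝ => A.multi q.1 (fun k => h k q.1) m k (fun _ => q.2)) = fun q =>
      A.multi q.1 (Function.update 0 (k + m) (h (k + m) q.1)) m k (fun _ => q.2) := by
    ext q
    exact hdep m k _ _ _ _ (by simp)
  rw [this]
  exact hcomp.comp_stronglyMeasurable ((measurable_fst.stronglyMeasurable.prodMk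
    ((Lp.stronglyMeasurable (h (k + m))).comp_measurable measurable_fst)).prodMk
    (measurable_pi_lambda _ fun _ => measurable_snd).stronglyMeasurable)

theorem primitive_eq_setIntegral {F : Type} [NormedAddCommGroup F] [NormedSpace ℂ F]
    (e : Lp F 1 (timeMeasure a b)) {r : ℝ} (hr : r ∈ Set.Icc a b) :
    primitive e r = ∫ s in Set.Ioc a r, e s := by
  rw [primitive, intervalIntegral.integral_of_le hr.1, Measure.restrict_restrict measurableSet_Ioc,
    Set.inter_eq_left.2 (Set.Ioc_subset_Ioc_right hr.2)]

theorem integrableOn_multi (hA : A.Bound a b c) {h : ∀ k, Source E a b k}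
    (hs : ∀ k σ τ, ∀ᵐ s ∂(timeMeasure a b), A.perm k σ τ (h k s) = h k s) (m k : ℕ) {r : ℝ}
    (hr : r ∈ Set.Icc a b) :
    IntegrableOn (fun s => A.multi s (fun k => h k s) m k (fun _ => r)) (Set.Ioc a r) := by
  refine ⟨((A.stronglyMeasurable_multi h m k).comp_measurable
    measurable_prodMk_right).aestronglyMeasurable, ?_⟩
  have hsub : Set.Ioc a r ⊆ Set.Ioc a b := Set.Ioc_subset_Ioc_right hr.2
  calc _ ≤ ∫⁻ s in Set.Ioc a r, 4 ^ k * (8 * c) ^ m * ‖h (k + m) s‖ₑ := by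
        refine lintegral_mono_ae ?_
        filter_upwards [ae_restrict_of_ae_restrict_of_subset hsub (A.ae_symm hs),
          ae_restrict_mem measurableSet_Ioc] with s hsym hmem
        exact A.enorm_multi_le hsym (hA.mono hmem.1.le hr.2) hmem.2 m k
    _ = 4 ^ k * (8 * c) ^ m * ∫⁻ s in Set.Ioc a r, ‖h (k + m) s‖ₑ :=
        lintegral_const_mul _ (Lp.stronglyMeasurable _).enorm
    _ < ∞ := by
        refine ENNReal.mul_lt_top (by finiteness) ?_
        exact (lintegral_mono_set hsub).trans_lt (L1.integrable_coeFn (h (k + m))).2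

theorem lintegral_lintegral_op_multi_le (hA : A.Bound a b c) {h : ∀ k, Source E a b k}
    (hs : ∀ k σ τ, ∀ᵐ s ∂(timeMeasure a b), A.perm k σ τ (h k s) = h k s) (m k : ℕ) (i : Idx k) :
    ∫⁻ s in Set.Ioc a b, ∫⁻ r in Set.Ioc s b,
      ‖A.op k i r (A.multi s (fun k => h k s) m (k + 1) (fun _ => r))‖ₑ ≤
      c * 4 ^ (k + 1) * (8 * c) ^ m * ‖h (k + 1 + m)‖ₑ := by
  rw [enorm_eq_lintegral, ← lintegral_const_mul _ (Lp.stronglyMeasurable _).enorm]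
  refine lintegral_mono_ae ?_
  filter_upwards [A.ae_symm hs, ae_restrict_mem measurableSet_Ioc] with s hsym hmem
  exact A.lintegral_op_multi_le hsym (hA.mono hmem.1.le le_rfl) hmem.2 m k i

theorem stronglyMeasurable_op_multi (h : ∀ k, Source E a b k) (m k : ℕ) (i : Idx k) :
    StronglyMeasurable fun q : ℝ × ℝ =>
      A.op k i q.2 (A.multi q.1 (fun k => h k q.1) m (k + 1) (fun _ => q.2)) :=
  (A.continuous_op k i).comp_stronglyMeasurable
    (measurable_snd.stronglyMeasurable.prodMk (A.stronglyMeasurable_multi h m (k + 1)))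

theorem lintegral_triangle_swap {g : ℝ × ℝ → ℝ≥0∞} (hg : Measurable g) :
    ∫⁻ r in Set.Ioc a b, ∫⁻ s in Set.Ioc a r, g (s, r) =
      ∫⁻ s in Set.Ioc a b, ∫⁻ r in Set.Ioc s b, g (s, r) := by
  have hm : Measurable (Set.indicator {q : ℝ × ℝ | q.1 < q.2} g) :=
    hg.indicator (measurableSet_lt measurable_fst measurable_snd)
  have hm' : Measurable (Set.indicator {q : ℝ × ℝ | q.1 ≤ q.2} g) :=
    hg.indicator (measurableSet_le measurable_fst measurable_snd)
  calc _ = ∫⁻ r in Set.Ioc a b, ∫⁻ s in Set.Ioc a b,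
        Set.indicator {q : ℝ × ℝ | q.1 ≤ q.2} g (s, r) := by
        refine setLIntegral_congr_fun measurableSet_Ioc fun r hr => ?_
        have : (fun s => Set.indicator {q : ℝ × ℝ | q.1 ≤ q.2} g (s, r)) =
            Set.indicator (Set.Iic r) (fun s => g (s, r)) := by
          ext s; simp [Set.indicator_apply]
        rw [this, setLIntegral_indicator measurableSet_Iic, Set.inter_comm, Set.Ioc_inter_Iic,
          min_eq_right hr.2]
    _ = ∫⁻ s in Set.Ioc a b, ∫⁻ r in Set.Ioc a b,
        Set.indicator {q : ℝ × ℝ | q.1 ≤ q.2} g (s, r) := by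
        exact lintegral_lintegral_swap (hm'.comp measurable_swap).aemeasurable
    _ = ∫⁻ s in Set.Ioc a b, ∫⁻ r in Set.Ioc s b, g (s, r) := by
        refine setLIntegral_congr_fun measurableSet_Ioc fun s hs => ?_
        have : (fun r => Set.indicator {q : ℝ × ℝ | q.1 ≤ q.2} g (s, r)) =
            Set.indicator (Set.Ici s) (fun r => g (s, r)) := by
          ext r; simp [Set.indicator_apply]
        rw [this, setLIntegral_indicator measurableSet_Ici]
        refine setLIntegral_congr (EventuallyEq.trans (Eq.eventuallyEq (Set.ext fun r => ?_))
          Ioc_ae_eq_Icc.symm)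
        simp only [Set.mem_inter_iff, Set.mem_Ici, Set.mem_Ioc, Set.mem_Icc]
        exact ⟨fun h => ⟨h.1, h.2.2⟩, fun h => ⟨h.1, hs.1.trans_le h.1, h.2⟩⟩

theorem integral_triangle_swap_of_lintegral {F : Type} [NormedAddCommGroup F] [NormedSpace ℂ F]
    {g : ℝ × ℝ → F} (hg : StronglyMeasurable g)
    (hfin : ∫⁻ s in Set.Ioc a b, ∫⁻ r in Set.Ioc s b, ‖g (s, r)‖ₑ < ∞) :
    IntegrableOn (fun s => ∫ r in Set.Ioc s b, g (s, r)) (Set.Ioc a b) ∧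
    ∫ r in Set.Ioc a b, ∫ s in Set.Ioc a r, g (s, r) =
      ∫ s in Set.Ioc a b, ∫ r in Set.Ioc s b, g (s, r) := by
  have hI : Integrable (Set.indicator {q : ℝ × ℝ | q.1 ≤ q.2} g)
      ((timeMeasure a b).prod (timeMeasure a b)) := by
    have hm : StronglyMeasurable (Set.indicator {q : ℝ × ℝ | q.1 ≤ q.2} g) :=
      hg.indicator (measurableSet_le measurable_fst measurable_snd)
    refine ⟨hm.aestronglyMeasurable, ?_⟩
    rw [HasFiniteIntegral, lintegral_prod _ hm.enorm.aemeasurable]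
    refine lt_of_eq_of_lt (setLIntegral_congr_fun measurableSet_Ioc fun s hs => ?_) hfin
    have : (fun r => ‖Set.indicator {q : ℝ × ℝ | q.1 ≤ q.2} g (s, r)‖ₑ) =
        Set.indicator (Set.Ici s) (fun r => ‖g (s, r)‖ₑ) := by
      ext r; by_cases h : s ≤ r <;> simp [h]
    simp only [this]
    rw [setLIntegral_indicator measurableSet_Ici]
    refine setLIntegral_congr (EventuallyEq.trans (Eq.eventuallyEq (Set.ext fun r => ?_))
      Ioc_ae_eq_Icc.symm)
    simp only [Set.mem_inter_iff, Set.mem_Ici, Set.mem_Ioc, Set.mem_Icc]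
    exact ⟨fun h => ⟨h.1, h.2.2⟩, fun h => ⟨h.1, hs.1.trans_le h.1, h.2⟩⟩
  have h1 : ∀ r ∈ Set.Ioc a b, ∫ s in Set.Ioc a r, g (s, r) =
      ∫ s in Set.Ioc a b, Set.indicator {q : ℝ × ℝ | q.1 ≤ q.2} g (s, r) := by
    intro r hr
    have : (fun s => Set.indicator {q : ℝ × ℝ | q.1 ≤ q.2} g (s, r)) =
        Set.indicator (Set.Iic r) (fun s => g (s, r)) := by
      ext s; simp [Set.indicator_apply]
    rw [this, setIntegral_indicator measurableSet_Iic, Set.Ioc_inter_Iic, min_eq_right hr.2]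
  have h2 : ∀ s ∈ Set.Ioc a b, ∫ r in Set.Ioc a b,
      Set.indicator {q : ℝ × ℝ | q.1 ≤ q.2} g (s, r) = ∫ r in Set.Ioc s b, g (s, r) := by
    intro s hs
    have : (fun r => Set.indicator {q : ℝ × ℝ | q.1 ≤ q.2} g (s, r)) =
        Set.indicator (Set.Ici s) (fun r => g (s, r)) := by
      ext r; simp [Set.indicator_apply]
    rw [this, setIntegral_indicator measurableSet_Ici]
    refine setIntegral_congr_set (EventuallyEq.trans (Eq.eventuallyEq (Set.ext fun r => ?_))
      Ioc_ae_eq_Icc.symm)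
    simp only [Set.mem_inter_iff, Set.mem_Ici, Set.mem_Ioc, Set.mem_Icc]
    exact ⟨fun h => ⟨h.2, h.1.2⟩, fun h => ⟨⟨hs.1.trans_le h.1, h.2⟩, h.1⟩⟩
  constructor
  · refine IntegrableOn.congr_fun (f := fun s => ∫ r in Set.Ioc a b,
      Set.indicator {q : ℝ × ℝ | q.1 ≤ q.2} g (s, r)) hI.integral_prod_left h2 measurableSet_Ioc
  · rw [setIntegral_congr_fun measurableSet_Ioc h1,
      ← setIntegral_congr_fun measurableSet_Ioc h2]
    exact (integral_integral_swap (f := fun s r =>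
      Set.indicator {q : ℝ × ℝ | q.1 ≤ q.2} g (s, r)) hI).symm

theorem primitive_sum {ι F : Type} [NormedAddCommGroup F] [NormedSpace ℂ F] (S : Finset ι)
    (e : ι → Lp F 1 (timeMeasure a b)) (r : ℝ) :
    primitive (∑ i ∈ S, e i) r = ∑ i ∈ S, primitive (e i) r :=
  map_sum (AddMonoidHom.mk' (fun e : Lp F 1 (timeMeasure a b) => primitive e r)
    fun e e' => primitive_add e e' r) e S

theorem lintegral_lintegral_op_multi_le' (hA : A.Bound a b c) {h : ∀ k, Source E a b k}
    (hs : ∀ k σ τ, ∀ᵐ s ∂(timeMeasure a b), A.perm k σ τ (h k s) = h k s) (m k : ℕ) (i : Idx k)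
    {r : ℝ} (hr : r ∈ Set.Icc a b) :
    ∫⁻ s in Set.Ioc a r, ∫⁻ r' in Set.Ioc s r,
      ‖A.op k i r' (A.multi s (fun k => h k s) m (k + 1) (fun _ => r'))‖ₑ < ∞ := by
  refine lt_of_le_of_lt ?_ ((A.lintegral_lintegral_op_multi_le hA hs m k i).trans_lt
    (by finiteness))
  exact (lintegral_mono_set (Set.Ioc_subset_Ioc_right hr.2)).trans
    (lintegral_mono fun s => lintegral_mono_set (Set.Ioc_subset_Ioc_right hr.2))

/-- The iterated collapse operators, expressed through the Duhamel terms. -/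
theorem primitive_iterSum_collapse (hA : A.Bound a b c) {h : ∀ k, Source E a b k}
    (hs : ∀ k σ τ, ∀ᵐ s ∂(timeMeasure a b), A.perm k σ τ (h k s) = h k s) (m : ℕ) :
    ∀ (k : ℕ) (r : ℝ), r ∈ Set.Icc a b → primitive (iterSum (A.collapse hA) h m k) r =
      ∫ s in Set.Ioc a r, A.multi s (fun k => h k s) m k (fun _ => r) := by
  -- A source is a superposition of data released at the times `s`; each release evolves by the
  -- Duhamel terms with initial time `s`. The induction step exchanges the release time with the
  -- time of the outermost collision.
  induction m with
  | zero => exact fun k r hr => primitive_eq_setIntegral _ hr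
  | succ m ih =>
    intro k r hr
    set G : Idx k → ℝ × ℝ → E k := fun i q =>
      A.op k i q.2 (A.multi q.1 (fun k => h k q.1) m (k + 1) (fun _ => q.2)) with hG
    have hsw := fun i => integral_triangle_swap_of_lintegral
      (A.stronglyMeasurable_op_multi h m k i) (A.lintegral_lintegral_op_multi_le' hA hs m k i hr)
    calc primitive (iterSum (A.collapse hA) h (m + 1) k) r
        = ∑ i, primitive (A.collapse hA k i (iterSum (A.collapse hA) h m (k + 1))) r :=
          primitive_sum _ _ r
      _ = ∑ i, ∫ r' in Set.Ioc a r, ∫ s in Set.Ioc a r', G i (s, r') := by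
          refine Finset.sum_congr rfl fun i _ => ?_
          rw [primitive_eq_setIntegral _ hr]
          refine integral_congr_ae ?_
          filter_upwards [ae_restrict_of_ae_restrict_of_subset (Set.Ioc_subset_Ioc_right hr.2)
            (primitiveOp_ae_eq (A.continuous_op k i) (hA k i)
              (iterSum (A.collapse hA) h m (k + 1))), ae_restrict_mem measurableSet_Ioc]
            with r' hr' hmem
          have hr'' : r' ∈ Set.Icc a b := ⟨hmem.1.le, hmem.2.trans hr.2⟩
          rw [collapse, hr', ih (k + 1) r' hr'']
          exact (ContinuousLinearMap.integral_comp_comm _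
            (A.integrableOn_multi hA hs m (k + 1) hr'')).symm
      _ = ∑ i, ∫ s in Set.Ioc a r, ∫ r' in Set.Ioc s r, G i (s, r') :=
          Finset.sum_congr rfl fun i _ => (hsw i).2
      _ = ∫ s in Set.Ioc a r, ∑ i, ∫ r' in Set.Ioc s r, G i (s, r') :=
          (integral_finsetSum _ fun i _ => (hsw i).1).symm
      _ = _ := by
          refine setIntegral_congr_fun measurableSet_Ioc fun s hmem => ?_
          have hc : ∀ i, Continuous fun r' => G i (s, r') := fun i =>
            A.continuous_op_comp i continuous_id
              ((A.continuous_multi_time s (fun k => h k s) m (k + 1)).comp (by fun_prop))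
          rw [A.multi_succ_diag hmem.2, intervalIntegral.integral_of_le hmem.2,
            integral_finsetSum _ fun i _ => (hc i).integrableOn_Ioc]

/-- The outermost collision is estimated together with the Duhamel terms below it, for each release
time separately. In `8^k` the part `4^k` comes from the running times and `2^k ≥ k` from the sum
over the `2k` particles; the remaining constants complete `(8c)^m`. -/
theorem norm_iterSum_collapse_le (hA : A.Bound a b c) {h : ∀ k, Source E a b k}
    (hs : ∀ k σ τ, ∀ᵐ s ∂(timeMeasure a b), A.perm k σ τ (h k s) = h k s) (m k : ℕ) :
    ‖iterSum (A.collapse hA) h m k‖ ≤ 8 ^ k * (8 * c) ^ m * ‖h (k + m)‖ := by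
  cases m with
  | zero =>
    rw [pow_zero, mul_one]
    exact le_mul_of_one_le_left (norm_nonneg _) (one_le_pow₀ (by norm_num))
  | succ m =>
    have hi : ∀ i, ‖A.collapse hA k i (iterSum (A.collapse hA) h m (k + 1))‖ₑ ≤
        ((c * 4 ^ (k + 1) * (8 * c) ^ m : ℝ≥0) : ℝ≥0∞) * ‖h (k + 1 + m)‖ₑ := by
      intro i
      have h1 := A.lintegral_lintegral_op_multi_le hA hs m k i
      push_cast
      refine le_trans ?_ h1
      rw [enorm_eq_lintegral, ← lintegral_triangle_swap
        (A.stronglyMeasurable_op_multi h m k i).enorm]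
      refine lintegral_mono_ae ?_
      filter_upwards [primitiveOp_ae_eq (A.continuous_op k i) (hA k i)
        (iterSum (A.collapse hA) h m (k + 1)), ae_restrict_mem measurableSet_Ioc] with r hr hmem
      have hr' : r ∈ Set.Icc a b := ⟨hmem.1.le, hmem.2⟩
      rw [collapse, hr, A.primitive_iterSum_collapse hA hs m (k + 1) r hr',
        ← ContinuousLinearMap.integral_comp_comm _ (A.integrableOn_multi hA hs m (k + 1) hr')]
      exact enorm_integral_le_lintegral_enorm _
    have hidx : ‖h (k + 1 + m)‖ = ‖h (k + (m + 1))‖ := congrArg (fun m => ‖h m‖) (by omega)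
    have hk : (k : ℝ) ≤ 2 ^ k := by exact_mod_cast Nat.lt_two_pow_self.le
    calc _ ≤ ∑ i : Idx k, ‖A.collapse hA k i (iterSum (A.collapse hA) h m (k + 1))‖ :=
          norm_sum_le _ _
      _ ≤ ∑ _i : Idx k, (c * 4 ^ (k + 1) * (8 * c) ^ m : ℝ≥0) * ‖h (k + 1 + m)‖ :=
          Finset.sum_le_sum fun i _ => norm_le_of_enorm_le_mul (hi i)
      _ = k * (4 ^ k * (8 * c) ^ (m + 1) * ‖h (k + (m + 1))‖) := by
          rw [Finset.sum_const, Finset.card_univ, Fintype.card_sum, Fintype.card_fin, hidx]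
          push_cast
          simp only [nsmul_eq_mul, Nat.cast_add]
          ring
      _ ≤ 2 ^ k * (4 ^ k * (8 * c) ^ (m + 1) * ‖h (k + (m + 1))‖) := by gcongr
      _ = _ := by
          rw [show (8 : ℝ) ^ k = 2 ^ k * 4 ^ k by rw [← mul_pow]; norm_num]
          ring

end CollisionFamily

/-- Strong convergence passes to products of operators because the norms are uniformly bounded. This
is how the cut-offs are removed from the iterates. -/
theorem tendsto_iterSum {ι : Type} {l : Filter ι}
    {B : ι → ∀ k, Idx k → (Source E a b (k + 1) →L[ℂ] Source E a b k)}
    {B' : ∀ k, Idx k → (Source E a b (k + 1) →L[ℂ] Source E a b k)}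
    (hbd : ∀ n k i, ‖B n k i‖ ≤ c)
    (hlim : ∀ k i e, Tendsto (fun n => B n k i e) l (𝓝 (B' k i e)))
    (h : ∀ k, Source E a b k) (m : ℕ) :
    ∀ k, Tendsto (fun n => iterSum (B n) h m k) l (𝓝 (iterSum B' h m k)) := by
  induction m with
  | zero => exact fun k => tendsto_const_nhds
  | succ m ih =>
    intro k
    refine tendsto_finsetSum _ fun i _ => ?_
    have h1 : Tendsto (fun n => B n k i (iterSum (B n) h m (k + 1) - iterSum B' h m (k + 1))) l
        (𝓝 0) := by
      refine squeeze_zero_norm (fun n => ((B n k i).le_opNorm _).trans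
        (mul_le_mul_of_nonneg_right (hbd n k i) (norm_nonneg _))) ?_
      simpa using ((ih (k + 1)).sub_const (iterSum B' h m (k + 1))).norm.const_mul (c : ℝ)
    have h2 := h1.add (hlim k i (iterSum B' h m (k + 1)))
    simpa using h2

/-- The bound on iterated collapse operators passes to strong limits. -/
theorem norm_iterSum_le {ι : Type} {l : Filter ι} [l.NeBot] (A : ι → CollisionFamily E)
    (hA : ∀ n, (A n).Bound a b c)
    {B : ∀ k, Idx k → (Source E a b (k + 1) →L[ℂ] Source E a b k)}
    (hlim : ∀ k i e, Tendsto (fun n => (A n).collapse (hA n) k i e) l (𝓝 (B k i e)))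
    {h : ∀ k, Source E a b k}
    (hs : ∀ n k σ τ, ∀ᵐ s ∂(timeMeasure a b), (A n).perm k σ τ (h k s) = h k s) (m k : ℕ) :
    ‖iterSum B h m k‖ ≤ 8 ^ k * (8 * c) ^ m * ‖h (k + m)‖ :=
  le_of_tendsto (tendsto_iterSum (fun n k i => norm_primitiveOp_le _ (hA n k i)) hlim h m k).norm
    (Eventually.of_forall fun n => (A n).norm_iterSum_collapse_le (hA n) (hs n) m k)

end

/-! ### Contraction of two frequencies as an operator on square integrable functions. -/

section

variable {k : ℕ}

/-- The frequencies `(…, ζ_i - η - η', …, η; …, η')` that the collision with particle `i` maps to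
the frequencies `ζ`. -/
def collapsePts (i : Idx k) (q : Pts k × (ℝ × ℝ)) : Pts (k + 1) :=
  WithLp.toLp 2 (snoc2 (Function.update (fun j => q.1 j) i (q.1 i - q.2.1 - q.2.2)) q.2.1 q.2.2)

@[simp] theorem collapsePts_up_self (i : Idx k) (q : Pts k × (ℝ × ℝ)) :
    collapsePts i q (up i) = q.1 i - q.2.1 - q.2.2 := by
  simp [collapsePts]

theorem collapsePts_up_of_ne {i j : Idx k} (h : j ≠ i) (q : Pts k × (ℝ × ℝ)) :
    collapsePts i q (up j) = q.1 j := by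
  simp [collapsePts, Function.update_of_ne h]

@[simp] theorem collapsePts_inl_last (i : Idx k) (q : Pts k × (ℝ × ℝ)) :
    collapsePts i q (Sum.inl (Fin.last k)) = q.2.1 := by
  simp [collapsePts]

@[simp] theorem collapsePts_inr_last (i : Idx k) (q : Pts k × (ℝ × ℝ)) :
    collapsePts i q (Sum.inr (Fin.last k)) = q.2.2 := by
  simp [collapsePts]

theorem continuous_collapsePts (i : Idx k) : Continuous (collapsePts i) := by
  refine (PiLp.continuous_toLp 2 _).comp (continuous_snoc2 ?_ (by fun_prop) (by fun_prop))
  exact Continuous.update (by fun_prop) i (by fun_prop)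

theorem measurePreserving_snoc2 : MeasurePreserving
    (fun q : (Idx k → ℝ) × (ℝ × ℝ) => snoc2 q.1 q.2.1 q.2.2) (volume.prod volume) volume := by
  have hm : Measurable fun q : (Idx k → ℝ) × (ℝ × ℝ) => snoc2 q.1 q.2.1 q.2.2 :=
    (continuous_snoc2 (x := fun q : (Idx k → ℝ) × (ℝ × ℝ) => q.1) (by fun_prop) (by fun_prop)
      (by fun_prop)).measurable
  refine ⟨hm, (Measure.pi_eq fun s hs => ?_).symm⟩
  rw [Measure.map_apply hm (MeasurableSet.univ_pi hs)]
  have : (fun q : (Idx k → ℝ) × (ℝ × ℝ) => snoc2 q.1 q.2.1 q.2.2) ⁻¹' Set.univ.pi s =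
      (Set.univ.pi fun i => s (up i)) ×ˢ
        (s (Sum.inl (Fin.last k)) ×ˢ s (Sum.inr (Fin.last k))) := by
    ext q
    simp only [Set.mem_preimage, Set.mem_pi, Set.mem_univ, true_imp_iff, Set.mem_prod]
    constructor
    · intro h
      exact ⟨fun i => by simpa using h (up i), by simpa using h (Sum.inl (Fin.last k)),
        by simpa using h (Sum.inr (Fin.last k))⟩
    · rintro ⟨h1, h2, h3⟩ i
      exact Idx.cases (P := fun i => snoc2 q.1 q.2.1 q.2.2 i ∈ s i)
        (fun i => by simpa using h1 i) (by simpa using h2) (by simpa using h3) i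
  rw [this, Measure.prod_prod, Measure.volume_eq_prod, Measure.prod_prod, volume_pi_pi]
  simp only [Fintype.prod_sum_type, Fin.prod_univ_castSucc, up_inl, up_inr]
  ring

/-- The map is a shear followed by a relabelling of coordinates. It turns integrals over the output
frequencies and the contracted pair into integrals over all input frequencies. -/
theorem measurePreserving_collapsePts (i : Idx k) :
    MeasurePreserving (collapsePts i) (volume.prod volume) volume := by
  have h1 : MeasurePreserving (fun q : (ℝ × ℝ) × (Idx k → ℝ) =>
      (q.1, q.2 - Pi.single i (q.1.1 + q.1.2))) (volume.prod volume) (volume.prod volume) := by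
    refine (MeasurePreserving.id (volume : Measure (ℝ × ℝ))).skew_product
      (μc := (volume : Measure (Idx k → ℝ))) (μd := (volume : Measure (Idx k → ℝ)))
      (g := fun (p : ℝ × ℝ) (x : Idx k → ℝ) => x - Pi.single i (p.1 + p.2)) ?_ ?_
    · have : Continuous fun c : ℝ => (Pi.single i c : Idx k → ℝ) :=
        continuous_const.update i continuous_id
      exact (continuous_snd.sub (this.comp (by fun_prop))).measurable
    · exact Eventually.of_forall fun p => (measurePreserving_sub_right volume _).map_eq
  have h2 := ((PiLp.volume_preserving_ofLp (Idx k)).prod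
    (MeasurePreserving.id (volume : Measure (ℝ × ℝ))))
  have h3 := (PiLp.volume_preserving_toLp (Idx (k + 1))).comp
    (measurePreserving_snoc2.comp ((Measure.measurePreserving_swap (μ := (volume :
      Measure (ℝ × ℝ))) (ν := (volume : Measure (Idx k → ℝ)))).comp
      (h1.comp ((Measure.measurePreserving_swap (μ := (volume : Measure (Idx k → ℝ)))
        (ν := (volume : Measure (ℝ × ℝ)))).comp h2))))
  refine (congrArg (fun f => MeasurePreserving f (volume.prod volume) volume) ?_).mp h3
  ext q : 1
  simp only [Function.comp_apply, collapsePts, Prod.map, Prod.swap, id]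
  congr 2
  ext j
  by_cases h : j = i
  · subst h; simp [sub_sub]
  · simp [h]

theorem ENNReal.sq_lintegral_mul_le {α : Type*} [MeasurableSpace α] {μ : Measure α}
    {f g : α → ℝ≥0∞} (hf : AEMeasurable f μ) (hg : AEMeasurable g μ) :
    (∫⁻ x, f x * g x ∂μ) ^ 2 ≤ (∫⁻ x, f x ^ 2 ∂μ) * ∫⁻ x, g x ^ 2 ∂μ := by
  have h := ENNReal.lintegral_mul_le_Lp_mul_Lq μ Real.HolderConjugate.two_two hf hg
  simp only [Pi.mul_apply, ENNReal.rpow_two] at h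
  calc _ ≤ ((∫⁻ x, f x ^ 2 ∂μ) ^ (1 / (2 : ℝ)) * (∫⁻ x, g x ^ 2 ∂μ) ^ (1 / (2 : ℝ))) ^ 2 := by
        gcongr
    _ = _ := by
        rw [mul_pow, ← ENNReal.rpow_two, ← ENNReal.rpow_two, ← ENNReal.rpow_mul,
          ← ENNReal.rpow_mul]
        norm_num

theorem sq_eLpNorm_two {α F : Type*} [MeasurableSpace α] {μ : Measure α} [NormedAddCommGroup F]
    (f : α → F) : eLpNorm f 2 μ ^ 2 = ∫⁻ x, ‖f x‖ₑ ^ 2 ∂μ := by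
  have := eLpNorm_nnreal_pow_eq_lintegral (f := f) (μ := μ) (p := 2) (by norm_num)
  simpa [ENNReal.rpow_two] using this

theorem sq_enorm_kernel (f : Kernel k) : ‖f‖ₑ ^ 2 = ∫⁻ ζ, ‖f ζ‖ₑ ^ 2 := by
  rw [Lp.enorm_def, sq_eLpNorm_two]

theorem enorm_le_of_sq {x y : ℝ≥0∞} (h : x ^ 2 ≤ y ^ 2) : x ≤ y :=
  (ENNReal.pow_le_pow_left_iff two_ne_zero).1 h

/-- Symbols of collapse operators: measurable functions of the output frequency and the two
contracted frequencies that are uniformly square integrable in the latter. -/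
structure IsSymbol (a : ℝ → ℝ × ℝ → ℂ) (C : ℝ≥0) : Prop where
  measurable : Measurable (Function.uncurry a)
  bound : ∀ z, ∫⁻ p, ‖a z p‖ₑ ^ 2 ≤ C ^ 2

/-- The contraction `ζ ↦ ∫ a(ζ_i; η, η') f(…, ζ_i - η - η', …, η; …, η') dη dη'`. -/
def collapseFun (a : ℝ → ℝ × ℝ → ℂ) (i : Idx k) (f : Pts (k + 1) → ℂ) (ζ : Pts k) : ℂ :=
  ∫ p : ℝ × ℝ, a (ζ i) p * f (collapsePts i (ζ, p))

section collapse

variable {a : ℝ → ℝ × ℝ → ℂ} {C : ℝ≥0}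

theorem lintegral_collapsePts (i : Idx k) {g : Pts (k + 1) → ℝ≥0∞} (hg : Measurable g) :
    ∫⁻ ζ, ∫⁻ p, g (collapsePts i (ζ, p)) = ∫⁻ w, g w := by
  rw [← (measurePreserving_collapsePts i).lintegral_comp hg,
    lintegral_prod (fun q => g (collapsePts i q))
      (hg.comp (continuous_collapsePts i).measurable).aemeasurable]

theorem ae_collapsePts (i : Idx k) {P : Pts (k + 1) → Prop} (h : ∀ᵐ w, P w) :
    ∀ᵐ ζ : Pts k, ∀ᵐ p : ℝ × ℝ, P (collapsePts i (ζ, p)) :=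
  Measure.ae_ae_of_ae_prod ((measurePreserving_collapsePts i).quasiMeasurePreserving.ae h)

theorem measurable_collapse_integrand (ha : Measurable (Function.uncurry a)) (i : Idx k)
    {f : Pts (k + 1) → ℂ} (hf : Measurable f) :
    Measurable fun q : Pts k × (ℝ × ℝ) => a (q.1 i) q.2 * f (collapsePts i q) := by
  refine Measurable.mul ?_ (hf.comp (continuous_collapsePts i).measurable)
  exact ha.comp (Measurable.prodMk (by fun_prop) measurable_snd)

theorem measurable_collapseFun (ha : Measurable (Function.uncurry a)) (i : Idx k)
    {f : Pts (k + 1) → ℂ} (hf : Measurable f) : Measurable (collapseFun a i f) :=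
  ((measurable_collapse_integrand ha i hf).stronglyMeasurable.integral_prod_right'
    (ν := volume)).measurable

theorem sq_lintegral_collapse_le (ha : IsSymbol a C) (i : Idx k) {f : Pts (k + 1) → ℂ}
    (hf : Measurable f) (ζ : Pts k) :
    (∫⁻ p, ‖a (ζ i) p * f (collapsePts i (ζ, p))‖ₑ) ^ 2 ≤
      C ^ 2 * ∫⁻ p, ‖f (collapsePts i (ζ, p))‖ₑ ^ 2 := by
  simp only [enorm_mul]
  have h1 : Measurable fun p => ‖a (ζ i) p‖ₑ :=
    (ha.measurable.comp measurable_prodMk_left).enorm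
  have h2 : Measurable fun p => ‖f (collapsePts i (ζ, p))‖ₑ :=
    (hf.comp ((continuous_collapsePts i).measurable.comp measurable_prodMk_left)).enorm
  refine (ENNReal.sq_lintegral_mul_le h1.aemeasurable h2.aemeasurable).trans ?_
  gcongr
  exact ha.bound _

theorem ae_lintegral_sq_lt_top (i : Idx k) {f : Pts (k + 1) → ℂ} (hf : Measurable f)
    (hf2 : ∫⁻ w, ‖f w‖ₑ ^ 2 < ∞) :
    ∀ᵐ ζ : Pts k, ∫⁻ p, ‖f (collapsePts i (ζ, p))‖ₑ ^ 2 < ∞ := by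
  have hm : Measurable fun q : Pts k × (ℝ × ℝ) => ‖f (collapsePts i q)‖ₑ ^ 2 :=
    (hf.comp (continuous_collapsePts i).measurable).enorm.pow_const 2
  refine ae_lt_top hm.lintegral_prod_right' ?_
  rw [lintegral_collapsePts i (hf.enorm.pow_const 2)]
  exact hf2.ne

theorem ae_integrable_collapse (ha : IsSymbol a C) (i : Idx k) {f : Pts (k + 1) → ℂ}
    (hf : Measurable f) (hf2 : ∫⁻ w, ‖f w‖ₑ ^ 2 < ∞) :
    ∀ᵐ ζ : Pts k, Integrable fun p => a (ζ i) p * f (collapsePts i (ζ, p)) := by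
  filter_upwards [ae_lintegral_sq_lt_top i hf hf2] with ζ hζ
  refine ⟨((measurable_collapse_integrand ha.measurable i hf).comp
    measurable_prodMk_left).aestronglyMeasurable, ?_⟩
  have h := (sq_lintegral_collapse_le ha i hf ζ).trans_lt
    (ENNReal.mul_lt_top (by finiteness) hζ)
  exact (ENNReal.pow_lt_top_iff.1 h).resolve_right two_ne_zero

/-- Cauchy–Schwarz in the contracted pair, followed by the change of variables `collapsePts`. -/
theorem lintegral_sq_collapseFun_le (ha : IsSymbol a C) (i : Idx k) {f : Pts (k + 1) → ℂ}
    (hf : Measurable f) :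
    ∫⁻ ζ, ‖collapseFun a i f ζ‖ₑ ^ 2 ≤ C ^ 2 * ∫⁻ w, ‖f w‖ₑ ^ 2 := by
  rw [← lintegral_collapsePts i (hf.enorm.pow_const 2), ← lintegral_const_mul]
  · refine lintegral_mono fun ζ => ?_
    refine le_trans ?_ (sq_lintegral_collapse_le ha i hf ζ)
    gcongr
    exact enorm_integral_le_lintegral_enorm _
  · exact Measurable.lintegral_prod_right' (f := fun q : Pts k × (ℝ × ℝ) =>
      ‖f (collapsePts i q)‖ₑ ^ 2) ((hf.comp (continuous_collapsePts i).measurable).enorm.pow_const 2)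

theorem collapseFun_congr_ae (i : Idx k) {f g : Pts (k + 1) → ℂ} (h : f =ᵐ[volume] g) :
    collapseFun a i f =ᵐ[volume] collapseFun a i g := by
  filter_upwards [ae_collapsePts i h] with ζ hζ
  refine integral_congr_ae ?_
  filter_upwards [hζ] with p hp
  rw [hp]

theorem measurable_coe (f : Kernel k) : Measurable f := (Lp.stronglyMeasurable f).measurable

theorem lintegral_sq_coe_lt_top (f : Kernel k) : ∫⁻ ζ, ‖f ζ‖ₑ ^ 2 < ∞ := by
  rw [← sq_enorm_kernel]
  finiteness

theorem memLp_collapseFun (ha : IsSymbol a C) (i : Idx k) (f : Kernel (k + 1)) :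
    MemLp (collapseFun a i f) 2 volume := by
  refine ⟨(measurable_collapseFun ha.measurable i (measurable_coe f)).aestronglyMeasurable, ?_⟩
  have h := (lintegral_sq_collapseFun_le ha i (measurable_coe f)).trans_lt
    (ENNReal.mul_lt_top (by finiteness) (lintegral_sq_coe_lt_top f))
  rw [← sq_eLpNorm_two] at h
  exact (ENNReal.pow_lt_top_iff.1 h).resolve_right two_ne_zero

/-- The collapse operator with symbol `a`, on square integrable functions. -/
def collapseOp (a : ℝ → ℝ × ℝ → ℂ) {C : ℝ≥0} (ha : IsSymbol a C) (i : Idx k) :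
    Kernel (k + 1) →L[ℂ] Kernel k :=
  LinearMap.mkContinuous
    { toFun := fun f => (memLp_collapseFun ha i f).toLp _
      map_add' := fun f g => by
        rw [← MemLp.toLp_add]
        refine MemLp.toLp_congr _ _ ?_
        filter_upwards [collapseFun_congr_ae (a := a) i (Lp.coeFn_add f g),
          ae_integrable_collapse ha i (measurable_coe f) (lintegral_sq_coe_lt_top f),
          ae_integrable_collapse ha i (measurable_coe g) (lintegral_sq_coe_lt_top g)]
          with ζ h hf hg
        rw [h, Pi.add_apply, collapseFun, collapseFun, collapseFun, ← integral_add hf hg]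
        simp only [Pi.add_apply, mul_add]
      map_smul' := fun z f => by
        rw [RingHom.id_apply, ← MemLp.toLp_const_smul]
        refine MemLp.toLp_congr _ _ ?_
        filter_upwards [collapseFun_congr_ae (a := a) i (Lp.coeFn_smul z f)] with ζ h
        rw [h, Pi.smul_apply, collapseFun, collapseFun, smul_eq_mul, ← integral_const_mul]
        simp only [Pi.smul_apply, smul_eq_mul]
        congr 1
        ext p
        ring } C (fun f => by
      refine norm_le_of_enorm_le_mul (enorm_le_of_sq ?_)
      rw [mul_pow, sq_enorm_kernel f]
      refine le_trans (le_of_eq ?_) (lintegral_sq_collapseFun_le ha i (measurable_coe f))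
      rw [sq_enorm_kernel]
      refine lintegral_congr_ae ?_
      filter_upwards [(memLp_collapseFun ha i f).coeFn_toLp] with ζ hζ
      rw [← hζ]; rfl)

theorem collapseOp_ae_eq (ha : IsSymbol a C) (i : Idx k) (f : Kernel (k + 1)) :
    collapseOp a ha i f =ᵐ[volume] collapseFun a i f :=
  (memLp_collapseFun ha i f).coeFn_toLp

end collapse

end

/-! ### Multiplication operators, the free flow and permutations of the particles. -/

section

variable {k : ℕ}

section multOp

variable {C : ℝ}

theorem memLp_mult {φ : Pts k → ℂ} (hm : Measurable φ) (hb : ∀ ζ, ‖φ ζ‖ ≤ C) (f : Kernel k) :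
    MemLp (fun ζ => φ ζ * f ζ) 2 volume := by
  refine (Lp.memLp f).of_le_mul (c := C)
    (hm.aestronglyMeasurable.mul (Lp.aestronglyMeasurable f)) ?_
  filter_upwards with ζ
  rw [norm_mul]
  exact mul_le_mul_of_nonneg_right (hb ζ) (norm_nonneg _)

/-- Multiplication by a bounded function. -/
def multOp (φ : Pts k → ℂ) (hm : Measurable φ) (hb : ∀ ζ, ‖φ ζ‖ ≤ C) :
    Kernel k →L[ℂ] Kernel k :=
  LinearMap.mkContinuous
    { toFun := fun f => (memLp_mult hm hb f).toLp _
      map_add' := fun f g => by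
        rw [← MemLp.toLp_add]
        refine MemLp.toLp_congr _ _ ?_
        filter_upwards [Lp.coeFn_add f g] with ζ h
        rw [h, Pi.add_apply, Pi.add_apply, mul_add]
      map_smul' := fun z f => by
        rw [RingHom.id_apply, ← MemLp.toLp_const_smul]
        refine MemLp.toLp_congr _ _ ?_
        filter_upwards [Lp.coeFn_smul z f] with ζ h
        rw [h, Pi.smul_apply, Pi.smul_apply, smul_eq_mul, smul_eq_mul]
        ring } C (fun f => by
      refine Lp.norm_le_mul_norm_of_ae_le_mul ?_
      filter_upwards [(memLp_mult hm hb f).coeFn_toLp] with ζ h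
      refine (congrArg norm h).trans_le ?_
      rw [norm_mul]
      exact mul_le_mul_of_nonneg_right (hb ζ) (norm_nonneg _))

theorem multOp_ae_eq {φ : Pts k → ℂ} (hm : Measurable φ) (hb : ∀ ζ, ‖φ ζ‖ ≤ C) (f : Kernel k) :
    multOp φ hm hb f =ᵐ[volume] fun ζ => φ ζ * f ζ :=
  (memLp_mult hm hb f).coeFn_toLp

theorem tendsto_kernel_of_lintegral {ι : Type*} {l : Filter ι} {f : ι → Kernel k} {g : Kernel k}
    (h : Tendsto (fun n => ∫⁻ ζ, ‖f n ζ - g ζ‖ₑ ^ 2) l (𝓝 0)) : Tendsto f l (𝓝 g) := by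
  rw [tendsto_iff_edist_tendsto_0]
  have h1 : ∀ n, edist (f n) g = (∫⁻ ζ, ‖f n ζ - g ζ‖ₑ ^ 2) ^ (1 / (2 : ℝ)) := by
    intro n
    rw [edist_eq_enorm_sub]
    have h2 : ‖f n - g‖ₑ ^ 2 = ∫⁻ ζ, ‖f n ζ - g ζ‖ₑ ^ 2 := by
      rw [sq_enorm_kernel]
      refine lintegral_congr_ae ?_
      filter_upwards [Lp.coeFn_sub (f n) g] with ζ hζ
      rw [hζ, Pi.sub_apply]
    rw [← h2, ← ENNReal.rpow_two, ← ENNReal.rpow_mul]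
    norm_num
  simp only [h1]
  have := ((ENNReal.continuous_rpow_const (y := 1 / (2 : ℝ))).tendsto 0).comp h
  simpa [Function.comp_def] using this

/-- Dominated convergence for multiplication operators. -/
theorem tendsto_multOp {ι : Type*} {l : Filter ι} [l.IsCountablyGenerated] {φ : ι → Pts k → ℂ}
    {ψ : Pts k → ℂ} (hφm : ∀ n, Measurable (φ n)) (hφ : ∀ n ζ, ‖φ n ζ‖ ≤ C) (hψm : Measurable ψ)
    (hψ : ∀ ζ, ‖ψ ζ‖ ≤ C) (h : ∀ ζ, Tendsto (fun n => φ n ζ) l (𝓝 (ψ ζ))) (f : Kernel k) :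
    Tendsto (fun n => multOp (φ n) (hφm n) (hφ n) f) l (𝓝 (multOp ψ hψm hψ f)) := by
  refine tendsto_kernel_of_lintegral ?_
  have h1 : ∀ n, ∫⁻ ζ, ‖multOp (φ n) (hφm n) (hφ n) f ζ - multOp ψ hψm hψ f ζ‖ₑ ^ 2 =
      ∫⁻ ζ, ‖φ n ζ - ψ ζ‖ₑ ^ 2 * ‖f ζ‖ₑ ^ 2 := by
    intro n
    refine lintegral_congr_ae ?_
    filter_upwards [multOp_ae_eq (hφm n) (hφ n) f, multOp_ae_eq hψm hψ f] with ζ h1 h2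
    rw [h1, h2, ← sub_mul, enorm_mul, mul_pow]
  simp only [h1]
  have h0 : (0 : ℝ≥0∞) = ∫⁻ _ : Pts k, 0 := by simp
  rw [h0]
  refine tendsto_lintegral_filter_of_dominated_convergence (fun ζ => ENNReal.ofReal (C + C) ^ 2 * ‖f ζ‖ₑ ^ 2) ?_ ?_ ?_ ?_
  · exact Eventually.of_forall fun n => (((hφm n).sub hψm).enorm.pow_const 2).mul
      ((measurable_coe f).enorm.pow_const 2)
  · refine Eventually.of_forall fun n => Eventually.of_forall fun ζ => ?_
    gcongr
    rw [← ofReal_norm]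
    refine ENNReal.ofReal_le_ofReal ?_
    linarith [norm_sub_le (φ n ζ) (ψ ζ), hφ n ζ, hψ ζ]
  · rw [lintegral_const_mul _ ((measurable_coe f).enorm.pow_const 2)]
    exact ENNReal.mul_ne_top (by simp) (lintegral_sq_coe_lt_top f).ne
  · refine Eventually.of_forall fun ζ => ?_
    have h2 : Tendsto (fun n => ‖φ n ζ - ψ ζ‖ₑ ^ 2) l (𝓝 0) := by
      have := ((h ζ).sub_const (ψ ζ)).enorm.ennrpow_const 2
      simpa using this
    have hne : ‖f ζ‖ₑ ^ 2 ≠ ∞ := by finiteness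
    simpa using ENNReal.Tendsto.mul_const h2 (Or.inr hne)

end multOp

theorem norm_freeSymbol_le (t : ℝ) (ζ : Pts k) : ‖freeSymbol t ζ‖ ≤ 1 := (norm_freeSymbol t ζ).le

/-- The free evolution on the Fourier side. -/
def flow (t : ℝ) : Kernel k →L[ℂ] Kernel k :=
  multOp (freeSymbol t) (continuous_freeSymbol t k).measurable (norm_freeSymbol_le t)

theorem flow_ae_eq (t : ℝ) (f : Kernel k) :
    flow t f =ᵐ[volume] fun ζ => freeSymbol t ζ * f ζ := multOp_ae_eq _ _ f

theorem norm_flow (t : ℝ) (f : Kernel k) : ‖flow t f‖ = ‖f‖ := by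
  refine le_antisymm (Lp.norm_le_norm_of_ae_le ?_) (Lp.norm_le_norm_of_ae_le ?_)
  all_goals
    filter_upwards [flow_ae_eq t f] with ζ h
    rw [h, norm_mul, norm_freeSymbol, one_mul]

theorem freeSymbol_add (s t : ℝ) (ζ : Pts k) :
    freeSymbol (s + t) ζ = freeSymbol s ζ * freeSymbol t ζ := by
  rw [freeSymbol, freeSymbol, freeSymbol, ← Complex.exp_add]
  congr 1
  push_cast
  ring

theorem freeSymbol_zero (ζ : Pts k) : freeSymbol 0 ζ = 1 := by
  simp [freeSymbol]

theorem flow_flow (s t : ℝ) (f : Kernel k) : flow s (flow t f) = flow (s + t) f := by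
  refine Lp.ext ?_
  filter_upwards [flow_ae_eq s (flow t f), flow_ae_eq t f, flow_ae_eq (s + t) f] with ζ h1 h2 h3
  rw [h1, h2, h3, freeSymbol_add, mul_assoc]

theorem flow_zero (f : Kernel k) : flow 0 f = f := by
  refine Lp.ext ?_
  filter_upwards [flow_ae_eq 0 f] with ζ h1
  rw [h1, freeSymbol_zero, one_mul]

theorem continuous_flow_apply (f : Kernel k) : Continuous fun t => flow t f := by
  rw [continuous_iff_continuousAt]
  refine fun t => tendsto_multOp _ _ _ _ (fun ζ => ?_) f
  have : Continuous fun s : ℝ => freeSymbol s ζ := by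
    unfold freeSymbol
    fun_prop
  exact this.tendsto t

/-- Strong continuity in time together with the isometry property gives joint continuity. -/
theorem continuous_flow : Continuous fun q : ℝ × Kernel k => flow q.1 q.2 := by
  rw [continuous_iff_continuousAt]
  rintro ⟨t, f⟩
  have h1 : Tendsto (fun q : ℝ × Kernel k => flow q.1 (q.2 - f)) (𝓝 (t, f)) (𝓝 0) := by
    refine squeeze_zero_norm (fun q => (norm_flow _ _).le) ?_
    have : Tendsto (fun q : ℝ × Kernel k => q.2 - f) (𝓝 (t, f)) (𝓝 (f - f)) :=
      (continuous_snd.sub continuous_const).tendsto (t, f)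
    simpa using this.norm
  have h2 : Tendsto (fun q : ℝ × Kernel k => flow q.1 f) (𝓝 (t, f)) (𝓝 (flow t f)) :=
    ((continuous_flow_apply f).comp continuous_fst).tendsto (t, f)
  have h3 := h1.add h2
  simp only [map_sub, sub_add_cancel, zero_add] at h3
  exact h3

/-- The permutation of the particles as a linear isometry. -/
def permIso (σ τ : Equiv.Perm (Fin k)) : Pts k ≃ₗᵢ[ℝ] Pts k :=
  LinearIsometryEquiv.piLpCongrLeft 2 ℝ ℝ (Equiv.sumCongr σ τ).symm

theorem measurePreserving_permPts (σ τ : Equiv.Perm (Fin k)) :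
    MeasurePreserving (permPts σ τ : Pts k → Pts k) volume volume :=
  (permIso σ τ).measurePreserving

/-- The action of the permutations of the particles on kernels. -/
def permOp (σ τ : Equiv.Perm (Fin k)) : Kernel k →L[ℂ] Kernel k :=
  (Lp.compMeasurePreservingₗᵢ ℂ (permPts σ τ) (measurePreserving_permPts σ τ)).toContinuousLinearMap

theorem permOp_ae_eq (σ τ : Equiv.Perm (Fin k)) (f : Kernel k) :
    permOp σ τ f =ᵐ[volume] fun ζ => f (permPts σ τ ζ) :=
  Lp.coeFn_compMeasurePreserving f (measurePreserving_permPts σ τ)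

theorem permPts_apply (σ τ : Equiv.Perm (Fin k)) (z : Pts k) (i : Idx k) :
    permPts σ τ z i = z (Sum.map σ τ i) := rfl

theorem pts_ext {z w : Pts k} (h : ∀ i, z i = w i) : z = w := PiLp.ext h

theorem collapsePts_permPts (σ τ : Equiv.Perm (Fin k)) (i : Idx k) (ζ : Pts k) (p : ℝ × ℝ) :
    collapsePts i (permPts σ τ ζ, p) =
      permPts (extPerm σ) (extPerm τ) (collapsePts (Sum.map σ τ i) (ζ, p)) := by
  have hup : ∀ l : Idx k, Sum.map (extPerm σ) (extPerm τ) (up l) = up (Sum.map σ τ l) := by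
    rintro (l | l) <;> simp
  refine pts_ext fun j => Idx.cases (P := fun j => collapsePts i (permPts σ τ ζ, p) j =
      permPts (extPerm σ) (extPerm τ) (collapsePts (Sum.map σ τ i) (ζ, p)) j) ?_ ?_ ?_ j
  · intro l
    rw [permPts_apply, hup]
    by_cases h : l = i
    · subst h; simp [permPts_apply]
    · have h' : Sum.map σ τ l ≠ Sum.map σ τ i := fun h' =>
        h ((Sum.map_injective.2 ⟨σ.injective, τ.injective⟩) h')
      rw [collapsePts_up_of_ne h, collapsePts_up_of_ne h', permPts_apply]
  · simp [permPts_apply]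
  · simp [permPts_apply]

/-- For `i ≠ j` the two shears act on different coordinates; only the order of the appended pairs
remembers the order of the contractions. -/
theorem collapsePts_collapsePts {i j : Idx k} (hij : i ≠ j) (ζ : Pts k) (p q : ℝ × ℝ) :
    permPts (swapLast k) (swapLast k) (collapsePts (up i) (collapsePts j (ζ, q), p)) =
      collapsePts (up j) (collapsePts i (ζ, p), q) := by
  have hup : ∀ l : Idx k, Sum.map (swapLast k) (swapLast k) (up (up l)) = up (up l) := by
    rintro (l | l) <;> simp
  have hl : ∀ m : Idx k, (Sum.inl (Fin.last k) : Idx (k + 1)) ≠ up m := by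
    rintro (m | m) <;> simp [Fin.ext_iff, m.2.ne']
  have hr : ∀ m : Idx k, (Sum.inr (Fin.last k) : Idx (k + 1)) ≠ up m := by
    rintro (m | m) <;> simp [Fin.ext_iff, m.2.ne']
  have hl' : (Sum.inl (Fin.last k).castSucc : Idx (k + 2)) = up (Sum.inl (Fin.last k)) := rfl
  have hr' : (Sum.inr (Fin.last k).castSucc : Idx (k + 2)) = up (Sum.inr (Fin.last k)) := rfl
  refine pts_ext fun l => Idx.cases (P := fun l => permPts (swapLast k) (swapLast k)
    (collapsePts (up i) (collapsePts j (ζ, q), p)) l =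
      collapsePts (up j) (collapsePts i (ζ, p), q) l) ?_ ?_ ?_ l
  · intro l
    refine Idx.cases (P := fun l => permPts (swapLast k) (swapLast k)
      (collapsePts (up i) (collapsePts j (ζ, q), p)) (up l) =
        collapsePts (up j) (collapsePts i (ζ, p), q) (up l)) ?_ ?_ ?_ l
    · intro l
      rw [permPts_apply, hup]
      by_cases hi : l = i
      · subst hi
        rw [collapsePts_up_self, collapsePts_up_of_ne hij,
          collapsePts_up_of_ne (up_injective.ne hij), collapsePts_up_self]
      · by_cases hj : l = j
        · subst hj
          rw [collapsePts_up_self, collapsePts_up_of_ne hi,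
            collapsePts_up_of_ne (up_injective.ne hi), collapsePts_up_self]
        · rw [collapsePts_up_of_ne (up_injective.ne hi), collapsePts_up_of_ne hj,
            collapsePts_up_of_ne (up_injective.ne hj), collapsePts_up_of_ne hi]
    · rw [collapsePts_up_of_ne (hl j), collapsePts_inl_last]
      simp [permPts_apply]
    · rw [collapsePts_up_of_ne (hr j), collapsePts_inr_last]
      simp [permPts_apply]
  · rw [permPts_apply, collapsePts_inl_last]
    simp only [Sum.map_inl, swapLast_last]
    rw [hl', collapsePts_up_of_ne (hl i), collapsePts_inl_last]
  · rw [permPts_apply, collapsePts_inr_last]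
    simp only [Sum.map_inr, swapLast_last]
    rw [hr', collapsePts_up_of_ne (hr i), collapsePts_inr_last]

end

/-! ### Commuting contractions; the weighted symbol of the collision operators. -/

section

variable {k : ℕ}

theorem permOp_collapseOp {a : ℝ → ℝ × ℝ → ℂ} {C : ℝ≥0} (ha : IsSymbol a C)
    (σ τ : Equiv.Perm (Fin k)) (i : Idx k) (f : Kernel (k + 1)) :
    permOp σ τ (collapseOp a ha i f) =
      collapseOp a ha (Sum.map σ τ i) (permOp (extPerm σ) (extPerm τ) f) := by
  refine Lp.ext ?_
  filter_upwards [permOp_ae_eq σ τ (collapseOp a ha i f),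
    (measurePreserving_permPts σ τ).quasiMeasurePreserving.ae (collapseOp_ae_eq ha i f),
    collapseOp_ae_eq ha (Sum.map σ τ i) (permOp (extPerm σ) (extPerm τ) f),
    collapseFun_congr_ae (a := a) (Sum.map σ τ i) (permOp_ae_eq (extPerm σ) (extPerm τ) f)]
    with ζ h1 h2 h3 h4
  rw [h1, h2, h3, h4, collapseFun, collapseFun]
  simp only [collapsePts_permPts, permPts_apply]

/-- Contractions with different particles commute, up to the order of the contracted particles. -/
theorem collapseOp_comm {a b : ℝ → ℝ × ℝ → ℂ} {C D : ℝ≥0} (ha : IsSymbol a C) (hb : IsSymbol b D)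
    {i j : Idx k} (hij : i ≠ j) (f : Kernel (k + 2)) :
    collapseOp a ha i (collapseOp b hb (up j) f) =
      collapseOp b hb j (collapseOp a ha (up i) (permOp (swapLast k) (swapLast k) f)) := by
  refine Lp.ext ?_
  have hf := measurable_coe f
  -- For almost every output frequency `f` is square integrable over both contracted pairs. Together
  -- with the square integrability of the product of the two symbols this justifies Fubini.
  have hfin : ∀ᵐ ζ : Pts k, ∫⁻ p, ∫⁻ q,
      ‖f (collapsePts (up j) (collapsePts i (ζ, p), q))‖ₑ ^ 2 < ∞ := by
    have hm : Measurable fun w : Pts (k + 1) => ∫⁻ q, ‖f (collapsePts (up j) (w, q))‖ₑ ^ 2 :=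
      Measurable.lintegral_prod_right' (f := fun q : Pts (k + 1) × (ℝ × ℝ) =>
        ‖f (collapsePts (up j) q)‖ₑ ^ 2)
        ((hf.comp (continuous_collapsePts (up j)).measurable).enorm.pow_const 2)
    have hm' : Measurable fun q : Pts k × (ℝ × ℝ) =>
        ∫⁻ q', ‖f (collapsePts (up j) (collapsePts i q, q'))‖ₑ ^ 2 :=
      hm.comp (continuous_collapsePts i).measurable
    refine ae_lt_top hm'.lintegral_prod_right' ?_
    rw [lintegral_collapsePts i hm, lintegral_collapsePts (up j) (hf.enorm.pow_const 2)]
    exact (lintegral_sq_coe_lt_top f).ne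
  filter_upwards [hfin, collapseOp_ae_eq ha i (collapseOp b hb (up j) f),
    collapseFun_congr_ae (a := a) i (collapseOp_ae_eq hb (up j) f),
    collapseOp_ae_eq hb j (collapseOp a ha (up i) (permOp (swapLast k) (swapLast k) f)),
    collapseFun_congr_ae (a := b) j ((collapseOp_ae_eq ha (up i)
      (permOp (swapLast k) (swapLast k) f)).trans (collapseFun_congr_ae (a := a) (up i)
        (permOp_ae_eq (swapLast k) (swapLast k) f)))] with ζ h0 h1 h2 h3 h4
  rw [h1, h2, h3, h4]
  simp only [collapseFun, collapsePts_up_of_ne hij, collapsePts_up_of_ne hij.symm,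
    collapsePts_collapsePts hij, ← integral_const_mul]
  have hM : Measurable (Function.uncurry fun p q : ℝ × ℝ =>
      a (ζ i) p * (b (ζ j) q * f (collapsePts (up j) (collapsePts i (ζ, p), q)))) := by
    refine ((ha.measurable.comp measurable_prodMk_left).comp measurable_fst).mul
      (((hb.measurable.comp measurable_prodMk_left).comp measurable_snd).mul (hf.comp ?_))
    exact (continuous_collapsePts (up j)).measurable.comp
      (((continuous_collapsePts i).measurable.comp
        (measurable_const.prodMk measurable_fst)).prodMk measurable_snd)
  rw [integral_integral_swap (f := fun p q : ℝ × ℝ =>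
      a (ζ i) p * (b (ζ j) q * f (collapsePts (up j) (collapsePts i (ζ, p), q))))]
  · refine integral_congr_ae (Eventually.of_forall fun q => ?_)
    refine integral_congr_ae (Eventually.of_forall fun p => ?_)
    simp only
    ring
  · refine ⟨hM.aestronglyMeasurable, ?_⟩
    have hM1 : Measurable fun r : (ℝ × ℝ) × (ℝ × ℝ) => ‖a (ζ i) r.1 * b (ζ j) r.2‖ₑ :=
      (((ha.measurable.comp measurable_prodMk_left).comp measurable_fst).mul
        ((hb.measurable.comp measurable_prodMk_left).comp measurable_snd)).enorm
    have hM2 : Measurable fun r : (ℝ × ℝ) × (ℝ × ℝ) =>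
        ‖f (collapsePts (up j) (collapsePts i (ζ, r.1), r.2))‖ₑ := by
      refine (hf.comp ?_).enorm
      exact (continuous_collapsePts (up j)).measurable.comp
        (((continuous_collapsePts i).measurable.comp
          (measurable_const.prodMk measurable_fst)).prodMk measurable_snd)
    have hcs := ENNReal.sq_lintegral_mul_le (μ := (volume : Measure (ℝ × ℝ)).prod
      (volume : Measure (ℝ × ℝ))) hM1.aemeasurable hM2.aemeasurable
    have h5 : (∫⁻ r : (ℝ × ℝ) × (ℝ × ℝ), ‖a (ζ i) r.1 * b (ζ j) r.2‖ₑ ^ 2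
        ∂((volume : Measure (ℝ × ℝ)).prod (volume : Measure (ℝ × ℝ)))) ≤ C ^ 2 * D ^ 2 := by
      simp only [enorm_mul, mul_pow]
      rw [lintegral_prod_mul (f := fun p => ‖a (ζ i) p‖ₑ ^ 2) (g := fun q => ‖b (ζ j) q‖ₑ ^ 2)
        (((ha.measurable.comp measurable_prodMk_left).enorm.pow_const 2).aemeasurable)
        (((hb.measurable.comp measurable_prodMk_left).enorm.pow_const 2).aemeasurable)]
      exact mul_le_mul' (ha.bound _) (hb.bound _)
    rw [lintegral_prod (fun r : (ℝ × ℝ) × (ℝ × ℝ) =>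
      ‖f (collapsePts (up j) (collapsePts i (ζ, r.1), r.2))‖ₑ ^ 2)
      (hM2.pow_const 2).aemeasurable] at hcs
    have h6 := hcs.trans_lt (ENNReal.mul_lt_top (h5.trans_lt (by finiteness)) h0)
    have h7 := (ENNReal.pow_lt_top_iff.1 h6).resolve_right two_ne_zero
    refine lt_of_eq_of_lt (lintegral_congr fun r => ?_) h7
    simp only [Function.uncurry, enorm_mul]
    ring

/-- The symbol of `⟨∂⟩^ε`. -/
def weight (ε x : ℝ) : ℝ := (1 + (2 * Real.pi * x) ^ 2) ^ (ε / 2)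

theorem one_le_weight {ε : ℝ} (hε : 0 ≤ ε) (x : ℝ) : 1 ≤ weight ε x :=
  Real.one_le_rpow (by nlinarith [sq_nonneg (2 * Real.pi * x)]) (by positivity)

theorem weight_pos (ε x : ℝ) : 0 < weight ε x := by
  unfold weight
  positivity

theorem continuous_weight (ε : ℝ) : Continuous (weight ε) := by
  unfold weight
  exact Continuous.rpow_const (by fun_prop) fun x => Or.inl (by positivity)

theorem weight_neg (ε x : ℝ) : weight ε (-x) = weight ε x := by
  simp [weight]

theorem sobolevSymbol_eq (ε : ℝ) (ζ : Pts k) : sobolevSymbol ε ζ = ∏ i, weight ε (ζ i) := rfl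

/-- The symbol of the contraction, relative to the weights. -/
def kappa (ε z : ℝ) (p : ℝ × ℝ) : ℝ :=
  weight ε z / (weight ε (z - p.1 - p.2) * weight ε p.1 * weight ε p.2)

theorem kappa_nonneg (ε z : ℝ) (p : ℝ × ℝ) : 0 ≤ kappa ε z p := by
  have := weight_pos ε
  unfold kappa
  exact div_nonneg (this _).le (mul_pos (mul_pos (this _) (this _)) (this _)).le

theorem measurable_kappa (ε : ℝ) : Measurable (Function.uncurry (kappa ε)) := by
  have h := (continuous_weight ε).measurable
  refine (h.comp measurable_fst).div (((h.comp ?_).mul (h.comp ?_)).mul (h.comp ?_)) <;> fun_prop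

/-- This crude bound, from `1 + (x+y+y')² ≤ 3 (1+x²)(1+y²)(1+y'²)`, serves only to make the
operators with a multiplier bounded at each fixed time. -/
theorem kappa_le {ε : ℝ} (hε : 0 ≤ ε) (z : ℝ) (p : ℝ × ℝ) : kappa ε z p ≤ 3 ^ (ε / 2) := by
  have hw := weight_pos ε
  rw [kappa, div_le_iff₀ (mul_pos (mul_pos (hw _) (hw _)) (hw _))]
  unfold weight
  rw [← Real.mul_rpow (by positivity) (by positivity), ← Real.mul_rpow (by positivity)
    (by positivity), ← Real.mul_rpow (by positivity) (by positivity)]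
  refine Real.rpow_le_rpow (by positivity) ?_ (by positivity)
  obtain ⟨x, hx⟩ : ∃ x, x = 2 * Real.pi * (z - p.1 - p.2) := ⟨_, rfl⟩
  obtain ⟨y, hy⟩ : ∃ y, y = 2 * Real.pi * p.1 := ⟨_, rfl⟩
  obtain ⟨y', hy'⟩ : ∃ y', y' = 2 * Real.pi * p.2 := ⟨_, rfl⟩
  have hz : 2 * Real.pi * z = x + y + y' := by rw [hx, hy, hy']; ring
  rw [hz, ← hx, ← hy, ← hy']
  nlinarith [sq_nonneg (x - y), sq_nonneg (x - y'), sq_nonneg (y - y'), sq_nonneg (x * y),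
    sq_nonneg (x * y'), sq_nonneg (y * y'), sq_nonneg (x * y * y')]

/-- Bounded and square integrable functions of the two contracted frequencies. -/
structure Multiplier where
  toFun : ℝ × ℝ → ℂ
  measurable : Measurable toFun
  -- Only `sup` enters the time-integrated estimates; `l2` merely makes the operators bounded at a
  -- fixed time and may blow up along an approximation.
  sup : ℝ≥0
  enorm_le : ∀ p, ‖toFun p‖ₑ ≤ sup
  l2 : ℝ≥0
  lintegral_le : ∫⁻ p, ‖toFun p‖ₑ ^ 2 ≤ l2 ^ 2

/-- The sign with which particle `i` enters the commutator. -/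
def sgn : Idx k → ℝ := Sum.elim (fun _ => 1) (fun _ => -1)

/-- The change of kinetic energy in a collision with particle `i`. -/
def phase (i : Idx k) (z : ℝ) (p : ℝ × ℝ) : ℝ :=
  2 * Real.pi ^ 2 * (sgn i * ((z - p.1 - p.2) ^ 2 - z ^ 2) + p.1 ^ 2 - p.2 ^ 2)

theorem sgn_map (σ τ : Equiv.Perm (Fin k)) (i : Idx k) : sgn (Sum.map σ τ i) = sgn i := by
  rcases i with i | i <;> rfl

theorem sgn_up (i : Idx k) : sgn (up i) = sgn i := by
  rcases i with i | i <;> rfl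

theorem continuous_phase (i : Idx k) : Continuous (Function.uncurry (phase i)) := by
  unfold phase
  fun_prop

/-- The symbol of the collision operator at time `s` in the interaction picture. -/
def symbol (ε : ℝ) (M : Multiplier) (i : Idx k) (s : ℝ) (z : ℝ) (p : ℝ × ℝ) : ℂ :=
  sgn i * kappa ε z p * M.toFun p * Complex.exp (-(Complex.I * (s * phase i z p : ℝ)))

/-- A bound for the norms of the collision operators with a given multiplier. -/
def symbolBound (ε : ℝ) (M : Multiplier) : ℝ≥0 := (3 ^ (ε / 2)) * M.l2

theorem isSymbol_symbol {ε : ℝ} (hε : 0 ≤ ε) (M : Multiplier) (i : Idx k) (s : ℝ) :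
    IsSymbol (symbol ε M i s) (symbolBound ε M) where
  measurable := by
    refine Measurable.mul (Measurable.mul (Measurable.mul measurable_const ?_) ?_) ?_
    · exact Complex.measurable_ofReal.comp (measurable_kappa ε)
    · exact M.measurable.comp measurable_snd
    · have : Measurable (Function.uncurry (phase i)) := (continuous_phase i).measurable
      exact Complex.measurable_exp.comp ((measurable_const.mul
        (Complex.measurable_ofReal.comp (measurable_const.mul this))).neg)
  bound z := by
    have h1 : ∀ p, ‖symbol ε M i s z p‖ₑ ^ 2 ≤ ((3 ^ (ε / 2) : ℝ≥0) : ℝ≥0∞) ^ 2 *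
        ‖M.toFun p‖ₑ ^ 2 := by
      intro p
      rw [← mul_pow]
      gcongr
      rw [← ofReal_norm, ← ofReal_norm, ← ENNReal.ofReal_coe_nnreal,
        ← ENNReal.ofReal_mul (by positivity)]
      refine ENNReal.ofReal_le_ofReal ?_
      have hexp : ‖Complex.exp (-(Complex.I * (s * phase i z p : ℝ)))‖ = 1 := by
        rw [← mul_neg, ← Complex.ofReal_neg]
        exact Complex.norm_exp_I_mul_ofReal _
      have hs : ‖(sgn i : ℂ)‖ = 1 := by
        rcases i with i | i <;> simp [sgn]
      rw [symbol, norm_mul, norm_mul, norm_mul, hexp, hs, mul_one, one_mul, Complex.norm_real,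
        Real.norm_of_nonneg (kappa_nonneg _ _ _)]
      refine mul_le_mul_of_nonneg_right ?_ (norm_nonneg _)
      simpa using kappa_le hε z p
    calc _ ≤ ∫⁻ p, ((3 ^ (ε / 2) : ℝ≥0) : ℝ≥0∞) ^ 2 * ‖M.toFun p‖ₑ ^ 2 := lintegral_mono h1
      _ = ((3 ^ (ε / 2) : ℝ≥0) : ℝ≥0∞) ^ 2 * ∫⁻ p, ‖M.toFun p‖ₑ ^ 2 :=
          lintegral_const_mul _ (M.measurable.enorm.pow_const 2)
      _ ≤ ((3 ^ (ε / 2) : ℝ≥0) : ℝ≥0∞) ^ 2 * M.l2 ^ 2 := by gcongr; exact M.lintegral_le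
      _ = _ := by rw [symbolBound, ENNReal.coe_mul, mul_pow]

theorem sum_update_sq (x : Fin k → ℝ) (i : Fin k) (c : ℝ) :
    ∑ j, Function.update x i c j ^ 2 = ∑ j, x j ^ 2 + (c ^ 2 - x i ^ 2) := by
  rw [← sub_eq_iff_eq_add', ← Finset.sum_sub_distrib, Finset.sum_eq_single i]
  · simp
  · intro j _ hj
    simp [Function.update_of_ne hj]
  · simp

theorem sum_update_sq_sub (x : Idx k → ℝ) (i : Idx k) (c : ℝ) :
    (∑ j : Fin k, Function.update x i c (Sum.inl j) ^ 2) -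
      (∑ j : Fin k, Function.update x i c (Sum.inr j) ^ 2) =
    (∑ j : Fin k, x (Sum.inl j) ^ 2) - (∑ j : Fin k, x (Sum.inr j) ^ 2) +
      sgn i * (c ^ 2 - x i ^ 2) := by
  rcases i with i | i
  · have h3 : ∀ j : Fin k, Function.update x (Sum.inl i) c (Sum.inl j) =
        Function.update (fun j => x (Sum.inl j)) i c j := fun j => by
      simp only [Function.update_apply, Sum.inl.injEq]
    have h4 : ∀ j : Fin k, Function.update x (Sum.inl i) c (Sum.inr j) = x (Sum.inr j) :=
      fun j => Function.update_of_ne Sum.inr_ne_inl _ _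
    simp only [h3, h4, sgn, Sum.elim_inl]
    rw [sum_update_sq]
    ring
  · have h3 : ∀ j : Fin k, Function.update x (Sum.inr i) c (Sum.inr j) =
        Function.update (fun j => x (Sum.inr j)) i c j := fun j => by
      simp only [Function.update_apply, Sum.inr.injEq]
    have h4 : ∀ j : Fin k, Function.update x (Sum.inr i) c (Sum.inl j) = x (Sum.inl j) :=
      fun j => Function.update_of_ne Sum.inl_ne_inr _ _
    simp only [h3, h4, sgn, Sum.elim_inr]
    rw [sum_update_sq]
    ring

/-- Only the energy of particle `i` and of the contracted pair changes in the collision, so the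
total phase depends on `ζ i` and `p` alone. This keeps the operator of the interaction picture a
contraction with a symbol. -/
theorem freeSymbol_collapsePts (s : ℝ) (i : Idx k) (ζ : Pts k) (p : ℝ × ℝ) :
    freeSymbol (-s) ζ * freeSymbol s (collapsePts i (ζ, p)) =
      Complex.exp (-(Complex.I * (s * phase i (ζ i) p : ℝ))) := by
  rw [freeSymbol, freeSymbol, ← Complex.exp_add]
  congr 1
  rw [← neg_add, ← mul_add, ← Complex.ofReal_add]
  congr 3
  have key : (∑ j : Fin (k + 1), collapsePts i (ζ, p) (Sum.inl j) ^ 2) -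
      (∑ j : Fin (k + 1), collapsePts i (ζ, p) (Sum.inr j) ^ 2) =
      (∑ j : Fin k, ζ (Sum.inl j) ^ 2) - (∑ j : Fin k, ζ (Sum.inr j) ^ 2) +
      (sgn i * ((ζ i - p.1 - p.2) ^ 2 - ζ i ^ 2) + p.1 ^ 2 - p.2 ^ 2) := by
    have h := sum_update_sq_sub (fun j => ζ j) i (ζ i - p.1 - p.2)
    have h1 : ∀ j : Fin k, collapsePts i (ζ, p) (Sum.inl j.castSucc) =
        Function.update (fun j => ζ j) i (ζ i - p.1 - p.2) (Sum.inl j) := fun j => by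
      simp [collapsePts]
    have h2 : ∀ j : Fin k, collapsePts i (ζ, p) (Sum.inr j.castSucc) =
        Function.update (fun j => ζ j) i (ζ i - p.1 - p.2) (Sum.inr j) := fun j => by
      simp [collapsePts]
    rw [Fin.sum_univ_castSucc, Fin.sum_univ_castSucc, collapsePts_inl_last, collapsePts_inr_last]
    simp only [h1, h2]
    linarith
  rw [key, phase]
  ring

/-- The collision operator at time `s` in the interaction picture. -/
def collisionOp {ε : ℝ} (hε : 0 ≤ ε) (M : Multiplier) (i : Idx k) (s : ℝ) :
    Kernel (k + 1) →L[ℂ] Kernel k :=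
  collapseOp (symbol ε M i s) (isSymbol_symbol hε M i s) i

/-- Conjugation of the collision operator with the free evolution. -/
theorem collisionOp_eq {ε : ℝ} (hε : 0 ≤ ε) (M : Multiplier) (i : Idx k) (s : ℝ)
    (f : Kernel (k + 1)) :
    collisionOp hε M i s f = flow (-s) (collisionOp hε M i 0 (flow s f)) := by
  refine Lp.ext ?_
  filter_upwards [collapseOp_ae_eq (isSymbol_symbol hε M i s) i f,
    flow_ae_eq (-s) (collisionOp hε M i 0 (flow s f)),
    collapseOp_ae_eq (isSymbol_symbol hε M i 0) i (flow s f),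
    collapseFun_congr_ae (a := symbol ε M i 0) i (flow_ae_eq s f)] with ζ h1 h2 h3 h4
  rw [collisionOp, h1, h2, collisionOp, h3, h4, collapseFun, collapseFun, ← integral_const_mul]
  refine integral_congr_ae (Eventually.of_forall fun p => ?_)
  simp only [symbol]
  rw [← freeSymbol_collapsePts]
  simp only [zero_mul, Complex.ofReal_zero, mul_zero, neg_zero, Complex.exp_zero]
  ring

/-- By conjugation with the flow, only the bounded operator at time `0` and the joint continuity of
the flow are involved. -/
theorem continuous_collisionOp {ε : ℝ} (hε : 0 ≤ ε) (M : Multiplier) (i : Idx k) :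
    Continuous fun q : ℝ × Kernel (k + 1) => collisionOp hε M i q.1 q.2 := by
  have h0 : (fun q : ℝ × Kernel (k + 1) => collisionOp hε M i q.1 q.2) = fun q =>
      flow (-q.1) (collisionOp hε M i 0 (flow q.1 q.2)) :=
    funext fun q => collisionOp_eq hε M i q.1 q.2
  have h1 : Continuous fun q : ℝ × Kernel (k + 1) => collisionOp hε M i 0 (flow q.1 q.2) :=
    (collisionOp hε M i 0).continuous.comp (continuous_flow (k := k + 1))
  have h2 : Continuous fun q : ℝ × Kernel (k + 1) => -q.1 := continuous_fst.neg
  have h3 : Continuous fun q : ℝ × Kernel (k + 1) =>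
      (-q.1, collisionOp hε M i 0 (flow q.1 q.2)) := h2.prodMk h1
  have h4 : Continuous ((fun q : ℝ × Kernel k => flow q.1 q.2) ∘
      fun q : ℝ × Kernel (k + 1) => (-q.1, collisionOp hε M i 0 (flow q.1 q.2))) :=
    continuous_flow.comp h3
  rw [Function.comp_def] at h4
  rw [h0]
  exact h4

theorem permOp_collisionOp {ε : ℝ} (hε : 0 ≤ ε) (M : Multiplier) (σ τ : Equiv.Perm (Fin k))
    (i : Idx k) (s : ℝ) (f : Kernel (k + 1)) :
    permOp σ τ (collisionOp hε M i s f) =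
      collisionOp hε M (Sum.map σ τ i) s (permOp (extPerm σ) (extPerm τ) f) := by
  have h1 : symbol ε M i s = symbol ε M (Sum.map σ τ i) s := by
    ext z p
    simp only [symbol, phase, sgn_map]
  rw [collisionOp, permOp_collapseOp, collisionOp]
  congr 2

theorem collisionOp_comm {ε : ℝ} (hε : 0 ≤ ε) (M : Multiplier) {i j : Idx k} (hij : i ≠ j)
    (r s : ℝ) (f : Kernel (k + 2)) :
    collisionOp hε M i r (collisionOp hε M (up j) s f) =
      collisionOp hε M j s
        (collisionOp hε M (up i) r (permOp (swapLast k) (swapLast k) f)) := by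
  have h1 : ∀ (l : Idx k) (t : ℝ), symbol ε M (up l) t = symbol ε M l t := by
    intro l t
    ext z p
    simp only [symbol, phase, sgn_up]
  have h2 : ∀ (l : Idx k) (t : ℝ) (g : Kernel (k + 2)), collisionOp hε M (up l) t g =
      collapseOp (symbol ε M l t) (isSymbol_symbol hε M l t) (up l) g := by
    intro l t g
    rw [collisionOp]
    congr 2
    exact h1 l t
  rw [h2, h2]
  exact collapseOp_comm _ _ hij f

/-- The collision operators with a given multiplier. -/
def collisionFamily {ε : ℝ} (hε : 0 ≤ ε) (M : Multiplier) : CollisionFamily Kernel where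
  op _ i s := collisionOp hε M i s
  perm _ σ τ := permOp σ τ
  continuous_op _ i := continuous_collisionOp hε M i
  perm_op _ σ τ i s x := permOp_collisionOp hε M σ τ i s x
  op_comm _ _ _ hij r s x := collisionOp_comm hε M hij r s x

end

/-! ### The resonance estimate for the weights. -/

section

variable {k : ℕ}

/-- The function `⟨2πx⟩^{-2ε}`. -/
def decay (ε x : ℝ) : ℝ := (1 + (2 * Real.pi * x) ^ 2) ^ (-ε)

theorem decay_pos (ε x : ℝ) : 0 < decay ε x := by
  unfold decay
  positivity

theorem continuous_decay (ε : ℝ) : Continuous (decay ε) := by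
  unfold decay
  exact Continuous.rpow_const (by fun_prop) fun x => Or.inl (by positivity)

theorem decay_le_one {ε : ℝ} (hε : 0 ≤ ε) (x : ℝ) : decay ε x ≤ 1 :=
  Real.rpow_le_one_of_one_le_of_nonpos (by nlinarith [sq_nonneg (2 * Real.pi * x)]) (by linarith)

theorem sq_weight (ε x : ℝ) : weight ε x ^ 2 = (1 + (2 * Real.pi * x) ^ 2) ^ ε := by
  rw [weight, ← Real.rpow_natCast, ← Real.rpow_mul (by positivity)]
  congr 1
  push_cast
  ring

theorem rpow_div_le {ε A X Y Z : ℝ} (hε : 0 ≤ ε) (hA : 0 ≤ A) (hX : 0 < X) (hY : 0 < Y)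
    (hZ : 0 < Z) (h : A ≤ 9 * X) :
    A ^ ε / (X ^ ε * Y ^ ε * Z ^ ε) ≤ 9 ^ ε * (Y ^ (-ε) * Z ^ (-ε)) := by
  rw [Real.rpow_neg hY.le, Real.rpow_neg hZ.le, div_le_iff₀ (by positivity)]
  have h1 : A ^ ε ≤ 9 ^ ε * X ^ ε := by
    rw [← Real.mul_rpow (by norm_num) hX.le]
    exact Real.rpow_le_rpow hA h hε
  have h2 : 0 < Y ^ ε := by positivity
  have h3 : 0 < Z ^ ε := by positivity
  calc A ^ ε ≤ 9 ^ ε * X ^ ε := h1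
    _ = _ := by field_simp

/-- The largest of the three input brackets dominates the output bracket up to the factor `9` and
cancels it. The two other brackets remain as decay; the sum covers the three possible pairs. -/
theorem sq_kappa_le {ε : ℝ} (hε : 0 ≤ ε) (z : ℝ) (p : ℝ × ℝ) :
    kappa ε z p ^ 2 ≤ 9 ^ ε * (decay ε p.1 * decay ε p.2 +
      decay ε (z - p.1 - p.2) * decay ε p.2 + decay ε p.1 * decay ε (z - p.1 - p.2)) := by
  rw [kappa, div_pow, mul_pow, mul_pow, sq_weight, sq_weight, sq_weight, sq_weight]
  have h1 := mul_pos (decay_pos ε p.1) (decay_pos ε p.2)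
  have h2 := mul_pos (decay_pos ε (z - p.1 - p.2)) (decay_pos ε p.2)
  have h3 := mul_pos (decay_pos ε p.1) (decay_pos ε (z - p.1 - p.2))
  have h9 : (0 : ℝ) < 9 ^ ε := by positivity
  unfold decay at *
  obtain ⟨x, hx⟩ : ∃ x, x = 2 * Real.pi * (z - p.1 - p.2) := ⟨_, rfl⟩
  obtain ⟨y, hy⟩ : ∃ y, y = 2 * Real.pi * p.1 := ⟨_, rfl⟩
  obtain ⟨y', hy'⟩ : ∃ y', y' = 2 * Real.pi * p.2 := ⟨_, rfl⟩
  have hz : 2 * Real.pi * z = x + y + y' := by rw [hx, hy, hy']; ring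
  rw [hz]
  rw [← hx, ← hy, ← hy']
  rw [← hy, ← hy'] at h1
  rw [← hx, ← hy'] at h2
  rw [← hx, ← hy] at h3
  have hA : 1 + (x + y + y') ^ 2 ≤ 3 * ((1 + x ^ 2) + (1 + y ^ 2) + (1 + y' ^ 2)) := by
    nlinarith [sq_nonneg (x - y), sq_nonneg (x - y'), sq_nonneg (y - y')]
  have hA0 : 0 ≤ 1 + (x + y + y') ^ 2 := by positivity
  have hX : 0 < 1 + x ^ 2 := by positivity
  have hY : 0 < 1 + y ^ 2 := by positivity
  have hZ : 0 < 1 + y' ^ 2 := by positivity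
  rcases le_total (1 + x ^ 2) (1 + y ^ 2) with h | h
  · rcases le_total (1 + y ^ 2) (1 + y' ^ 2) with h' | h'
    · have := rpow_div_le hε hA0 hZ hY hX (by linarith)
      rw [mul_comm ((1 + y' ^ 2) ^ ε), mul_assoc, mul_comm ((1 + y' ^ 2) ^ ε), ← mul_assoc,
        mul_comm ((1 + y ^ 2) ^ ε)] at this
      refine this.trans (mul_le_mul_of_nonneg_left ?_ h9.le)
      linarith
    · have := rpow_div_le hε hA0 hY hX hZ (by linarith)
      rw [mul_comm ((1 + y ^ 2) ^ ε)] at this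
      refine this.trans (mul_le_mul_of_nonneg_left ?_ h9.le)
      linarith
  · rcases le_total (1 + x ^ 2) (1 + y' ^ 2) with h' | h'
    · have := rpow_div_le hε hA0 hZ hY hX (by linarith)
      rw [mul_comm ((1 + y' ^ 2) ^ ε), mul_assoc, mul_comm ((1 + y' ^ 2) ^ ε), ← mul_assoc,
        mul_comm ((1 + y ^ 2) ^ ε)] at this
      refine this.trans (mul_le_mul_of_nonneg_left ?_ h9.le)
      linarith
    · have := rpow_div_le hε hA0 hX hY hZ (by linarith)
      refine this.trans (mul_le_mul_of_nonneg_left ?_ h9.le)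
      linarith

/-- The value is `√(π/b)` with `b = 4π⁴u²`; the scaling `1/|u|` is all that matters. -/
theorem lintegral_gaussian_le {u : ℝ} (hu : u ≠ 0) (c : ℝ) :
    ∫⁻ y : ℝ, ENNReal.ofReal (Real.exp (-(c + 4 * Real.pi ^ 2 * u * y) ^ 2 / 4)) ≤
      ENNReal.ofReal |u|⁻¹ := by
  have hd : 4 * Real.pi ^ 2 * u ≠ 0 := by positivity
  obtain ⟨b, hb⟩ : ∃ b, b = (4 * Real.pi ^ 2 * u) ^ 2 / 4 := ⟨_, rfl⟩
  have hb0 : 0 < b := by rw [hb]; positivity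
  have h1 : ∀ y : ℝ, Real.exp (-(c + 4 * Real.pi ^ 2 * u * y) ^ 2 / 4) =
      Real.exp (-b * (y + c / (4 * Real.pi ^ 2 * u)) ^ 2) := by
    intro y
    congr 1
    rw [hb]
    field_simp
    ring
  simp only [h1]
  rw [lintegral_add_right_eq_self (fun y => ENNReal.ofReal (Real.exp (-b * y ^ 2))),
    ← ofReal_integral_eq_lintegral_ofReal (integrable_exp_neg_mul_sq hb0)
      (Eventually.of_forall fun _ => (Real.exp_pos _).le), integral_gaussian]
  refine ENNReal.ofReal_le_ofReal ?_
  have hpi := Real.pi_gt_three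
  have hu' : 0 < |u| := abs_pos.2 hu
  refine Real.sqrt_le_iff.2 ⟨by positivity, ?_⟩
  rw [inv_pow, sq_abs, hb, div_le_iff₀ (by positivity)]
  have : (u ^ 2)⁻¹ * ((4 * Real.pi ^ 2 * u) ^ 2 / 4) = 4 * Real.pi ^ 4 := by
    field_simp
  rw [this]
  have h3 : 1 ≤ Real.pi ^ 3 := one_le_pow₀ (by linarith)
  nlinarith

theorem decay_le_of_small {ε : ℝ} (hε : 0 ≤ ε) {u y : ℝ} (hu : u ≠ 0)
    (h : |u| ^ (-(1 / 2) : ℝ) ≤ |y|) : decay ε y ≤ |u| ^ ε := by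
  have hu' : 0 < |u| := abs_pos.2 hu
  have h1 : |u|⁻¹ ≤ 1 + (2 * Real.pi * y) ^ 2 := by
    have h2 : (|u| ^ (-(1 / 2) : ℝ)) ^ 2 ≤ |y| ^ 2 := by gcongr
    rw [← Real.rpow_natCast, ← Real.rpow_mul hu'.le, sq_abs] at h2
    norm_num at h2
    rw [Real.rpow_neg_one] at h2
    have hpi := Real.pi_gt_three
    nlinarith [sq_nonneg y, mul_nonneg (sq_nonneg y) (by nlinarith : (0 : ℝ) ≤ (2 * Real.pi) ^ 2 - 1)]
  rw [decay, Real.rpow_neg (by positivity)]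
  rw [show |u| ^ ε = ((|u|⁻¹) ^ ε)⁻¹ by rw [Real.inv_rpow hu'.le, inv_inv]]
  exact inv_anti₀ (by positivity) (Real.rpow_le_rpow (by positivity) h1 hε)

/-- For small `u` the factor `1/|u|` from the Gaussian alone would not be integrable. Beyond `|y| =
|u|^(-1/2)` the decay gains `|u|^ε`, while inside this ball the trivial bound `1` costs just the
length of the ball, of order `|u|^(-1/2)`. -/
theorem decay_mul_exp_le {ε : ℝ} (hε : 0 ≤ ε) {u : ℝ} (hu : u ≠ 0) (y : ℝ) {E : ℝ} (hE : 0 ≤ E)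
    (hE1 : E ≤ 1) :
    decay ε y * E ≤ |u| ^ ε * E + (Metric.closedBall (0 : ℝ) (|u| ^ (-(1 / 2) : ℝ))).indicator 1 y := by
  by_cases h : |u| ^ (-(1 / 2) : ℝ) ≤ |y|
  · have := decay_le_of_small hε hu h
    have h2 : 0 ≤ (Metric.closedBall (0 : ℝ) (|u| ^ (-(1 / 2) : ℝ))).indicator (1 : ℝ → ℝ) y :=
      Set.indicator_nonneg (fun _ _ => zero_le_one) _
    nlinarith
  · rw [Set.indicator_of_mem (by simpa using (not_le.1 h).le)]
    have := decay_le_one hε y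
    have h3 := (decay_pos ε y).le
    have h4 : 0 ≤ |u| ^ ε := by positivity
    simp only [Pi.one_apply]
    nlinarith [mul_le_one₀ this hE hE1, mul_nonneg h4 hE]

/-- For large `u` the factor `1/|u|` is worth half a power of the bracket of `u`. In the product of
the two powers both brackets may be replaced by the smaller one, which leaves the exponent `ε +
1/2`, integrable on the line. -/
theorem decay_mul_inv_le {ε : ℝ} (hε : 0 ≤ ε) {u : ℝ} (hu : 1 ≤ |u|) (y : ℝ) :
    decay ε y * |u|⁻¹ ≤ 10 * (decay (ε + 1 / 2) y + decay (ε + 1 / 2) u) := by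
  have hpi := Real.pi_gt_three
  have hpi4 := Real.pi_lt_four
  have hm : ∀ x : ℝ, 0 < 1 + (2 * Real.pi * x) ^ 2 := fun x => by positivity
  have h1 : |u|⁻¹ ≤ 10 * (1 + (2 * Real.pi * u) ^ 2) ^ (-(1 / 2) : ℝ) := by
    rw [Real.rpow_neg (hm u).le, ← Real.sqrt_eq_rpow, ← div_eq_mul_inv,
      inv_le_comm₀ (by positivity) (by positivity), inv_div, div_le_iff₀ (by norm_num)]
    refine Real.sqrt_le_iff.2 ⟨by positivity, ?_⟩
    rw [mul_pow, mul_pow |u|, sq_abs]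
    have : 1 ≤ u ^ 2 := by rw [← sq_abs]; exact one_le_pow₀ hu
    nlinarith [mul_nonneg (sq_nonneg u) (by nlinarith : (0 : ℝ) ≤ 64 - (2 * Real.pi) ^ 2)]
  have h2 : decay ε y * (1 + (2 * Real.pi * u) ^ 2) ^ (-(1 / 2) : ℝ) ≤
      decay (ε + 1 / 2) y + decay (ε + 1 / 2) u := by
    have hy := (decay_pos (ε + 1 / 2) y).le
    have hu := (decay_pos (ε + 1 / 2) u).le
    unfold decay at *
    rcases le_total (1 + (2 * Real.pi * y) ^ 2) (1 + (2 * Real.pi * u) ^ 2) with h | h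
    · refine le_trans ?_ (le_add_of_nonneg_right hu)
      rw [neg_add, Real.rpow_add (hm y)]
      refine mul_le_mul_of_nonneg_left ?_ (by positivity)
      exact Real.rpow_le_rpow_of_nonpos (hm y) h (by norm_num)
    · refine le_trans ?_ (le_add_of_nonneg_left hy)
      rw [neg_add, Real.rpow_add (hm u)]
      refine mul_le_mul_of_nonneg_right ?_ (by positivity)
      exact Real.rpow_le_rpow_of_nonpos (hm u) h (by linarith)
  calc _ ≤ decay ε y * (10 * (1 + (2 * Real.pi * u) ^ 2) ^ (-(1 / 2) : ℝ)) :=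
        mul_le_mul_of_nonneg_left h1 (decay_pos ε y).le
    _ = 10 * (decay ε y * (1 + (2 * Real.pi * u) ^ 2) ^ (-(1 / 2) : ℝ)) := by ring
    _ ≤ _ := mul_le_mul_of_nonneg_left h2 (by norm_num)

/-- At least one of `y` and `u - y` is as large as `|u|/2` in absolute value. -/
theorem decay_mul_decay_le {ε : ℝ} (hε : 0 ≤ ε) (u y : ℝ) :
    decay ε (u - y) * decay ε y ≤ 4 ^ ε * decay ε u := by
  have key : ∀ x : ℝ, u ^ 2 ≤ 4 * x ^ 2 → decay ε x ≤ 4 ^ ε * decay ε u := by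
    intro x hx
    unfold decay
    rw [Real.rpow_neg (by positivity), Real.rpow_neg (by positivity), ← div_eq_mul_inv,
      ← Real.div_rpow (by norm_num) (by positivity), ← Real.inv_rpow (by positivity)]
    refine Real.rpow_le_rpow (by positivity) ?_ hε
    rw [inv_le_comm₀ (by positivity) (by positivity), inv_div, div_le_iff₀ (by norm_num)]
    nlinarith [mul_le_mul_of_nonneg_left hx (sq_nonneg (2 * Real.pi))]
  have h1 := decay_le_one hε y
  have h2 := decay_le_one hε (u - y)
  have h3 := decay_pos ε y
  have h4 := decay_pos ε (u - y)
  by_cases h : u ^ 2 ≤ 4 * y ^ 2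
  · nlinarith [key y h]
  · have : u ^ 2 ≤ 4 * (u - y) ^ 2 := by
      nlinarith [sq_nonneg (u - 2 * y), sq_nonneg u]
    nlinarith [key (u - y) this]

theorem phase_inl (j : Fin k) (z η y : ℝ) : phase (Sum.inl j) z (η, y) =
    2 * Real.pi ^ 2 * ((z - η) ^ 2 - z ^ 2 + η ^ 2) - 4 * Real.pi ^ 2 * (z - η) * y := by
  simp only [phase, sgn, Sum.elim_inl]
  ring

theorem phase_inr (j : Fin k) (z : ℝ) (p : ℝ × ℝ) :
    phase (Sum.inr j) z p = -phase (Sum.inl j) z p.swap := by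
  simp only [phase, sgn, Sum.elim_inl, Sum.elim_inr, Prod.fst_swap, Prod.snd_swap]
  ring

theorem kappa_swap (ε z : ℝ) (p : ℝ × ℝ) : kappa ε z p.swap = kappa ε z p := by
  simp only [kappa, Prod.fst_swap, Prod.snd_swap]
  rw [sub_right_comm, mul_right_comm]

/-- A bound for the integral over one of the two contracted frequencies. -/
def fiberBound (ε η u : ℝ) : ℝ :=
  (Metric.closedBall (0 : ℝ) 1).indicator
      (fun u => 3 * |u| ^ (ε - 1) + 6 * |u| ^ (-(1 / 2) : ℝ)) u +
    20 * (1 + 4 ^ ε) * (decay (ε + 1 / 2) η + decay (ε + 1 / 2) u)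

/-- For `|u| ≤ 1` the decay in `η` is discarded and the integration variable is split at
`|u|^(-1/2)`, for both `y` and `u - y`. For `|u| ≥ 1` the decay factors are bounded independently of
`y`, and the Gaussian contributes `1/|u|`. -/
theorem lintegral_fiber_le {ε : ℝ} (hε : 0 ≤ ε) (η : ℝ) {u : ℝ} (hu : u ≠ 0) (c : ℝ) :
    ∫⁻ y : ℝ, ENNReal.ofReal ((decay ε η * decay ε y + decay ε (u - y) * decay ε y +
      decay ε η * decay ε (u - y)) * Real.exp (-(c + 4 * Real.pi ^ 2 * u * y) ^ 2 / 4)) ≤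
      ENNReal.ofReal (fiberBound ε η u) := by
  have hu' : 0 < |u| := abs_pos.2 hu
  have hd := decay_le_one hε
  have hd0 := fun y => (decay_pos ε y).le
  have hE0 : ∀ y, 0 ≤ Real.exp (-(c + 4 * Real.pi ^ 2 * u * y) ^ 2 / 4) :=
    fun y => (Real.exp_pos _).le
  have hE1 : ∀ y, Real.exp (-(c + 4 * Real.pi ^ 2 * u * y) ^ 2 / 4) ≤ 1 := fun y =>
    Real.exp_le_one_iff.2 (by nlinarith [sq_nonneg (c + 4 * Real.pi ^ 2 * u * y)])
  have hEm : Measurable fun y : ℝ => ENNReal.ofReal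
      (Real.exp (-(c + 4 * Real.pi ^ 2 * u * y) ^ 2 / 4)) := by fun_prop
  have hν : ∀ y, 0 ≤ decay (ε + 1 / 2) y := fun y => (decay_pos _ y).le
  have h4 : (0 : ℝ) < 4 ^ ε := by positivity
  rcases le_total |u| 1 with h | h
  · obtain ⟨r, hr⟩ : ∃ r, r = |u| ^ (-(1 / 2) : ℝ) := ⟨_, rfl⟩
    have hr0 : 0 ≤ r := by rw [hr]; positivity
    have hpt : ∀ y, (decay ε η * decay ε y + decay ε (u - y) * decay ε y +
        decay ε η * decay ε (u - y)) * Real.exp (-(c + 4 * Real.pi ^ 2 * u * y) ^ 2 / 4) ≤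
        3 * |u| ^ ε * Real.exp (-(c + 4 * Real.pi ^ 2 * u * y) ^ 2 / 4) +
          (2 * (Metric.closedBall (0 : ℝ) r).indicator 1 y +
          (Metric.closedBall (0 : ℝ) r).indicator 1 (u - y)) := by
      intro y
      have h1 := decay_mul_exp_le hε hu y (hE0 y) (hE1 y)
      have h2 := decay_mul_exp_le hε hu (u - y) (hE0 y) (hE1 y)
      rw [← hr] at h1 h2
      have h3 : decay ε η * decay ε y + decay ε (u - y) * decay ε y +
          decay ε η * decay ε (u - y) ≤ 2 * decay ε y + decay ε (u - y) := by
        nlinarith [mul_le_mul_of_nonneg_right (hd η) (hd0 y),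
          mul_le_mul_of_nonneg_right (hd (u - y)) (hd0 y),
          mul_le_mul_of_nonneg_right (hd η) (hd0 (u - y))]
      have h5 := mul_le_mul_of_nonneg_right h3 (hE0 y)
      linarith
    have hi0 : ∀ y, 0 ≤ (Metric.closedBall (0 : ℝ) r).indicator (1 : ℝ → ℝ) y := fun y =>
      Set.indicator_nonneg (fun _ _ => zero_le_one) _
    have hball : ∫⁻ y : ℝ, ENNReal.ofReal ((Metric.closedBall (0 : ℝ) r).indicator 1 y) =
        ENNReal.ofReal (2 * r) := by
      have : (fun y : ℝ => ENNReal.ofReal ((Metric.closedBall (0 : ℝ) r).indicator 1 y)) =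
          (Metric.closedBall (0 : ℝ) r).indicator 1 := by
        ext y
        by_cases hy : y ∈ Metric.closedBall (0 : ℝ) r <;> simp [hy]
      rw [this, lintegral_indicator_one Metric.isClosed_closedBall.measurableSet,
        Real.volume_closedBall]
    have him : Measurable fun y : ℝ =>
        ENNReal.ofReal ((Metric.closedBall (0 : ℝ) r).indicator 1 y) :=
      (measurable_one.indicator Metric.isClosed_closedBall.measurableSet).ennreal_ofReal
    calc _ ≤ ∫⁻ y : ℝ, (ENNReal.ofReal (3 * |u| ^ ε) *
          ENNReal.ofReal (Real.exp (-(c + 4 * Real.pi ^ 2 * u * y) ^ 2 / 4)) +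
          (ENNReal.ofReal 2 * ENNReal.ofReal ((Metric.closedBall (0 : ℝ) r).indicator 1 y) +
            ENNReal.ofReal ((Metric.closedBall (0 : ℝ) r).indicator 1 (u - y)))) := by
          refine lintegral_mono fun y => ?_
          rw [← ENNReal.ofReal_mul (by positivity), ← ENNReal.ofReal_mul (by norm_num),
            ← ENNReal.ofReal_add (mul_nonneg (by norm_num) (hi0 _)) (hi0 _),
            ← ENNReal.ofReal_add (by positivity)
              (add_nonneg (mul_nonneg (by norm_num) (hi0 _)) (hi0 _))]
          exact ENNReal.ofReal_le_ofReal (hpt y)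
      _ ≤ ENNReal.ofReal (3 * |u| ^ ε) * ENNReal.ofReal |u|⁻¹ +
          (ENNReal.ofReal 2 * ENNReal.ofReal (2 * r) + ENNReal.ofReal (2 * r)) := by
          rw [lintegral_add_left (hEm.const_mul _), lintegral_const_mul _ hEm,
            lintegral_add_left (him.const_mul _), lintegral_const_mul _ him, hball,
            lintegral_sub_left_eq_self (fun y => ENNReal.ofReal
              ((Metric.closedBall (0 : ℝ) r).indicator 1 y)) u, hball]
          gcongr
          exact lintegral_gaussian_le hu c
      _ = ENNReal.ofReal (3 * |u| ^ ε * |u|⁻¹ + (2 * (2 * r) + 2 * r)) := by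
          rw [ENNReal.ofReal_add (by positivity) (by positivity),
            ENNReal.ofReal_add (by positivity) (by positivity),
            ENNReal.ofReal_mul (p := 3 * |u| ^ ε) (by positivity),
            ENNReal.ofReal_mul (p := 2) (q := 2 * r) (by norm_num)]
      _ ≤ _ := by
          refine ENNReal.ofReal_le_ofReal ?_
          rw [fiberBound, Set.indicator_of_mem (by simpa using h), Real.rpow_sub_one hu'.ne',
            ← hr, div_eq_mul_inv]
          nlinarith [hν η, hν u, mul_nonneg (by positivity : (0 : ℝ) ≤ 20 * (1 + 4 ^ ε))
            (add_nonneg (hν η) (hν u))]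
  · have hpt : ∀ y, (decay ε η * decay ε y + decay ε (u - y) * decay ε y +
        decay ε η * decay ε (u - y)) ≤ 2 * decay ε η + 4 ^ ε * decay ε u := by
      intro y
      have := decay_mul_decay_le hε u y
      nlinarith [mul_le_mul_of_nonneg_left (hd y) (hd0 η),
        mul_le_mul_of_nonneg_left (hd (u - y)) (hd0 η)]
    have hc0 : 0 ≤ 2 * decay ε η + 4 ^ ε * decay ε u :=
      add_nonneg (mul_nonneg (by norm_num) (hd0 _)) (mul_nonneg h4.le (hd0 _))
    calc _ ≤ ∫⁻ y : ℝ, ENNReal.ofReal (2 * decay ε η + 4 ^ ε * decay ε u) *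
          ENNReal.ofReal (Real.exp (-(c + 4 * Real.pi ^ 2 * u * y) ^ 2 / 4)) := by
          refine lintegral_mono fun y => ?_
          rw [← ENNReal.ofReal_mul hc0]
          exact ENNReal.ofReal_le_ofReal (mul_le_mul_of_nonneg_right (hpt y) (hE0 y))
      _ ≤ ENNReal.ofReal (2 * decay ε η + 4 ^ ε * decay ε u) * ENNReal.ofReal |u|⁻¹ := by
          rw [lintegral_const_mul _ hEm]
          gcongr
          exact lintegral_gaussian_le hu c
      _ ≤ _ := by
          rw [← ENNReal.ofReal_mul hc0]
          refine ENNReal.ofReal_le_ofReal ?_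
          have h1 := decay_mul_inv_le hε h η
          have h2 := decay_mul_inv_le hε h u
          have h3 : 0 ≤ (Metric.closedBall (0 : ℝ) 1).indicator
              (fun u => 3 * |u| ^ (ε - 1) + 6 * |u| ^ (-(1 / 2) : ℝ)) u :=
            Set.indicator_nonneg (fun _ _ => by positivity) _
          rw [fiberBound]
          have h5 := mul_le_mul_of_nonneg_left h2 h4.le
          have h6 := mul_nonneg h4.le (hν η)
          nlinarith

theorem lintegral_decay_lt_top {s : ℝ} (hs : 1 / 2 < s) :
    ∫⁻ x : ℝ, ENNReal.ofReal (decay s x) < ∞ := by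
  have h := (integrable_rpow_neg_one_add_norm_sq (E := ℝ) (μ := volume) (r := 2 * s)
    (by simpa using by linarith)).lintegral_lt_top
  refine lt_of_le_of_lt (lintegral_mono fun x => ENNReal.ofReal_le_ofReal ?_) h
  rw [decay, show -(2 * s) / 2 = -s by ring]
  refine Real.rpow_le_rpow_of_nonpos (by positivity) ?_ (by linarith)
  have hpi := Real.pi_gt_three
  rw [Real.norm_eq_abs, sq_abs]
  nlinarith [mul_nonneg (sq_nonneg x) (by nlinarith : (0 : ℝ) ≤ (2 * Real.pi) ^ 2 - 1)]

theorem lintegral_abs_rpow_lt_top {s : ℝ} (hs : -1 < s) :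
    ∫⁻ x in Metric.closedBall (0 : ℝ) 1, ENNReal.ofReal (|x| ^ s) < ∞ := by
  have h : IntegrableOn (fun x : ℝ => |x| ^ s) (Metric.closedBall (0 : ℝ) 1) := by
    have h1 : IntegrableOn (fun x : ℝ => |x| ^ s) (Set.Ioc 0 1) := by
      have := (intervalIntegral.intervalIntegrable_rpow' (a := 0) (b := 1) hs).1
      refine this.congr_fun (fun x hx => ?_) measurableSet_Ioc
      simp only [abs_of_pos hx.1]
    have h2 : IntegrableOn (fun x : ℝ => |x| ^ s) (Set.Ico (-1) 0) := by
      have := h1.comp_neg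
      simpa using this
    have h3 : IntegrableOn (fun x : ℝ => |x| ^ s) {0} := by simp
    refine ((h2.union h3).union h1).mono_set ?_
    intro x hx
    rw [Real.closedBall_eq_Icc] at hx
    rcases lt_trichotomy x 0 with h | h | h
    · exact Or.inl (Or.inl ⟨by linarith [hx.1], h⟩)
    · exact Or.inl (Or.inr h)
    · exact Or.inr ⟨h, by linarith [hx.2]⟩
  exact h.lintegral_lt_top

/-- Positivity of `ε` is decisive twice: `|u|^(ε-1)` is integrable at the origin, and the decay of
exponent `ε + 1/2` is integrable at infinity. Translation invariance makes the bound independent of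
`z`. -/
theorem exists_lintegral_fiberBound_le {ε : ℝ} (hε : 0 < ε) :
    ∃ K : ℝ≥0, ∀ z : ℝ, ∫⁻ η, ENNReal.ofReal (fiberBound ε η (z - η)) ≤ K := by
  have hsing : Measurable fun u : ℝ => ENNReal.ofReal ((Metric.closedBall (0 : ℝ) 1).indicator
      (fun u => 3 * |u| ^ (ε - 1) + 6 * |u| ^ (-(1 / 2) : ℝ)) u) :=
    (Measurable.indicator (by fun_prop) Metric.isClosed_closedBall.measurableSet).ennreal_ofReal
  have hdm : Measurable fun u : ℝ => ENNReal.ofReal (decay (ε + 1 / 2) u) :=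
    (continuous_decay _).measurable.ennreal_ofReal
  have hν : ∀ y, 0 ≤ decay (ε + 1 / 2) y := fun y => (decay_pos _ y).le
  have hc : (0 : ℝ) ≤ 20 * (1 + 4 ^ ε) := by positivity
  have h1 : ∫⁻ u, ENNReal.ofReal ((Metric.closedBall (0 : ℝ) 1).indicator
      (fun u => 3 * |u| ^ (ε - 1) + 6 * |u| ^ (-(1 / 2) : ℝ)) u) < ∞ := by
    have : (fun u => ENNReal.ofReal ((Metric.closedBall (0 : ℝ) 1).indicator
        (fun u => 3 * |u| ^ (ε - 1) + 6 * |u| ^ (-(1 / 2) : ℝ)) u)) =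
        (Metric.closedBall (0 : ℝ) 1).indicator
          (fun u => ENNReal.ofReal 3 * ENNReal.ofReal (|u| ^ (ε - 1)) +
            ENNReal.ofReal 6 * ENNReal.ofReal (|u| ^ (-(1 / 2) : ℝ))) := by
      ext u
      by_cases hu : u ∈ Metric.closedBall (0 : ℝ) 1
      · rw [Set.indicator_of_mem hu, Set.indicator_of_mem hu,
          ENNReal.ofReal_add (by positivity) (by positivity), ENNReal.ofReal_mul (by norm_num),
          ENNReal.ofReal_mul (by norm_num)]
      · rw [Set.indicator_of_notMem hu, Set.indicator_of_notMem hu, ENNReal.ofReal_zero]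
    rw [this, lintegral_indicator Metric.isClosed_closedBall.measurableSet,
      lintegral_add_left (by fun_prop), lintegral_const_mul _ (by fun_prop),
      lintegral_const_mul _ (by fun_prop)]
    have h2 := lintegral_abs_rpow_lt_top (s := ε - 1) (by linarith)
    have h3 := lintegral_abs_rpow_lt_top (s := -(1 / 2)) (by norm_num)
    exact ENNReal.add_lt_top.2 ⟨ENNReal.mul_lt_top (by finiteness) h2,
      ENNReal.mul_lt_top (by finiteness) h3⟩
  have h2 := lintegral_decay_lt_top (s := ε + 1 / 2) (by linarith)
  have h3 : ∀ z : ℝ, ∫⁻ η, ENNReal.ofReal (fiberBound ε η (z - η)) =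
      (∫⁻ u, ENNReal.ofReal ((Metric.closedBall (0 : ℝ) 1).indicator
        (fun u => 3 * |u| ^ (ε - 1) + 6 * |u| ^ (-(1 / 2) : ℝ)) u)) +
      ENNReal.ofReal (20 * (1 + 4 ^ ε)) * ((∫⁻ x : ℝ, ENNReal.ofReal (decay (ε + 1 / 2) x)) +
        ∫⁻ x : ℝ, ENNReal.ofReal (decay (ε + 1 / 2) x)) := by
    intro z
    have : ∀ η, ENNReal.ofReal (fiberBound ε η (z - η)) =
        ENNReal.ofReal ((Metric.closedBall (0 : ℝ) 1).indicator
          (fun u => 3 * |u| ^ (ε - 1) + 6 * |u| ^ (-(1 / 2) : ℝ)) (z - η)) +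
        ENNReal.ofReal (20 * (1 + 4 ^ ε)) * (ENNReal.ofReal (decay (ε + 1 / 2) η) +
          ENNReal.ofReal (decay (ε + 1 / 2) (z - η))) := by
      intro η
      rw [fiberBound, ENNReal.ofReal_add (Set.indicator_nonneg (fun _ _ => by positivity) _)
        (mul_nonneg hc (add_nonneg (hν _) (hν _))), ENNReal.ofReal_mul hc,
        ENNReal.ofReal_add (hν _) (hν _)]
    simp only [this]
    have hdm' : Measurable fun η : ℝ => ENNReal.ofReal (decay (ε + 1 / 2) (z - η)) :=
      hdm.comp (measurable_const.sub measurable_id)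
    have hsing' : Measurable fun η : ℝ => ENNReal.ofReal
        ((Metric.closedBall (0 : ℝ) 1).indicator
          (fun u => 3 * |u| ^ (ε - 1) + 6 * |u| ^ (-(1 / 2) : ℝ)) (z - η)) :=
      hsing.comp (measurable_const.sub measurable_id)
    rw [lintegral_add_left hsing',
      lintegral_const_mul' _ _ ENNReal.ofReal_ne_top, lintegral_add_left hdm,
      lintegral_sub_left_eq_self (fun u => ENNReal.ofReal (decay (ε + 1 / 2) u)) z,
      lintegral_sub_left_eq_self (fun u => ENNReal.ofReal ((Metric.closedBall (0 : ℝ) 1).indicator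
        (fun u => 3 * |u| ^ (ε - 1) + 6 * |u| ^ (-(1 / 2) : ℝ)) u)) z]
  have h4 := ENNReal.add_lt_top.2 ⟨h1, ENNReal.mul_lt_top
    (ENNReal.ofReal_lt_top (r := 20 * (1 + 4 ^ ε))) (ENNReal.add_lt_top.2 ⟨h2, h2⟩)⟩
  exact ⟨_, fun z => by rw [h3 z, ENNReal.coe_toNNReal h4.ne]⟩

/-- The resonance estimate: the weights are square integrable along the level sets of the phase,
uniformly in the output frequency and the level. -/
theorem exists_lintegral_sq_kappa_le {ε : ℝ} (hε : 0 < ε) :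
    ∃ K : ℝ≥0, ∀ {k : ℕ} (i : Idx k) (z ω : ℝ),
      ∫⁻ p, ENNReal.ofReal (kappa ε z p ^ 2 * Real.exp (-(ω - phase i z p) ^ 2 / 4)) ≤ K := by
  obtain ⟨K, hK⟩ := exists_lintegral_fiberBound_le hε
  have h9 : (0 : ℝ) ≤ 9 ^ ε := by positivity
  have hm : ∀ {k : ℕ} (i : Idx k) (z ω : ℝ), Measurable fun p : ℝ × ℝ =>
      ENNReal.ofReal (kappa ε z p ^ 2 * Real.exp (-(ω - phase i z p) ^ 2 / 4)) := by
    intro k i z ω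
    have h1 : Measurable (kappa ε z) := (measurable_kappa ε).of_uncurry_left
    have h2 : Measurable (phase i z) := (continuous_phase i).measurable.of_uncurry_left
    fun_prop
  have main : ∀ {k : ℕ} (j : Fin k) (z ω : ℝ), ∫⁻ p, ENNReal.ofReal
      (kappa ε z p ^ 2 * Real.exp (-(ω - phase (Sum.inl j) z p) ^ 2 / 4)) ≤
      (((9 : ℝ) ^ ε).toNNReal * K : ℝ≥0) := by
    intro k j z ω
    -- For a fixed first frequency `η` the phase is affine in the second one, with slope `-4π²(z -
    -- η)`; the slope vanishes only at the single point `η = z`.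
    rw [Measure.volume_eq_prod, lintegral_prod _ (hm _ _ _).aemeasurable]
    calc _ ≤ ∫⁻ η : ℝ, ENNReal.ofReal (9 ^ ε) * ENNReal.ofReal (fiberBound ε η (z - η)) := by
          refine lintegral_mono_ae ?_
          filter_upwards [Measure.ae_ne volume z] with η hη
          have hu : z - η ≠ 0 := sub_ne_zero.2 (Ne.symm hη)
          obtain ⟨c, hc⟩ : ∃ c, c = ω - 2 * Real.pi ^ 2 * ((z - η) ^ 2 - z ^ 2 + η ^ 2) :=
            ⟨_, rfl⟩
          refine le_trans ?_ (mul_le_mul_right (lintegral_fiber_le hε.le η hu c) _)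
          have hmm : Measurable fun y : ℝ => ENNReal.ofReal
              ((decay ε η * decay ε y + decay ε (z - η - y) * decay ε y +
              decay ε η * decay ε (z - η - y)) *
                Real.exp (-(c + 4 * Real.pi ^ 2 * (z - η) * y) ^ 2 / 4)) := by
            have := continuous_decay ε
            fun_prop
          rw [← lintegral_const_mul _ hmm]
          refine lintegral_mono fun y => ?_
          rw [← ENNReal.ofReal_mul h9]
          refine ENNReal.ofReal_le_ofReal ?_
          rw [phase_inl, hc, ← mul_assoc]
          refine (mul_le_mul_of_nonneg_right (sq_kappa_le hε.le z (η, y))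
            (Real.exp_pos _).le).trans (le_of_eq ?_)
          congr 3
          ring
      _ ≤ _ := by
          rw [lintegral_const_mul' _ _ ENNReal.ofReal_ne_top, ENNReal.coe_mul]
          gcongr
          · exact le_refl _
          · exact hK z
  refine ⟨((9 : ℝ) ^ ε).toNNReal * K, fun {k} i z ω => ?_⟩
  rcases i with j | j
  · exact main j z ω
  -- A primed particle reduces to an unprimed one by exchanging the two contracted frequencies and
  -- reversing the phase.
  · refine le_trans (le_of_eq ?_) (main j z (-ω))
    rw [Measure.volume_eq_prod, ← lintegral_prod_swap]
    refine lintegral_congr fun p => ?_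
    rw [kappa_swap, phase_inr, Prod.swap_swap]
    congr 3
    ring

end

/-! ### Oscillatory integrals and the collapse estimate. -/

section

variable {k : ℕ}

theorem norm_exp_neg_I_mul (x : ℝ) : ‖Complex.exp (-(Complex.I * (x : ℂ)))‖ = 1 := by
  rw [← mul_neg, ← Complex.ofReal_neg]
  exact Complex.norm_exp_I_mul_ofReal _

/-- The Fourier transform of a Gaussian is a Gaussian; the translation by `a` produces a unimodular
factor, and `√π ≤ 2`. -/
theorem enorm_integral_gaussian_le (a δ : ℝ) :
    ‖∫ r : ℝ, (Real.exp (-(r - a) ^ 2) : ℂ) * Complex.exp (-(Complex.I * (r * δ : ℝ)))‖ₑ ≤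
      2 * ENNReal.ofReal (Real.exp (-δ ^ 2 / 4)) := by
  have h1 : ∫ r : ℝ, (Real.exp (-(r - a) ^ 2) : ℂ) * Complex.exp (-(Complex.I * (r * δ : ℝ))) =
      Complex.exp (-(Complex.I * (a * δ : ℝ))) * ∫ r : ℝ,
        Complex.exp (Complex.I * (-δ : ℂ) * r) * Complex.exp (-(1 : ℂ) * r ^ 2) := by
    rw [← integral_const_mul, ← integral_add_right_eq_self _ a]
    refine integral_congr_ae (Eventually.of_forall fun r => ?_)
    simp only [Complex.ofReal_exp, ← Complex.exp_add]
    congr 1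
    push_cast
    ring
  rw [h1, fourierIntegral_gaussian (by simp), enorm_mul, enorm_mul]
  have h2 : ‖Complex.exp (-(Complex.I * (a * δ : ℝ)))‖ₑ = 1 := by
    rw [← ofReal_norm, norm_exp_neg_I_mul, ENNReal.ofReal_one]
  have h3 : ‖((Real.pi : ℂ) / 1) ^ (1 / 2 : ℂ)‖ₑ ≤ 2 := by
    rw [div_one, ← ofReal_norm, Complex.norm_cpow_eq_rpow_re_of_pos Real.pi_pos,
      show (1 / 2 : ℂ).re = 1 / 2 by norm_num, ← Real.sqrt_eq_rpow]
    have : √Real.pi ≤ 2 := Real.sqrt_le_iff.2 ⟨by norm_num, by linarith [Real.pi_lt_four]⟩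
    simpa using ENNReal.ofReal_le_ofReal this
  have h4 : ‖Complex.exp (-(-δ : ℂ) ^ 2 / (4 * 1))‖ₑ = ENNReal.ofReal (Real.exp (-δ ^ 2 / 4)) := by
    rw [← ofReal_norm, Complex.norm_exp]
    congr 2
    have : (-(-δ : ℂ) ^ 2 / (4 * 1)) = ((-δ ^ 2 / 4 : ℝ) : ℂ) := by push_cast; ring
    rw [this, Complex.ofReal_re]
  rw [h2, h4, one_mul]
  gcongr

section oscillatory

variable {α : Type*} [MeasurableSpace α] {μ : Measure α} [SFinite μ] {Ω : α → ℝ} {g : α → ℂ}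

/-- The oscillatory integral of `g` with phase `Ω`. -/
def oscInt (μ : Measure α) (Ω : α → ℝ) (g : α → ℂ) (r : ℝ) : ℂ :=
  ∫ p, g p * Complex.exp (-(Complex.I * (r * Ω p : ℝ))) ∂μ

theorem measurable_oscInt (hΩ : Measurable Ω) (hg : Measurable g) : Measurable (oscInt μ Ω g) := by
  have : Measurable fun q : ℝ × α => g q.2 * Complex.exp (-(Complex.I * (q.1 * Ω q.2 : ℝ))) := by
    fun_prop
  exact (this.stronglyMeasurable.integral_prod_right' (ν := μ)).measurable

/-- The square is expanded into a double integral and the time integration is carried out first,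
which confines pairs of frequencies to nearly equal phases. The Gaussian weight makes the time
integral explicit. -/
theorem lintegral_gaussian_oscInt_le (hΩ : Measurable Ω) (hg : Measurable g)
    (hgi : Integrable g μ) (a : ℝ) :
    ∫⁻ r, ENNReal.ofReal (Real.exp (-(r - a) ^ 2)) * ‖oscInt μ Ω g r‖ₑ ^ 2 ≤
      2 * ∫⁻ q, ‖g q.1‖ₑ * ‖g q.2‖ₑ * ENNReal.ofReal (Real.exp (-(Ω q.1 - Ω q.2) ^ 2 / 4))
        ∂(μ.prod μ) := by
  have hE : Integrable fun r : ℝ => Real.exp (-(r - a) ^ 2) := by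
    have := (integrable_exp_neg_mul_sq (b := 1) one_pos).comp_sub_right a
    simpa using this
  have hEc : Integrable fun r : ℝ => (Real.exp (-(r - a) ^ 2) : ℂ) := hE.ofReal
  have hprod : ∀ r, oscInt μ Ω g r * (starRingEnd ℂ) (oscInt μ Ω g r) =
      ∫ q, (g q.1 * (starRingEnd ℂ) (g q.2)) *
        Complex.exp (-(Complex.I * (r * (Ω q.1 - Ω q.2) : ℝ))) ∂(μ.prod μ) := by
    intro r
    rw [oscInt, ← integral_conj, ← integral_prod_mul]
    refine integral_congr_ae (Eventually.of_forall fun q => ?_)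
    simp only [map_mul, ← Complex.exp_conj, map_neg, Complex.conj_I, Complex.conj_ofReal]
    rw [mul_mul_mul_comm, ← Complex.exp_add]
    congr 2
    push_cast
    ring
  have hgg : Integrable (fun q : α × α => g q.1 * (starRingEnd ℂ) (g q.2)) (μ.prod μ) := by
    have hgc : Integrable (fun p => (starRingEnd ℂ) (g p)) μ :=
      Complex.conjCLE.toContinuousLinearMap.integrable_comp hgi
    exact hgi.mul_prod hgc
  have hF : Integrable (Function.uncurry fun (r : ℝ) (q : α × α) =>
      (Real.exp (-(r - a) ^ 2) : ℂ) * ((g q.1 * (starRingEnd ℂ) (g q.2)) *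
        Complex.exp (-(Complex.I * (r * (Ω q.1 - Ω q.2) : ℝ)))))
      (volume.prod (μ.prod μ)) := by
    refine (hEc.mul_prod hgg).mono ?_ (Eventually.of_forall fun x => ?_)
    · have hgm : Measurable fun x : ℝ × (α × α) => g x.2.1 * (starRingEnd ℂ) (g x.2.2) :=
        (hg.comp (measurable_fst.comp measurable_snd)).mul
          (Complex.continuous_conj.measurable.comp
            (hg.comp (measurable_snd.comp measurable_snd)))
      have : Measurable (Function.uncurry fun (r : ℝ) (q : α × α) =>
          (Real.exp (-(r - a) ^ 2) : ℂ) * ((g q.1 * (starRingEnd ℂ) (g q.2)) *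
          Complex.exp (-(Complex.I * (r * (Ω q.1 - Ω q.2) : ℝ))))) := by
        unfold Function.uncurry
        refine Measurable.mul (by fun_prop) (hgm.mul (by fun_prop))
      exact this.aestronglyMeasurable
    · simp only [Function.uncurry, norm_mul, norm_exp_neg_I_mul, mul_one, le_refl]
  have hkey : ∫ r, (Real.exp (-(r - a) ^ 2) : ℂ) *
      (oscInt μ Ω g r * (starRingEnd ℂ) (oscInt μ Ω g r)) =
      ∫ q, (g q.1 * (starRingEnd ℂ) (g q.2)) * (∫ r : ℝ, (Real.exp (-(r - a) ^ 2) : ℂ) *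
        Complex.exp (-(Complex.I * (r * (Ω q.1 - Ω q.2) : ℝ)))) ∂(μ.prod μ) := by
    simp only [hprod, ← integral_const_mul]
    rw [integral_integral_swap hF]
    refine integral_congr_ae (Eventually.of_forall fun q => ?_)
    refine integral_congr_ae (Eventually.of_forall fun r => ?_)
    simp only
    ring
  have hbd : ∀ r, ‖oscInt μ Ω g r‖ ≤ ∫ p, ‖g p‖ ∂μ := fun r =>
    (norm_integral_le_integral_norm _).trans (le_of_eq (by
      simp only [norm_mul, norm_exp_neg_I_mul, mul_one]))
  have hint : Integrable fun r => Real.exp (-(r - a) ^ 2) * ‖oscInt μ Ω g r‖ ^ 2 := by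
    refine (hE.mul_const ((∫ p, ‖g p‖ ∂μ) ^ 2)).mono
      (hE.aestronglyMeasurable.mul
        (((measurable_oscInt hΩ hg).norm.pow_const 2).aestronglyMeasurable))
      (Eventually.of_forall fun r => ?_)
    rw [norm_mul, norm_mul, norm_pow, norm_pow, norm_norm,
      Real.norm_of_nonneg (integral_nonneg fun _ => norm_nonneg _)]
    gcongr
    exact hbd r
  have hleft : ∫⁻ r, ENNReal.ofReal (Real.exp (-(r - a) ^ 2)) * ‖oscInt μ Ω g r‖ₑ ^ 2 =
      ‖∫ r, (Real.exp (-(r - a) ^ 2) : ℂ) *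
        (oscInt μ Ω g r * (starRingEnd ℂ) (oscInt μ Ω g r))‖ₑ := by
    have h1 : ∀ r, (Real.exp (-(r - a) ^ 2) : ℂ) *
        (oscInt μ Ω g r * (starRingEnd ℂ) (oscInt μ Ω g r)) =
        ((Real.exp (-(r - a) ^ 2) * ‖oscInt μ Ω g r‖ ^ 2 : ℝ) : ℂ) := by
      intro r
      rw [Complex.mul_conj']
      push_cast
      rfl
    simp only [h1]
    rw [integral_complex_ofReal, ← ofReal_norm, Complex.norm_real, Real.norm_of_nonneg
      (integral_nonneg fun r => by positivity), ofReal_integral_eq_lintegral_ofReal hint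
        (Eventually.of_forall fun r => by positivity)]
    refine lintegral_congr fun r => ?_
    rw [ENNReal.ofReal_mul (Real.exp_pos _).le, ENNReal.ofReal_pow (norm_nonneg _), ofReal_norm]
  rw [hleft, hkey]
  refine (enorm_integral_le_lintegral_enorm _).trans ?_
  rw [← lintegral_const_mul' _ _ (by norm_num)]
  refine lintegral_mono fun q => ?_
  rw [enorm_mul, enorm_mul, RCLike.enorm_conj, mul_left_comm]
  gcongr
  exact enorm_integral_gaussian_le a _

/-- A Schur test with crossed weights: `|κ_p h_p κ_q h_q| ≤ |h_p|² κ_q² + |h_q|² κ_p²`, so that each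
integration of `κ²` runs over the variable absent from `h`. The factor `12` is `3 · 2 · 2`: on an
interval of length at most one the Gaussian weight is at least `1/e ≥ 1/3`, the Gaussian transform
costs `2`, and there are two crossed terms. -/
theorem lintegral_sq_oscInt_le (hΩ : Measurable Ω) {κ : α → ℝ} (hκ : Measurable κ) {h : α → ℂ}
    (hh : Measurable h) (hi : Integrable (fun p => κ p * h p) μ) {K : ℝ≥0∞}
    (hK : ∀ ω, ∫⁻ p, ENNReal.ofReal (κ p ^ 2 * Real.exp (-(ω - Ω p) ^ 2 / 4)) ∂μ ≤ K)
    {a b : ℝ} (hab : b ≤ a + 1) :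
    ∫⁻ r in Set.Ioc a b, ‖oscInt μ Ω (fun p => κ p * h p) r‖ₑ ^ 2 ≤
      12 * K * ∫⁻ p, ‖h p‖ₑ ^ 2 ∂μ := by
  have hgm : Measurable fun p => (κ p : ℂ) * h p := by fun_prop
  have hhm : Measurable fun p => ‖h p‖ₑ ^ 2 := hh.enorm.pow_const 2
  have h1 : ∫⁻ r in Set.Ioc a b, ‖oscInt μ Ω (fun p => κ p * h p) r‖ₑ ^ 2 ≤
      3 * ∫⁻ r, ENNReal.ofReal (Real.exp (-(r - a) ^ 2)) *
        ‖oscInt μ Ω (fun p => κ p * h p) r‖ₑ ^ 2 := by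
    rw [← lintegral_const_mul' _ _ (by norm_num)]
    refine le_trans (setLIntegral_mono' measurableSet_Ioc fun r hr => ?_)
      (setLIntegral_le_lintegral (Set.Ioc a b) _)
    rw [← mul_assoc]
    refine le_mul_of_one_le_left' ?_
    have : (1 : ℝ) ≤ 3 * Real.exp (-(r - a) ^ 2) := by
      have h2 : Real.exp (-1) ≤ Real.exp (-(r - a) ^ 2) :=
        Real.exp_le_exp.2 (by nlinarith [hr.1, hr.2])
      have h3 : 1 ≤ 3 * Real.exp (-1) := by
        rw [Real.exp_neg, ← div_eq_mul_inv, one_le_div (Real.exp_pos _)]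
        linarith [Real.exp_one_lt_d9]
      linarith
    calc (1 : ℝ≥0∞) = ENNReal.ofReal 1 := by simp
      _ ≤ ENNReal.ofReal (3 * Real.exp (-(r - a) ^ 2)) := ENNReal.ofReal_le_ofReal this
      _ = _ := by rw [ENNReal.ofReal_mul (by norm_num)]; simp
  have hterm : ∀ p q, ‖(κ p : ℂ) * h p‖ₑ * ‖(κ q : ℂ) * h q‖ₑ *
      ENNReal.ofReal (Real.exp (-(Ω p - Ω q) ^ 2 / 4)) ≤
      ‖h p‖ₑ ^ 2 * ENNReal.ofReal (κ q ^ 2 * Real.exp (-(Ω p - Ω q) ^ 2 / 4)) +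
      ‖h q‖ₑ ^ 2 * ENNReal.ofReal (κ p ^ 2 * Real.exp (-(Ω q - Ω p) ^ 2 / 4)) := by
    intro p q
    have hk : ∀ p, ENNReal.ofReal (κ p ^ 2) = ‖(κ p : ℂ)‖ₑ ^ 2 := fun p => by
      rw [← ofReal_norm, ← ENNReal.ofReal_pow (norm_nonneg _), Complex.norm_real,
        Real.norm_eq_abs, sq_abs]
    have h2 : ∀ x y : ℝ≥0∞, x * y ≤ x ^ 2 + y ^ 2 := by
      intro x y
      rcases le_total x y with h | h
      · exact le_add_left (by rw [sq]; gcongr)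
      · exact le_add_right (by rw [sq]; gcongr)
    have h3 : (Ω q - Ω p) ^ 2 = (Ω p - Ω q) ^ 2 := by ring
    rw [h3, ENNReal.ofReal_mul (sq_nonneg _), ENNReal.ofReal_mul (sq_nonneg _), hk, hk,
      ← mul_assoc, ← mul_assoc, ← add_mul, ← mul_pow, ← mul_pow, enorm_mul, enorm_mul]
    gcongr
    refine le_trans (le_of_eq ?_) (h2 _ _)
    ring
  have hm1 : Measurable fun q : α × α => ‖h q.1‖ₑ ^ 2 *
      ENNReal.ofReal (κ q.2 ^ 2 * Real.exp (-(Ω q.1 - Ω q.2) ^ 2 / 4)) := by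
    have : Measurable fun q : α × α => ‖h q.1‖ₑ ^ 2 := hhm.comp measurable_fst
    refine this.mul ?_
    fun_prop
  have hA : ∫⁻ q : α × α, ‖h q.1‖ₑ ^ 2 *
      ENNReal.ofReal (κ q.2 ^ 2 * Real.exp (-(Ω q.1 - Ω q.2) ^ 2 / 4)) ∂(μ.prod μ) ≤
      K * ∫⁻ p, ‖h p‖ₑ ^ 2 ∂μ := by
    rw [lintegral_prod _ hm1.aemeasurable, ← lintegral_const_mul _ hhm]
    refine lintegral_mono fun p => ?_
    change ∫⁻ y, ‖h p‖ₑ ^ 2 * ENNReal.ofReal (κ y ^ 2 * Real.exp (-(Ω p - Ω y) ^ 2 / 4)) ∂μ ≤ _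
    rw [lintegral_const_mul' _ _ (by finiteness), mul_comm]
    exact mul_le_mul_left (hK _) _
  have hB : ∫⁻ q : α × α, ‖h q.2‖ₑ ^ 2 *
      ENNReal.ofReal (κ q.1 ^ 2 * Real.exp (-(Ω q.2 - Ω q.1) ^ 2 / 4)) ∂(μ.prod μ) ≤
      K * ∫⁻ p, ‖h p‖ₑ ^ 2 ∂μ := by
    refine le_trans (le_of_eq ?_) hA
    rw [← lintegral_prod_swap]
    rfl
  have hG := lintegral_gaussian_oscInt_le hΩ hgm hi a
  calc _ ≤ 3 * (2 * ∫⁻ q, ‖(κ q.1 : ℂ) * h q.1‖ₑ * ‖(κ q.2 : ℂ) * h q.2‖ₑ *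
        ENNReal.ofReal (Real.exp (-(Ω q.1 - Ω q.2) ^ 2 / 4)) ∂(μ.prod μ)) :=
        h1.trans (mul_le_mul_right hG 3)
    _ ≤ 3 * (2 * (K * ∫⁻ p, ‖h p‖ₑ ^ 2 ∂μ + K * ∫⁻ p, ‖h p‖ₑ ^ 2 ∂μ)) := by
        gcongr
        have hC : ∫⁻ q, ‖(κ q.1 : ℂ) * h q.1‖ₑ * ‖(κ q.2 : ℂ) * h q.2‖ₑ *
            ENNReal.ofReal (Real.exp (-(Ω q.1 - Ω q.2) ^ 2 / 4)) ∂(μ.prod μ) ≤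
            ∫⁻ q : α × α, (‖h q.1‖ₑ ^ 2 *
              ENNReal.ofReal (κ q.2 ^ 2 * Real.exp (-(Ω q.1 - Ω q.2) ^ 2 / 4)) +
            ‖h q.2‖ₑ ^ 2 * ENNReal.ofReal (κ q.1 ^ 2 * Real.exp (-(Ω q.2 - Ω q.1) ^ 2 / 4)))
              ∂(μ.prod μ) := by
          refine lintegral_mono ?_
          intro q
          exact hterm q.1 q.2
        rw [lintegral_add_left hm1] at hC
        exact hC.trans (add_le_add hA hB)
    _ = _ := by ring

end oscillatory

/-- The two contracted frequencies of a point. -/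
def lastPair (w : Pts (k + 1)) : ℝ × ℝ := (w (Sum.inl (Fin.last k)), w (Sum.inr (Fin.last k)))

theorem measurable_lastPair : Measurable (lastPair (k := k)) := by
  unfold lastPair
  fun_prop

theorem lastPair_collapsePts (i : Idx k) (ζ : Pts k) (p : ℝ × ℝ) :
    lastPair (collapsePts i (ζ, p)) = p := by
  simp [lastPair]

theorem _root_.Measurable.kappa {α : Type*} [MeasurableSpace α] (ε : ℝ) {z : α → ℝ}
    {p : α → ℝ × ℝ} (hz : Measurable z) (hp : Measurable p) :
    Measurable fun x => kappa ε (z x) (p x) := by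
  have h := (measurable_kappa ε).comp (hz.prodMk hp)
  exact h

theorem _root_.Measurable.phase {α : Type*} [MeasurableSpace α] (i : Idx k) {z : α → ℝ}
    {p : α → ℝ × ℝ} (hz : Measurable z) (hp : Measurable p) :
    Measurable fun x => phase i (z x) (p x) := by
  have h := (continuous_phase i).measurable.comp (hz.prodMk hp)
  exact h

/-- For almost every output frequency the operator is an oscillatory integral in time. The
multiplier is counted with the function rather than with the weight; hence the bound is uniform and
sees only the product of multiplier and function. -/
theorem lintegral_sq_collisionOp_le {ε : ℝ} (hε : 0 ≤ ε) {K : ℝ≥0∞} (i : Idx k)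
    (hK : ∀ z ω : ℝ,
      ∫⁻ p, ENNReal.ofReal (kappa ε z p ^ 2 * Real.exp (-(ω - phase i z p) ^ 2 / 4)) ≤ K)
    (M : Multiplier) {a b : ℝ} (hab : b ≤ a + 1) (f : Kernel (k + 1)) :
    ∫⁻ r in Set.Ioc a b, ‖collisionOp hε M i r f‖ₑ ^ 2 ≤
      12 * K * ∫⁻ w, ‖M.toFun (lastPair w)‖ₑ ^ 2 * ‖f w‖ₑ ^ 2 := by
  have hf := measurable_coe f
  have hosc : ∀ r ζ, collapseFun (symbol ε M i r) i f ζ = oscInt volume (phase i (ζ i))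
      (fun p => kappa ε (ζ i) p * (sgn i * M.toFun p * f (collapsePts i (ζ, p)))) r := by
    intro r ζ
    refine integral_congr_ae (Eventually.of_forall fun p => ?_)
    simp only [symbol]
    ring
  have hjm : Measurable fun q : (ℝ × Pts k) × (ℝ × ℝ) =>
      symbol ε M i q.1.1 (q.1.2 i) q.2 * f (collapsePts i (q.1.2, q.2)) := by
    have h0 : Measurable fun q : (ℝ × Pts k) × (ℝ × ℝ) => (q.1.2, q.2) := by fun_prop
    have hz : Measurable fun q : (ℝ × Pts k) × (ℝ × ℝ) => q.1.2 i := by fun_prop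
    have hk := Measurable.kappa ε hz measurable_snd
    have hp := Measurable.phase i hz measurable_snd
    have hM : Measurable fun q : (ℝ × Pts k) × (ℝ × ℝ) => M.toFun q.2 :=
      M.measurable.comp measurable_snd
    have hc : Measurable fun q : (ℝ × Pts k) × (ℝ × ℝ) => f (collapsePts i (q.1.2, q.2)) :=
      hf.comp ((continuous_collapsePts i).measurable.comp h0)
    unfold symbol
    fun_prop
  have hcm : Measurable fun q : ℝ × Pts k => collapseFun (symbol ε M i q.1) i f q.2 :=
    (hjm.stronglyMeasurable.integral_prod_right' (ν := volume)).measurable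
  have h1 : ∀ r, ‖collisionOp hε M i r f‖ₑ ^ 2 =
      ∫⁻ ζ, ‖collapseFun (symbol ε M i r) i f ζ‖ₑ ^ 2 := by
    intro r
    rw [sq_enorm_kernel]
    refine lintegral_congr_ae ?_
    filter_upwards [collapseOp_ae_eq (isSymbol_symbol hε M i r) i f] with ζ hζ
    rw [collisionOp, hζ]
  simp only [h1]
  rw [lintegral_lintegral_swap (f := fun r ζ => ‖collapseFun (symbol ε M i r) i f ζ‖ₑ ^ 2)
    (hcm.enorm.pow_const 2).aemeasurable]
  have hMf : Measurable fun w : Pts (k + 1) => ‖M.toFun (lastPair w)‖ₑ ^ 2 * ‖f w‖ₑ ^ 2 :=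
    ((M.measurable.comp measurable_lastPair).enorm.pow_const 2).mul (hf.enorm.pow_const 2)
  rw [← lintegral_collapsePts i hMf, ← lintegral_const_mul _
    (Measurable.lintegral_prod_right' (f := fun q : Pts k × (ℝ × ℝ) =>
      ‖M.toFun (lastPair (collapsePts i q))‖ₑ ^ 2 * ‖f (collapsePts i q)‖ₑ ^ 2)
      (hMf.comp (continuous_collapsePts i).measurable))]
  refine lintegral_mono_ae ?_
  filter_upwards [ae_integrable_collapse (isSymbol_symbol hε M i 0) i hf
    (lintegral_sq_coe_lt_top f)] with ζ hζ
  have hs : ‖(sgn i : ℂ)‖ₑ = 1 := by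
    rcases i with i | i <;> simp [sgn]
  simp only [hosc]
  have hcp : Measurable fun p => f (collapsePts i (ζ, p)) :=
    hf.comp ((continuous_collapsePts i).measurable.comp measurable_prodMk_left)
  refine (lintegral_sq_oscInt_le (continuous_phase i).measurable.of_uncurry_left
    (measurable_kappa ε).of_uncurry_left
    (h := fun p => sgn i * M.toFun p * f (collapsePts i (ζ, p)))
    ((measurable_const.mul M.measurable).mul hcp) ?_ (hK _) hab).trans (le_of_eq ?_)
  · refine hζ.congr (Eventually.of_forall fun p => ?_)
    simp only [symbol, zero_mul, Complex.ofReal_zero, mul_zero, neg_zero, Complex.exp_zero]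
    ring
  · congr 1
    refine lintegral_congr fun p => ?_
    rw [lastPair_collapsePts, enorm_mul, enorm_mul, hs, one_mul, mul_pow]

/-- The collapse estimate: the collision operator in the interaction picture is bounded from `L²`
to `L¹` in time, uniformly in the multiplier. -/
theorem exists_collapse_estimate {ε : ℝ} (hε : 0 < ε) :
    ∃ C : ℝ≥0, ∀ (k : ℕ) (i : Idx k) (M : Multiplier) (a b : ℝ), b ≤ a + 1 →
      ∀ f : Kernel (k + 1), (∫⁻ r in Set.Ioc a b, ‖collisionOp hε.le M i r f‖ₑ) ^ 2 ≤
        C ^ 2 * ENNReal.ofReal (b - a) * ∫⁻ w, ‖M.toFun (lastPair w)‖ₑ ^ 2 * ‖f w‖ₑ ^ 2 := by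
  obtain ⟨K, hK⟩ := exists_lintegral_sq_kappa_le hε
  refine ⟨NNReal.sqrt (12 * K), fun k i M a b hab f => ?_⟩
  have hm : Measurable fun r => ‖collisionOp hε.le M i r f‖ₑ :=
    (((continuous_collisionOp hε.le M i).comp (Continuous.prodMk_left f)).enorm).measurable
  -- Cauchy–Schwarz in time gains the length of the interval, which is what makes short steps
  -- contractive.
  have h := ENNReal.sq_lintegral_mul_le (μ := volume.restrict (Set.Ioc a b))
    (f := fun _ => 1) (g := fun r => ‖collisionOp hε.le M i r f‖ₑ) aemeasurable_const
    hm.aemeasurable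
  simp only [one_mul, one_pow, lintegral_const, Measure.restrict_apply_univ,
    Real.volume_Ioc] at h
  refine h.trans ?_
  have h2 : ((NNReal.sqrt (12 * K) : ℝ≥0) : ℝ≥0∞) ^ 2 = 12 * K := by
    rw [← ENNReal.coe_pow, NNReal.sq_sqrt]
    push_cast
    rfl
  rw [h2, mul_comm (12 * (K : ℝ≥0∞)), mul_assoc]
  gcongr
  exact lintegral_sq_collisionOp_le hε.le i (hK i) M hab f

end

/-! ### Removal of the multiplier. -/

section

variable {k : ℕ}

namespace Multiplier

theorem norm_le (M : Multiplier) (p : ℝ × ℝ) : ‖M.toFun p‖ ≤ M.sup := by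
  have h := M.enorm_le p
  rw [enorm_eq_nnnorm] at h
  exact_mod_cast h

/-- Multiplication with a multiplier. -/
def mul (M : Multiplier) : Kernel (k + 1) →L[ℂ] Kernel (k + 1) :=
  multOp (fun w => M.toFun (lastPair w)) (M.measurable.comp measurable_lastPair)
    (fun w => M.norm_le (lastPair w))

theorem mul_ae_eq (M : Multiplier) (f : Kernel (k + 1)) :
    M.mul f =ᵐ[volume] fun w => M.toFun (lastPair w) * f w := multOp_ae_eq _ _ f

theorem norm_mul_le (M : Multiplier) (f : Kernel (k + 1)) : ‖M.mul f‖ ≤ M.sup * ‖f‖ := by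
  refine Lp.norm_le_mul_norm_of_ae_le_mul ?_
  filter_upwards [M.mul_ae_eq f] with w h
  rw [h, norm_mul]
  exact mul_le_mul_of_nonneg_right (M.norm_le _) (norm_nonneg _)

theorem eLpNorm_le (M : Multiplier) : eLpNorm M.toFun 2 volume ≤ M.l2 := by
  refine enorm_le_of_sq ?_
  rw [sq_eLpNorm_two]
  exact M.lintegral_le

/-- The difference of two multipliers. -/
def sub (M M' : Multiplier) : Multiplier where
  toFun p := M.toFun p - M'.toFun p
  measurable := M.measurable.sub M'.measurable
  sup := M.sup + M'.sup
  enorm_le p := by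
    push_cast
    exact (enorm_sub_le).trans (add_le_add (M.enorm_le p) (M'.enorm_le p))
  l2 := M.l2 + M'.l2
  lintegral_le := by
    have h := eLpNorm_sub_le M.measurable.aestronglyMeasurable M'.measurable.aestronglyMeasurable
      (p := 2) (μ := volume) (by norm_num)
    have h2 := h.trans (add_le_add M.eLpNorm_le M'.eLpNorm_le)
    calc _ = eLpNorm (M.toFun - M'.toFun) 2 volume ^ 2 := (sq_eLpNorm_two _).symm
      _ ≤ _ := by
        push_cast
        gcongr

theorem sub_mul (M M' : Multiplier) (f : Kernel (k + 1)) :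
    (M.sub M').mul f = M.mul f - M'.mul f := by
  refine Lp.ext ?_
  filter_upwards [(M.sub M').mul_ae_eq f, M.mul_ae_eq f, M'.mul_ae_eq f,
    Lp.coeFn_sub (M.mul f) (M'.mul f)] with w h1 h2 h3 h4
  rw [h1, h4, Pi.sub_apply, h2, h3, ← _root_.sub_mul]
  rfl

/-- The indicator function of a square as a multiplier. -/
def box (n : ℕ) : Multiplier where
  toFun := (Metric.closedBall (0 : ℝ × ℝ) n).indicator 1
  measurable := measurable_one.indicator Metric.isClosed_closedBall.measurableSet
  sup := 1
  enorm_le p := by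
    by_cases h : p ∈ Metric.closedBall (0 : ℝ × ℝ) n <;> simp [h]
  l2 := NNReal.sqrt (volume (Metric.closedBall (0 : ℝ × ℝ) n)).toNNReal
  lintegral_le := by
    have h1 : ∀ p, ‖(Metric.closedBall (0 : ℝ × ℝ) n).indicator (1 : ℝ × ℝ → ℂ) p‖ₑ ^ 2 =
        (Metric.closedBall (0 : ℝ × ℝ) n).indicator 1 p := by
      intro p
      by_cases h : p ∈ Metric.closedBall (0 : ℝ × ℝ) n <;> simp [h]
    simp only [h1]
    rw [lintegral_indicator_one Metric.isClosed_closedBall.measurableSet, ← ENNReal.coe_pow,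
      NNReal.sq_sqrt, ENNReal.coe_toNNReal measure_closedBall_lt_top.ne]

end Multiplier

/-- Uniformly bounded multipliers that converge to one. -/
structure IsApprox {ι : Type} (l : Filter ι) (M : ι → Multiplier) : Prop where
  sup_le : ∃ S : ℝ≥0, ∀ n, (M n).sup ≤ S
  tendsto : ∀ p, Tendsto (fun n => (M n).toFun p) l (𝓝 1)

theorem isApprox_box : IsApprox atTop Multiplier.box where
  sup_le := ⟨1, fun _ => le_rfl⟩
  tendsto p := by
    refine tendsto_const_nhds.congr' ?_
    obtain ⟨N, hN⟩ := exists_nat_ge ‖p‖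
    filter_upwards [eventually_ge_atTop N] with n hn
    have : p ∈ Metric.closedBall (0 : ℝ × ℝ) n := by
      rw [mem_closedBall_zero_iff]
      exact hN.trans (by exact_mod_cast hn)
    simp [Multiplier.box, this]

namespace IsApprox

variable {ι : Type} {l : Filter ι} [l.IsCountablyGenerated] {M : ι → Multiplier}

theorem tendsto_mul (hM : IsApprox l M) (f : Kernel (k + 1)) :
    Tendsto (fun n => (M n).mul f) l (𝓝 f) := by
  obtain ⟨S, hS⟩ := hM.sup_le
  have hb : ∀ n (w : Pts (k + 1)), ‖(M n).toFun (lastPair w)‖ ≤ ((max S 1 : ℝ≥0) : ℝ) :=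
    fun n w => ((M n).norm_le _).trans (by exact_mod_cast (hS n).trans (le_max_left _ _))
  have h := tendsto_multOp (l := l) (φ := fun n (w : Pts (k + 1)) => (M n).toFun (lastPair w))
    (ψ := fun _ => 1) (C := ((max S 1 : ℝ≥0) : ℝ))
    (fun n => (M n).measurable.comp measurable_lastPair) hb measurable_const
    (fun w => by simp) (fun w => hM.tendsto _) f
  have h1 : multOp (C := ((max S 1 : ℝ≥0) : ℝ)) (fun _ : Pts (k + 1) => (1 : ℂ)) measurable_const
      (fun w => by simp) f = f := by
    refine Lp.ext ?_
    filter_upwards [multOp_ae_eq (C := ((max S 1 : ℝ≥0) : ℝ)) (φ := fun _ : Pts (k + 1) => (1 : ℂ))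
      measurable_const (fun w => by simp) f] with w h
    rw [h, one_mul]
  rw [h1] at h
  refine h.congr fun n => Lp.ext ?_
  filter_upwards [multOp_ae_eq ((M n).measurable.comp measurable_lastPair) (hb n) f,
    (M n).mul_ae_eq f] with w h1 h2
  exact h1.trans h2.symm

theorem tendsto_lintegral (hM : IsApprox l M) {a b : ℝ} (e : Source Kernel a b (k + 1)) :
    Tendsto (fun n => ∫⁻ s in Set.Ioc a b, ‖(M n).mul (e s) - e s‖ₑ) l (𝓝 0) := by
  obtain ⟨S, hS⟩ := hM.sup_le
  have h0 : (0 : ℝ≥0∞) = ∫⁻ _ in Set.Ioc a b, 0 := by simp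
  rw [h0]
  have he := Lp.stronglyMeasurable e
  refine tendsto_lintegral_filter_of_dominated_convergence (fun s => (S + 1 : ℝ≥0) * ‖e s‖ₑ)
    ?_ ?_ ?_ ?_
  · refine Eventually.of_forall fun n => ?_
    exact (((M n).mul.continuous.comp_stronglyMeasurable he).sub he).enorm
  · refine Eventually.of_forall fun n => Eventually.of_forall fun s => ?_
    have h1 : ‖(M n).mul (e s) - e s‖ ≤ ((S + 1 : ℝ≥0) : ℝ) * ‖e s‖ := by
      have h2 := (M n).norm_mul_le (e s)
      have h3 : ((M n).sup : ℝ) ≤ S := by exact_mod_cast hS n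
      push_cast
      nlinarith [norm_sub_le ((M n).mul (e s)) (e s), norm_nonneg (e s)]
    rw [enorm_eq_nnnorm, enorm_eq_nnnorm]
    exact_mod_cast h1
  · rw [lintegral_const_mul _ he.enorm, ← enorm_eq_lintegral]
    finiteness
  · refine Eventually.of_forall fun s => ?_
    have := ((hM.tendsto_mul (e s)).sub_const (e s)).enorm
    simpa using this

end IsApprox

section limit

variable {ε : ℝ} (hε : 0 < ε) {a b : ℝ}

/-- The constant of the collapse estimate. -/
def collapseConst : ℝ≥0 := (exists_collapse_estimate hε).choose

/-- The constant of the collapse estimate on the time interval `(a, b]`. -/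
def timeConst (a b : ℝ) : ℝ≥0 := collapseConst hε * NNReal.sqrt (b - a).toNNReal

theorem lintegral_collisionOp_le (hab : b ≤ a + 1) (i : Idx k) (M : Multiplier)
    (f : Kernel (k + 1)) :
    ∫⁻ r in Set.Ioc a b, ‖collisionOp hε.le M i r f‖ₑ ≤ timeConst hε a b * ‖M.mul f‖ₑ := by
  refine enorm_le_of_sq (((exists_collapse_estimate hε).choose_spec k i M a b hab f).trans
    (le_of_eq ?_))
  rw [mul_pow, timeConst, ENNReal.coe_mul, mul_pow, ← ENNReal.coe_pow (NNReal.sqrt _),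
    NNReal.sq_sqrt, sq_enorm_kernel]
  congr 1
  refine lintegral_congr_ae ?_
  filter_upwards [M.mul_ae_eq f] with w h
  rw [h, enorm_mul, mul_pow]

theorem enorm_mul_le (M : Multiplier) (f : Kernel (k + 1)) : ‖M.mul f‖ₑ ≤ M.sup * ‖f‖ₑ := by
  rw [enorm_eq_nnnorm, enorm_eq_nnnorm]
  exact_mod_cast M.norm_mul_le f

theorem bound_collisionFamily (hab : b ≤ a + 1) (M : Multiplier) :
    (collisionFamily hε.le M).Bound a b (timeConst hε a b * M.sup) := by
  intro k i x
  refine (lintegral_collisionOp_le hε hab i M x).trans ?_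
  rw [ENNReal.coe_mul, mul_assoc]
  gcongr
  exact enorm_mul_le M x

/-- The operator that maps an initial datum and a source to the collision term of the corresponding
solution. -/
def dataOp (hab : b ≤ a + 1) (M : Multiplier) (i : Idx k) :
    Kernel (k + 1) × Source Kernel a b (k + 1) →L[ℂ] Source Kernel a b k :=
  (freeOp a b (collisionOp hε.le M i) (continuous_collisionOp hε.le M i) _
    (bound_collisionFamily hε hab M k i)).coprod
  ((collisionFamily hε.le M).collapse (bound_collisionFamily hε hab M) k i)

theorem dataOp_ae_eq (hab : b ≤ a + 1) (M : Multiplier) (i : Idx k)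
    (x : Kernel (k + 1) × Source Kernel a b (k + 1)) :
    dataOp hε hab M i x =ᵐ[timeMeasure a b]
      fun r => collisionOp hε.le M i r (x.1 + primitive x.2 r) := by
  have h1 := freeOp_ae_eq (continuous_collisionOp hε.le M i)
    (bound_collisionFamily hε hab M k i) x.1
  have h2 := primitiveOp_ae_eq (continuous_collisionOp hε.le M i)
    (bound_collisionFamily hε hab M k i) x.2
  have h3 := Lp.coeFn_add (freeOp a b (collisionOp hε.le M i) (continuous_collisionOp hε.le M i) _
    (bound_collisionFamily hε hab M k i) x.1)
    ((collisionFamily hε.le M).collapse (bound_collisionFamily hε hab M) k i x.2)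
  filter_upwards [h1, h2, h3] with r h1 h2 h3
  rw [dataOp, ContinuousLinearMap.coprod_apply, h3, Pi.add_apply, h1, map_add]
  congr 1

/-- Each release time of the source contributes a fixed vector. The data enter only after
multiplication by `M`, so the bound is small when the multiplier nearly annihilates them. -/
theorem enorm_dataOp_le (hab : b ≤ a + 1) (M : Multiplier) (i : Idx k)
    (x : Kernel (k + 1) × Source Kernel a b (k + 1)) :
    ‖dataOp hε hab M i x‖ₑ ≤
      timeConst hε a b * (‖M.mul x.1‖ₑ + ∫⁻ s in Set.Ioc a b, ‖M.mul (x.2 s)‖ₑ) := by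
  have hc := continuous_collisionOp hε.le M i
  have hm1 : Measurable fun r => ‖collisionOp hε.le M i r x.1‖ₑ :=
    ((hc.comp (Continuous.prodMk_left x.1)).enorm).measurable
  rw [enorm_eq_lintegral]
  calc _ = ∫⁻ r in Set.Ioc a b, ‖collisionOp hε.le M i r (x.1 + primitive x.2 r)‖ₑ :=
        lintegral_congr_ae (by
          filter_upwards [dataOp_ae_eq hε hab M i x] with r hr
          rw [hr])
    _ ≤ ∫⁻ r in Set.Ioc a b, (‖collisionOp hε.le M i r x.1‖ₑ +
          ‖collisionOp hε.le M i r (primitive x.2 r)‖ₑ) := by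
        refine lintegral_mono fun r => ?_
        rw [map_add]
        exact enorm_add_le _ _
    _ = (∫⁻ r in Set.Ioc a b, ‖collisionOp hε.le M i r x.1‖ₑ) +
          ∫⁻ r in Set.Ioc a b, ‖collisionOp hε.le M i r (primitive x.2 r)‖ₑ :=
        lintegral_add_left hm1 _
    _ ≤ timeConst hε a b * ‖M.mul x.1‖ₑ +
          ∫⁻ s in Set.Ioc a b, timeConst hε a b * ‖M.mul (x.2 s)‖ₑ := by
        refine add_le_add (lintegral_collisionOp_le hε hab i M x.1) ?_
        exact (lintegral_op_primitive_le hc x.2).trans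
          (lintegral_mono fun s => lintegral_collisionOp_le hε hab i M (x.2 s))
    _ = _ := by
        rw [lintegral_const_mul' _ _ ENNReal.coe_ne_top, mul_add]

theorem collisionOp_sub (M M' : Multiplier) (i : Idx k) (s : ℝ) (f : Kernel (k + 1)) :
    collisionOp hε.le (M.sub M') i s f = collisionOp hε.le M i s f - collisionOp hε.le M' i s f := by
  refine Lp.ext ?_
  filter_upwards [collapseOp_ae_eq (isSymbol_symbol hε.le (M.sub M') i s) i f,
    collapseOp_ae_eq (isSymbol_symbol hε.le M i s) i f,
    collapseOp_ae_eq (isSymbol_symbol hε.le M' i s) i f,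
    Lp.coeFn_sub (collisionOp hε.le M i s f) (collisionOp hε.le M' i s f),
    ae_integrable_collapse (isSymbol_symbol hε.le M i s) i (measurable_coe f)
      (lintegral_sq_coe_lt_top f),
    ae_integrable_collapse (isSymbol_symbol hε.le M' i s) i (measurable_coe f)
      (lintegral_sq_coe_lt_top f)] with ζ h1 h2 h3 h4 h5 h6
  rw [h4, Pi.sub_apply, collisionOp, collisionOp, collisionOp, h1, h2, h3, collapseFun, collapseFun,
    collapseFun, ← integral_sub h5 h6]
  refine integral_congr_ae (Eventually.of_forall fun p => ?_)
  simp only [symbol, Multiplier.sub]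
  ring

theorem dataOp_sub (hab : b ≤ a + 1) (M M' : Multiplier) (i : Idx k)
    (x : Kernel (k + 1) × Source Kernel a b (k + 1)) :
    dataOp hε hab M i x - dataOp hε hab M' i x = dataOp hε hab (M.sub M') i x := by
  refine Lp.ext ?_
  filter_upwards [dataOp_ae_eq hε hab M i x, dataOp_ae_eq hε hab M' i x,
    dataOp_ae_eq hε hab (M.sub M') i x,
    Lp.coeFn_sub (dataOp hε hab M i x) (dataOp hε hab M' i x)] with r h1 h2 h3 h4
  rw [h4, Pi.sub_apply, h1, h2, h3, collisionOp_sub hε]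

/-- The distance of a datum and a source from their truncations. -/
def defect (M : Multiplier) (x : Kernel (k + 1) × Source Kernel a b (k + 1)) : ℝ≥0∞ :=
  ‖M.mul x.1 - x.1‖ₑ + ∫⁻ s in Set.Ioc a b, ‖M.mul (x.2 s) - x.2 s‖ₑ

theorem IsApprox.tendsto_defect {ι : Type} {l : Filter ι} [l.IsCountablyGenerated]
    {M : ι → Multiplier} (hM : IsApprox l M) (x : Kernel (k + 1) × Source Kernel a b (k + 1)) :
    Tendsto (fun n => defect (M n) x) l (𝓝 0) := by
  have h1 := ((hM.tendsto_mul x.1).sub_const x.1).enorm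
  have h2 := h1.add (hM.tendsto_lintegral x.2)
  rw [sub_self, enorm_zero, add_zero] at h2
  exact h2

/-- The operators are linear in the multiplier, and the product with `M - M'` is compared through
the data themselves. This makes any approximating sequence Cauchy and its limit independent of the
approximation. -/
theorem edist_dataOp_le (hab : b ≤ a + 1) (M M' : Multiplier) (i : Idx k)
    (x : Kernel (k + 1) × Source Kernel a b (k + 1)) :
    edist (dataOp hε hab M i x) (dataOp hε hab M' i x) ≤
      timeConst hε a b * (defect M x + defect M' x) := by
  rw [edist_eq_enorm_sub, dataOp_sub]
  refine (enorm_dataOp_le hε hab _ i x).trans (mul_le_mul_right ?_ _)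
  have h1 : ∀ f : Kernel (k + 1), ‖(M.sub M').mul f‖ₑ ≤ ‖M.mul f - f‖ₑ + ‖M'.mul f - f‖ₑ := by
    intro f
    rw [Multiplier.sub_mul, ← edist_eq_enorm_sub, ← edist_eq_enorm_sub, ← edist_eq_enorm_sub,
      edist_comm (M'.mul f)]
    exact edist_triangle _ _ _
  have he := Lp.stronglyMeasurable x.2
  have hm : Measurable fun s => ‖M.mul (x.2 s) - x.2 s‖ₑ :=
    ((M.mul.continuous.comp_stronglyMeasurable he).sub he).enorm
  calc _ ≤ (‖M.mul x.1 - x.1‖ₑ + ‖M'.mul x.1 - x.1‖ₑ) + ∫⁻ s in Set.Ioc a b,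
        (‖M.mul (x.2 s) - x.2 s‖ₑ + ‖M'.mul (x.2 s) - x.2 s‖ₑ) :=
        add_le_add (h1 _) (lintegral_mono fun s => h1 _)
    _ = _ := by
        rw [lintegral_add_left hm, add_add_add_comm]
        rfl

theorem exists_tendsto_dataOp_box (hab : b ≤ a + 1) (i : Idx k)
    (x : Kernel (k + 1) × Source Kernel a b (k + 1)) :
    ∃ y, Tendsto (fun n => dataOp hε hab (Multiplier.box n) i x) atTop (𝓝 y) := by
  refine cauchySeq_tendsto_of_complete ?_
  have h := (isApprox_box.tendsto_defect x)
  rw [EMetric.cauchySeq_iff]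
  intro δ hδ
  have h2 : Tendsto (fun n => timeConst hε a b * (defect (Multiplier.box n) x)) atTop (𝓝 0) := by
    simpa using ENNReal.Tendsto.const_mul h (Or.inr ENNReal.coe_ne_top)
  obtain ⟨N, hN⟩ := eventually_atTop.1 (h2.eventually_lt_const (ENNReal.half_pos hδ.ne'))
  refine ⟨N, fun m hm n hn => ?_⟩
  refine (edist_dataOp_le hε hab _ _ i x).trans_lt ?_
  rw [mul_add, ← ENNReal.add_halves δ]
  exact ENNReal.add_lt_add (hN m hm) (hN n hn)

/-- The collision term of the solution with a given datum and source, without truncation. -/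
def dataLim (hab : b ≤ a + 1) (i : Idx k) :
    Kernel (k + 1) × Source Kernel a b (k + 1) →L[ℂ] Source Kernel a b k :=
  continuousLinearMapOfTendsto (fun n => dataOp hε hab (Multiplier.box n) i)
    (tendsto_pi_nhds.2 fun x => (exists_tendsto_dataOp_box hε hab i x).choose_spec)

theorem tendsto_dataOp_box (hab : b ≤ a + 1) (i : Idx k)
    (x : Kernel (k + 1) × Source Kernel a b (k + 1)) :
    Tendsto (fun n => dataOp hε hab (Multiplier.box n) i x) atTop (𝓝 (dataLim hε hab i x)) :=
  (exists_tendsto_dataOp_box hε hab i x).choose_spec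

/-- The limit was built with sharp cut-offs. That mollifiers lead to the same limit is what
identifies it with the collision term in the sense of distributions. -/
theorem tendsto_dataOp {ι : Type} {l : Filter ι} [l.IsCountablyGenerated]
    {M : ι → Multiplier} (hM : IsApprox l M) (hab : b ≤ a + 1) (i : Idx k)
    (x : Kernel (k + 1) × Source Kernel a b (k + 1)) :
    Tendsto (fun n => dataOp hε hab (M n) i x) l (𝓝 (dataLim hε hab i x)) := by
  rw [tendsto_iff_edist_tendsto_0]
  have h1 : ∀ n, edist (dataOp hε hab (M n) i x) (dataLim hε hab i x) ≤
      timeConst hε a b * defect (M n) x := by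
    intro n
    have h2 := (tendsto_dataOp_box hε hab i x).edist
      (tendsto_const_nhds (x := dataOp hε hab (M n) i x))
    rw [edist_comm]
    have h3 : Tendsto (fun m => timeConst hε a b * (defect (Multiplier.box m) x + defect (M n) x))
        atTop (𝓝 (timeConst hε a b * (0 + defect (M n) x))) :=
      ENNReal.Tendsto.const_mul ((isApprox_box.tendsto_defect x).add_const _)
        (Or.inr ENNReal.coe_ne_top)
    rw [zero_add] at h3
    exact le_of_tendsto_of_tendsto' h2 h3 fun m => edist_dataOp_le hε hab _ _ i x
  have h4 : Tendsto (fun n => timeConst hε a b * defect (M n) x) l (𝓝 0) := by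
    simpa using ENNReal.Tendsto.const_mul (hM.tendsto_defect x) (Or.inr ENNReal.coe_ne_top)
  exact tendsto_of_tendsto_of_tendsto_of_le_of_le tendsto_const_nhds h4 (fun _ => zero_le) h1

theorem norm_dataLim_free_le (hab : b ≤ a + 1) (i : Idx k) (f : Kernel (k + 1)) :
    ‖dataLim hε hab i (f, 0)‖ ≤ timeConst hε a b * ‖f‖ := by
  refine le_of_tendsto (tendsto_dataOp_box hε hab i (f, 0)).norm (Eventually.of_forall fun n => ?_)
  rw [dataOp, ContinuousLinearMap.coprod_apply, map_zero, add_zero]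
  refine (ContinuousLinearMap.le_opNorm _ _).trans ?_
  refine mul_le_mul_of_nonneg_right ((norm_freeOp_le _ _).trans ?_) (norm_nonneg _)
  simp [Multiplier.box]

/-- The collision operator on sources. -/
def collapseLim (hab : b ≤ a + 1) (k : ℕ) (i : Idx k) :
    Source Kernel a b (k + 1) →L[ℂ] Source Kernel a b k :=
  (dataLim hε hab i).comp (ContinuousLinearMap.inr ℂ _ _)

/-- All sharp cut-offs have supremum `1`, so the bounds on the iterates are uniform and survive the
limit. -/
theorem norm_iterSum_collapseLim_le (hab : b ≤ a + 1) {h : ∀ k, Source Kernel a b k}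
    (hs : ∀ k σ τ, ∀ᵐ s ∂(timeMeasure a b), permOp σ τ (h k s) = h k s) (m k : ℕ) :
    ‖iterSum (collapseLim hε hab) h m k‖ ≤ 8 ^ k * (8 * timeConst hε a b) ^ m * ‖h (k + m)‖ := by
  refine norm_iterSum_le (l := atTop) (fun n => collisionFamily hε.le (Multiplier.box n))
    (c := timeConst hε a b) (fun n => ?_) (fun k i e => ?_) (fun n => hs) m k
  · have := bound_collisionFamily hε hab (Multiplier.box n)
    rwa [show (Multiplier.box n).sup = 1 from rfl, mul_one] at this
  · refine (tendsto_dataOp_box hε hab i (0, e)).congr fun n => ?_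
    rw [dataOp, ContinuousLinearMap.coprod_apply, map_zero, zero_add]
    refine Lp.ext ?_
    filter_upwards [primitiveOp_ae_eq (continuous_collisionOp hε.le (Multiplier.box n) i)
      (bound_collisionFamily hε hab (Multiplier.box n) k i) e,
      primitiveOp_ae_eq (continuous_collisionOp hε.le (Multiplier.box n) i) (c := timeConst hε a b)
        (by
          have := bound_collisionFamily hε hab (Multiplier.box n)
          rw [show (Multiplier.box n).sup = 1 from rfl, mul_one] at this
          exact this k i) e] with r h1 h2
    exact h1.trans h2.symm

end limit

end

/-! ### Symmetries and Sobolev weights on the Fourier side. -/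

section

variable {k : ℕ}

/-- Composition with a linear isometry. -/
def isoOp (A : Pts k ≃ₗᵢ[ℝ] Pts k) : Kernel k →L[ℂ] Kernel k :=
  (Lp.compMeasurePreservingₗᵢ ℂ A A.measurePreserving).toContinuousLinearMap

theorem isoOp_ae_eq (A : Pts k ≃ₗᵢ[ℝ] Pts k) (f : Kernel k) :
    isoOp A f =ᵐ[volume] fun ζ => f (A ζ) :=
  Lp.coeFn_compMeasurePreserving f A.measurePreserving

/-- Complex conjugation of kernels. -/
def conjOp : Kernel k →L[ℝ] Kernel k := Complex.conjCLE.toContinuousLinearMap.compLpL 2 volume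

theorem conjOp_ae_eq (f : Kernel k) : conjOp f =ᵐ[volume] fun ζ => (starRingEnd ℂ) (f ζ) :=
  ContinuousLinearMap.coeFn_compLpL _ f

theorem continuous_fourier : Continuous fun f : Kernel k => (𝓕 f : Kernel k) :=
  (Lp.fourierTransformₗᵢ (Pts k) ℂ).continuous

theorem continuous_fourierInv : Continuous fun f : Kernel k => (𝓕⁻ f : Kernel k) :=
  (Lp.fourierTransformₗᵢ (Pts k) ℂ).symm.continuous

theorem kernel_induction {p : Kernel k → Prop} (f : Kernel k) (hc : IsClosed {f | p f})
    (h : ∀ φ : 𝓢(Pts k, ℂ), p (φ.toLp 2)) : p f :=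
  DenseRange.induction_on (p := p)
    (SchwartzMap.denseRange_toLpCLM (p := 2) ENNReal.ofNat_ne_top) f hc h

/-- Both sides are continuous on square integrable functions, so Schwartz functions suffice, where
the integral formula for the Fourier transform is available. -/
theorem fourier_isoOp (A : Pts k ≃ₗᵢ[ℝ] Pts k) (f : Kernel k) :
    (𝓕 (isoOp A f) : Kernel k) = isoOp A (𝓕 f) := by
  refine kernel_induction (p := fun f : Kernel k => (𝓕 (isoOp A f) : Kernel k) = isoOp A (𝓕 f)) f
    (isClosed_eq (continuous_fourier.comp (isoOp A).continuous)
      ((isoOp A).continuous.comp continuous_fourier)) fun φ => ?_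
  have h1 : isoOp A (φ.toLp 2) =
      (SchwartzMap.compCLMOfContinuousLinearEquiv ℂ A.toContinuousLinearEquiv φ).toLp 2 := by
    refine Lp.ext ?_
    filter_upwards [isoOp_ae_eq A (φ.toLp 2),
      A.measurePreserving.quasiMeasurePreserving.ae (φ.coeFn_toLp 2 volume),
      (SchwartzMap.compCLMOfContinuousLinearEquiv ℂ A.toContinuousLinearEquiv φ).coeFn_toLp 2
        volume] with ζ h1 h2 h3
    rw [h1, h2, h3]
    rfl
  rw [h1, SchwartzMap.toLp_fourier_eq, SchwartzMap.toLp_fourier_eq]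
  refine Lp.ext ?_
  filter_upwards [isoOp_ae_eq A ((𝓕 φ).toLp 2),
    A.measurePreserving.quasiMeasurePreserving.ae ((𝓕 φ).coeFn_toLp 2 volume),
    (𝓕 (SchwartzMap.compCLMOfContinuousLinearEquiv ℂ A.toContinuousLinearEquiv φ)).coeFn_toLp 2
      volume] with ζ h1 h2 h3
  rw [h1, h2, h3, SchwartzMap.fourier_coe, SchwartzMap.fourier_coe]
  exact Real.fourier_comp_linearIsometry A φ ζ

theorem fourier_conj_apply (f : Pts k → ℂ) (ζ : Pts k) :
    𝓕 (fun z => (starRingEnd ℂ) (f z)) ζ = (starRingEnd ℂ) (𝓕 f (-ζ)) := by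
  rw [Real.fourier_eq', Real.fourier_eq', ← integral_conj]
  refine integral_congr_ae (Eventually.of_forall fun z => ?_)
  simp only [smul_eq_mul, map_mul, ← Complex.exp_conj, Complex.conj_I, Complex.conj_ofReal,
    inner_neg_right]
  congr 2
  push_cast
  ring

theorem fourier_conjOp (f : Kernel k) :
    (𝓕 (conjOp f) : Kernel k) = conjOp (isoOp (LinearIsometryEquiv.neg ℝ) (𝓕 f)) := by
  refine kernel_induction (p := fun f : Kernel k => (𝓕 (conjOp f) : Kernel k) =
    conjOp (isoOp (LinearIsometryEquiv.neg ℝ) (𝓕 f))) f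
    (isClosed_eq (continuous_fourier.comp conjOp.continuous)
      (conjOp.continuous.comp ((isoOp _).continuous.comp continuous_fourier))) fun φ => ?_
  have h1 : conjOp (φ.toLp 2) =
      (SchwartzMap.postcompCLM Complex.conjCLE.toContinuousLinearMap φ).toLp 2 := by
    refine Lp.ext ?_
    filter_upwards [conjOp_ae_eq (φ.toLp 2), φ.coeFn_toLp 2 volume,
      (SchwartzMap.postcompCLM Complex.conjCLE.toContinuousLinearMap φ).coeFn_toLp 2
        volume] with ζ h1 h2 h3
    rw [h1, h2, h3]
    rfl
  rw [h1, SchwartzMap.toLp_fourier_eq, SchwartzMap.toLp_fourier_eq]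
  refine Lp.ext ?_
  have hneg : MeasurePreserving (LinearIsometryEquiv.neg ℝ : Pts k ≃ₗᵢ[ℝ] Pts k) volume volume :=
    LinearIsometryEquiv.measurePreserving _
  filter_upwards [conjOp_ae_eq (isoOp (LinearIsometryEquiv.neg ℝ) ((𝓕 φ).toLp 2)),
    isoOp_ae_eq (LinearIsometryEquiv.neg ℝ) ((𝓕 φ).toLp 2),
    hneg.quasiMeasurePreserving.ae ((𝓕 φ).coeFn_toLp 2 volume),
    (𝓕 (SchwartzMap.postcompCLM Complex.conjCLE.toContinuousLinearMap φ)).coeFn_toLp 2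
      volume] with ζ h1 h2 h3 h4
  rw [h1, h2, h3, h4, SchwartzMap.fourier_coe, SchwartzMap.fourier_coe]
  exact fourier_conj_apply φ ζ

/-- The exchange of primed and unprimed variables. -/
def swapIso : Pts k ≃ₗᵢ[ℝ] Pts k :=
  LinearIsometryEquiv.piLpCongrLeft 2 ℝ ℝ (Equiv.sumComm (Fin k) (Fin k))

theorem swapIso_apply (z : Pts k) : swapIso z = swapPts z := rfl

/-- The operator that corresponds to passing to the adjoint of a density kernel. -/
def adjOp : Kernel k →L[ℝ] Kernel k :=
  conjOp.comp ((isoOp (swapIso.trans (LinearIsometryEquiv.neg ℝ))).restrictScalars ℝ)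

theorem adjOp_ae_eq (f : Kernel k) :
    adjOp f =ᵐ[volume] fun ζ => (starRingEnd ℂ) (f (-swapPts ζ)) := by
  filter_upwards [conjOp_ae_eq (isoOp (swapIso.trans (LinearIsometryEquiv.neg ℝ)) f),
    isoOp_ae_eq (swapIso.trans (LinearIsometryEquiv.neg ℝ)) f] with ζ h1 h2
  exact h1.trans (congrArg _ h2)

theorem measurePreserving_neg_swap :
    MeasurePreserving (fun ζ : Pts k => -swapPts ζ) volume volume :=
  (swapIso.trans (LinearIsometryEquiv.neg ℝ)).measurePreserving

theorem swapPts_swapPts (ζ : Pts k) : swapPts (swapPts ζ) = ζ := by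
  ext i
  rcases i with i | i <;> rfl

theorem isBosonic_iff (γ : Kernel k) : IsBosonic γ ↔ ∀ σ τ, permOp σ τ γ = γ := by
  refine forall_congr' fun σ => forall_congr' fun τ => ?_
  constructor
  · intro h
    refine Lp.ext ?_
    filter_upwards [h, permOp_ae_eq σ τ γ] with z h1 h2
    rw [h2, h1]
  · intro h
    filter_upwards [permOp_ae_eq σ τ γ] with z h1
    rw [← h1, h]

theorem fourier_permOp (σ τ : Equiv.Perm (Fin k)) (f : Kernel k) :
    (𝓕 (permOp σ τ f) : Kernel k) = permOp σ τ (𝓕 f) := fourier_isoOp (permIso σ τ) f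

/-- The Fourier transform turns complex conjugation into conjugation with a reflection, hence the
sign in `adjOp`. A fixed-point equation of a continuous real-linear map passes through integrals and
limits. -/
theorem isHermitianKernel_iff (γ : Kernel k) :
    IsHermitianKernel γ ↔ adjOp (𝓕 γ : Kernel k) = 𝓕 γ := by
  have h1 : IsHermitianKernel γ ↔ isoOp swapIso γ = conjOp γ := by
    constructor
    · intro h
      refine Lp.ext ?_
      filter_upwards [h, isoOp_ae_eq swapIso γ, conjOp_ae_eq γ] with z h1 h2 h3
      rw [h2, h3, swapIso_apply, h1]
    · intro h
      filter_upwards [isoOp_ae_eq swapIso γ, conjOp_ae_eq γ] with z h2 h3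
      rw [← h3, ← h, h2, swapIso_apply]
  have h2 : isoOp swapIso γ = conjOp γ ↔
      (𝓕 (isoOp swapIso γ) : Kernel k) = 𝓕 (conjOp γ) :=
    ((Lp.fourierTransformₗᵢ (Pts k) ℂ).injective.eq_iff).symm
  rw [h1, h2, fourier_isoOp, fourier_conjOp]
  obtain ⟨g, hg⟩ : ∃ g : Kernel k, g = 𝓕 γ := ⟨_, rfl⟩
  rw [← hg]
  have hsw : MeasurePreserving (fun ζ : Pts k => swapPts ζ) volume volume :=
    swapIso.measurePreserving
  constructor
  · intro h
    refine Lp.ext ?_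
    have h3 : ∀ᵐ ζ, g (swapPts ζ) = (starRingEnd ℂ) (g (-ζ)) := by
      filter_upwards [isoOp_ae_eq swapIso g, conjOp_ae_eq (isoOp (LinearIsometryEquiv.neg ℝ) g),
        isoOp_ae_eq (LinearIsometryEquiv.neg ℝ) g] with ζ h4 h5 h6
      rw [← swapIso_apply, ← h4, h, h5, h6]
      rfl
    filter_upwards [adjOp_ae_eq g, hsw.quasiMeasurePreserving.ae h3] with ζ h4 h5
    rw [h4, ← h5, swapPts_swapPts]
  · intro h
    refine Lp.ext ?_
    have h3 : ∀ᵐ ζ, g ζ = (starRingEnd ℂ) (g (-swapPts ζ)) := by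
      filter_upwards [adjOp_ae_eq g] with ζ h4
      rw [← h4, h]
    filter_upwards [isoOp_ae_eq swapIso g, conjOp_ae_eq (isoOp (LinearIsometryEquiv.neg ℝ) g),
        isoOp_ae_eq (LinearIsometryEquiv.neg ℝ) g, hsw.quasiMeasurePreserving.ae h3]
        with ζ h4 h5 h6 h7
    rw [h4, h5, h6, swapIso_apply, h7, swapPts_swapPts]
    rfl

/-- The inverse of the symbol of the Sobolev weight. -/
def invSymbol (ε : ℝ) (ζ : Pts k) : ℂ := ((sobolevSymbol ε ζ)⁻¹ : ℝ)

theorem one_le_sobolevSymbol {ε : ℝ} (hε : 0 ≤ ε) (ζ : Pts k) : 1 ≤ sobolevSymbol ε ζ := by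
  rw [sobolevSymbol_eq]
  calc (1 : ℝ) = ∏ i : Idx k, 1 := Finset.prod_const_one.symm
    _ ≤ _ := Finset.prod_le_prod (fun _ _ => zero_le_one) fun i _ => one_le_weight hε _

theorem measurable_sobolevSymbol (ε : ℝ) : Measurable (sobolevSymbol ε : Pts k → ℝ) := by
  have : (sobolevSymbol ε : Pts k → ℝ) = fun ζ => ∏ i, weight ε (ζ i) :=
    funext fun ζ => sobolevSymbol_eq ε ζ
  rw [this]
  exact Finset.measurable_prod _ fun i _ => (continuous_weight ε).measurable.comp (by fun_prop)

theorem measurable_invSymbol (ε : ℝ) : Measurable (invSymbol ε : Pts k → ℂ) :=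
  Complex.measurable_ofReal.comp (measurable_sobolevSymbol ε).inv

theorem norm_invSymbol_le {ε : ℝ} (hε : 0 ≤ ε) (ζ : Pts k) : ‖invSymbol ε ζ‖ ≤ 1 := by
  have h := one_le_sobolevSymbol hε ζ
  rw [invSymbol, Complex.norm_real, Real.norm_of_nonneg (inv_nonneg.2 (by linarith))]
  exact inv_le_one_of_one_le₀ h

theorem sobolevSymbol_mul_invSymbol {ε : ℝ} (hε : 0 ≤ ε) (ζ : Pts k) :
    (sobolevSymbol ε ζ : ℂ) * invSymbol ε ζ = 1 := by
  have h := one_le_sobolevSymbol hε ζ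
  rw [invSymbol, ← Complex.ofReal_mul, mul_inv_cancel₀ (by linarith), Complex.ofReal_one]

section synthesis

variable {ε : ℝ} (hε : 0 ≤ ε)

/-- Division by the Sobolev weight. -/
def unweight : Kernel k →L[ℂ] Kernel k :=
  multOp (invSymbol ε) (measurable_invSymbol ε) (norm_invSymbol_le hε)

theorem unweight_ae_eq (g : Kernel k) : unweight hε g =ᵐ[volume] fun ζ => invSymbol ε ζ * g ζ :=
  multOp_ae_eq _ _ g

/-- The kernel with given weighted Fourier transform. -/
def synth : Kernel k →L[ℂ] Kernel k :=
  ((Lp.fourierTransformₗᵢ (Pts k) ℂ).symm.toContinuousLinearEquiv.toContinuousLinearMap).comp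
    (unweight hε)

theorem synth_apply (g : Kernel k) : synth hε g = 𝓕⁻ (unweight hε g) := rfl

theorem fourier_synth (g : Kernel k) : (𝓕 (synth hε g) : Kernel k) = unweight hε g := by
  rw [synth_apply, FourierTransform.fourier_fourierInv_eq]

/-- With `exists_synth_eq` this makes `synth` an isometry of the plain space onto the kernels of
finite Sobolev norm, so that the weights occur only inside `kappa`. -/
theorem sobolevNorm_synth (g : Kernel k) : sobolevNorm ε (synth hε g) = ‖g‖ₑ := by
  rw [sobolevNorm, fourier_synth, Lp.enorm_def]
  refine eLpNorm_congr_ae ?_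
  filter_upwards [unweight_ae_eq hε g] with ζ h
  rw [h, ← mul_assoc, sobolevSymbol_mul_invSymbol hε, one_mul]

theorem exists_synth_eq {γ : Kernel k} (h : sobolevNorm ε γ < ∞) : ∃ g, synth hε g = γ := by
  have hm : MemLp (fun ζ : Pts k => (sobolevSymbol ε ζ : ℂ) * (𝓕 γ : Kernel k) ζ) 2 volume :=
    ⟨((Complex.measurable_ofReal.comp (measurable_sobolevSymbol ε)).mul
      (measurable_coe _)).aestronglyMeasurable, h⟩
  refine ⟨hm.toLp _, ?_⟩
  have : unweight hε (hm.toLp _) = 𝓕 γ := by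
    refine Lp.ext ?_
    filter_upwards [unweight_ae_eq hε (hm.toLp _), hm.coeFn_toLp] with ζ h1 h2
    rw [h1, h2, ← mul_assoc, mul_comm (invSymbol ε ζ), sobolevSymbol_mul_invSymbol hε, one_mul]
  rw [synth_apply, this, FourierTransform.fourierInv_fourier_eq]

theorem synth_injective : Function.Injective (synth hε : Kernel k → Kernel k) := by
  intro f g h
  have h1 : sobolevNorm ε (synth hε (f - g)) = 0 := by
    rw [map_sub, h, sub_self, ← map_zero (synth hε), sobolevNorm_synth, enorm_zero]
  rw [sobolevNorm_synth, enorm_eq_zero, sub_eq_zero] at h1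
  exact h1

theorem freeEvolution_synth (t : ℝ) (g : Kernel k) :
    freeEvolution t (synth hε g) = synth hε (flow t g) := by
  have h : ((memLp_freeSymbol_mul t (𝓕 (synth hε g) : Kernel k)).toLp : Kernel k) =
      unweight hε (flow t g) := by
    refine Lp.ext ?_
    filter_upwards [(memLp_freeSymbol_mul t (𝓕 (synth hε g) : Kernel k)).coeFn_toLp,
      unweight_ae_eq hε (flow t g), flow_ae_eq t g, unweight_ae_eq hε g] with ζ h1 h2 h3 h4
    rw [h1, h2, h3, fourier_synth, h4]
    ring
  rw [freeEvolution, h, synth_apply]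

theorem sobolevSymbol_permPts (σ τ : Equiv.Perm (Fin k)) (ζ : Pts k) :
    sobolevSymbol ε (permPts σ τ ζ) = sobolevSymbol ε ζ := by
  rw [sobolevSymbol_eq, sobolevSymbol_eq]
  exact Fintype.prod_equiv (Equiv.sumCongr σ τ) _ _ fun i => rfl

theorem sobolevSymbol_neg_swap (ζ : Pts k) :
    sobolevSymbol ε (-swapPts ζ) = sobolevSymbol ε ζ := by
  rw [sobolevSymbol_eq, sobolevSymbol_eq]
  refine Fintype.prod_equiv (Equiv.sumComm (Fin k) (Fin k)) _ _ fun i => ?_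
  rw [PiLp.neg_apply, weight_neg]
  rfl

theorem permOp_unweight (σ τ : Equiv.Perm (Fin k)) (g : Kernel k) :
    permOp σ τ (unweight hε g) = unweight hε (permOp σ τ g) := by
  refine Lp.ext ?_
  filter_upwards [permOp_ae_eq σ τ (unweight hε g),
    (measurePreserving_permPts σ τ).quasiMeasurePreserving.ae (unweight_ae_eq hε g),
    unweight_ae_eq hε (permOp σ τ g), permOp_ae_eq σ τ g] with ζ h1 h2 h3 h4
  rw [h1, h2, h3, h4, invSymbol, invSymbol, sobolevSymbol_permPts]

theorem adjOp_unweight (g : Kernel k) : adjOp (unweight hε g) = unweight hε (adjOp g) := by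
  refine Lp.ext ?_
  filter_upwards [adjOp_ae_eq (unweight hε g),
    measurePreserving_neg_swap.quasiMeasurePreserving.ae (unweight_ae_eq hε g),
    unweight_ae_eq hε (adjOp g), adjOp_ae_eq g] with ζ h1 h2 h3 h4
  rw [h1, h2, h3, h4, map_mul, invSymbol, invSymbol, sobolevSymbol_neg_swap, Complex.conj_ofReal]

theorem unweight_injective : Function.Injective (unweight hε : Kernel k → Kernel k) := by
  intro f g h
  refine synth_injective hε ?_
  rw [synth_apply, synth_apply, h]

theorem isBosonic_synth_iff (g : Kernel k) :
    IsBosonic (synth hε g) ↔ ∀ σ τ, permOp σ τ g = g := by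
  rw [isBosonic_iff]
  refine forall_congr' fun σ => forall_congr' fun τ => ?_
  rw [← (Lp.fourierTransformₗᵢ (Pts k) ℂ).injective.eq_iff]
  change (𝓕 (permOp σ τ (synth hε g)) : Kernel k) = 𝓕 (synth hε g) ↔ _
  rw [fourier_permOp, fourier_synth, permOp_unweight, (unweight_injective hε).eq_iff]

theorem isHermitianKernel_synth_iff (g : Kernel k) :
    IsHermitianKernel (synth hε g) ↔ adjOp g = g := by
  rw [isHermitianKernel_iff, fourier_synth, adjOp_unweight, (unweight_injective hε).eq_iff]

end synthesis

end

/-! ### Test functions and mollifiers on the Fourier side. -/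

section

variable {k : ℕ}

/-- Integration against a square integrable function. -/
def testOp (Ψ : Pts k → ℂ) (hΨ : MemLp Ψ 2 volume) : Kernel k →L[ℂ] ℂ :=
  innerSL ℂ (conjOp (hΨ.toLp Ψ))

theorem testOp_apply {Ψ : Pts k → ℂ} (hΨ : MemLp Ψ 2 volume) (f : Kernel k) :
    testOp Ψ hΨ f = ∫ z, Ψ z * f z := by
  rw [testOp, innerSL_apply_apply, L2.inner_def]
  refine integral_congr_ae ?_
  filter_upwards [conjOp_ae_eq (hΨ.toLp Ψ), hΨ.coeFn_toLp] with z h1 h2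
  rw [h1, h2, RCLike.inner_apply, Complex.conj_conj, mul_comm]

theorem integral_mul_fourierInv_schwartz {Ψ : Pts k → ℂ} (h1 : Integrable Ψ)
    (φ : 𝓢(Pts k, ℂ)) :
    ∫ z, Ψ z * 𝓕⁻ (φ : Pts k → ℂ) z = ∫ ζ, 𝓕⁻ Ψ ζ * φ ζ := by
  have h := VectorFourier.integral_fourierIntegral_smul_eq_flip (L := -innerₗ (Pts k))
    (μ := volume) (ν := volume) Real.continuous_fourierChar
    (continuous_inner.neg) h1 φ.integrable
  have hflip : (-innerₗ (Pts k)).flip = -innerₗ (Pts k) := by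
    ext x y
    simp [real_inner_comm]
  rw [hflip] at h
  exact h.symm

/-- The multiplication formula extends from Schwartz functions by density; square integrability on
both sides makes the two functionals continuous. -/
theorem integral_mul_fourierInv {Ψ : Pts k → ℂ} (h1 : Integrable Ψ) (h2 : MemLp Ψ 2 volume)
    (h3 : MemLp (𝓕⁻ Ψ) 2 volume) (h : Kernel k) :
    ∫ z, Ψ z * (𝓕⁻ h : Kernel k) z = ∫ ζ, 𝓕⁻ Ψ ζ * h ζ := by
  rw [← testOp_apply h2, ← testOp_apply h3]
  refine kernel_induction (p := fun h : Kernel k => testOp Ψ h2 (𝓕⁻ h) = testOp _ h3 h) h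
    (isClosed_eq ((testOp Ψ h2).continuous.comp continuous_fourierInv)
      (testOp _ h3).continuous) fun φ => ?_
  rw [SchwartzMap.toLp_fourierInv_eq, testOp_apply, testOp_apply]
  calc _ = ∫ z, Ψ z * 𝓕⁻ (φ : Pts k → ℂ) z := integral_congr_ae (by
        filter_upwards [(𝓕⁻ φ).coeFn_toLp 2 volume] with z hz
        rw [hz, SchwartzMap.fourierInv_coe])
    _ = ∫ ζ, 𝓕⁻ Ψ ζ * φ ζ := integral_mul_fourierInv_schwartz h1 φ
    _ = _ := integral_congr_ae (by
        filter_upwards [φ.coeFn_toLp 2 volume] with z hz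
        rw [hz])

/-- The point with given first coordinates and given distances of the last two coordinates from
coordinate `i`. -/
def spreadPts (i : Idx k) (q : Pts k × (ℝ × ℝ)) : Pts (k + 1) :=
  WithLp.toLp 2 (snoc2 (fun j => q.1 j) (q.1 i - q.2.1) (q.1 i - q.2.2))

theorem measurePreserving_spreadPts (i : Idx k) :
    MeasurePreserving (spreadPts i) (volume.prod volume) volume := by
  have h0 : ∀ c : ℝ, MeasurePreserving (fun x : ℝ => c - x) volume volume := fun c =>
    Measure.measurePreserving_sub_left volume c
  have h1 : MeasurePreserving (fun q : (Idx k → ℝ) × (ℝ × ℝ) =>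
      (q.1, (q.1 i - q.2.1, q.1 i - q.2.2))) (volume.prod volume) (volume.prod volume) := by
    refine (MeasurePreserving.id (volume : Measure (Idx k → ℝ))).skew_product
      (μc := (volume : Measure (ℝ × ℝ))) (μd := (volume : Measure (ℝ × ℝ)))
      (g := fun (x : Idx k → ℝ) (p : ℝ × ℝ) => (x i - p.1, x i - p.2)) (by fun_prop) ?_
    exact Eventually.of_forall fun x => ((h0 (x i)).prod (h0 (x i))).map_eq
  have h2 := ((PiLp.volume_preserving_ofLp (Idx k)).prod
    (MeasurePreserving.id (volume : Measure (ℝ × ℝ))))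
  exact (PiLp.volume_preserving_toLp (Idx (k + 1))).comp
    (measurePreserving_snoc2.comp (h1.comp h2))

/-- The two changes of variables are dual to each other: positions relative to particle `i` pair
with the contracted frequencies and decouple from the rest, so Fourier integrals of product test
functions factorize. -/
theorem inner_spreadPts_collapsePts (i : Idx k) (z ζ : Pts k) (q p : ℝ × ℝ) :
    inner ℝ (spreadPts i (z, q)) (collapsePts i (ζ, p)) =
      inner ℝ z ζ + (-(q.1 * p.1) + -(q.2 * p.2)) := by
  simp only [PiLp.inner_apply, RCLike.inner_apply, conj_trivial]
  rw [Fintype.sum_sum_type, Fin.sum_univ_castSucc, Fin.sum_univ_castSucc]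
  have h1 : ∀ j : Idx k, collapsePts i (ζ, p) (up j) * spreadPts i (z, q) (up j) =
      ζ j * z j + if j = i then -(p.1 + p.2) * z i else 0 := by
    intro j
    by_cases h : j = i
    · subst h
      simp only [collapsePts_up_self, spreadPts, snoc2_up, if_true]
      ring
    · simp only [collapsePts_up_of_ne h, spreadPts, snoc2_up, if_neg h, add_zero]
  have h2 := Finset.sum_congr rfl fun (j : Idx k) (_ : j ∈ Finset.univ) => h1 j
  rw [Finset.sum_add_distrib, Finset.sum_ite_eq' Finset.univ i, if_pos (Finset.mem_univ i),
    Fintype.sum_sum_type] at h2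
  simp only [up_inl, up_inr] at h2
  have h3 : collapsePts i (ζ, p) (Sum.inl (Fin.last k)) * spreadPts i (z, q) (Sum.inl (Fin.last k))
      = p.1 * (z i - q.1) := by simp [spreadPts]
  have h4 : collapsePts i (ζ, p) (Sum.inr (Fin.last k)) * spreadPts i (z, q) (Sum.inr (Fin.last k))
      = p.2 * (z i - q.2) := by simp [spreadPts]
  rw [h3, h4]
  linarith

section profile

variable {ρ : ℝ → ℝ}

theorem contDiff_approxDelta (hρ : IsProfile ρ) (a : ℝ) :
    ContDiff ℝ (⊤ : ℕ∞) fun x => (approxDelta ρ a x : ℂ) := by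
  have h := hρ.smooth
  have h1 : ContDiff ℝ (⊤ : ℕ∞) (approxDelta ρ a) := by
    unfold approxDelta
    exact contDiff_const.mul (h.comp (contDiff_id.div_const a))
  exact Complex.ofRealCLM.contDiff.comp h1

theorem hasCompactSupport_approxDelta (hρ : IsProfile ρ) (a : ℝ) :
    HasCompactSupport fun x => (approxDelta ρ a x : ℂ) := by
  by_cases ha : a = 0
  · have : (fun x => (approxDelta ρ a x : ℂ)) = 0 := by
      ext x
      simp [approxDelta, ha]
    rw [this]
    exact HasCompactSupport.zero
  · have h1 : HasCompactSupport fun x => ρ (x / a) := by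
      have := hρ.compact.comp_homeomorph (Homeomorph.mulRight₀ a⁻¹ (inv_ne_zero ha))
      simpa [Function.comp_def, div_eq_mul_inv] using this
    have h2 : HasCompactSupport (approxDelta ρ a) := h1.mul_left
    exact h2.comp_left (g := fun x : ℝ => (x : ℂ)) Complex.ofReal_zero

/-- The approximate delta function as a Schwartz function. -/
def bump (hρ : IsProfile ρ) (a : ℝ) : 𝓢(ℝ, ℂ) :=
  (hasCompactSupport_approxDelta hρ a).toSchwartzMap (contDiff_approxDelta hρ a)

theorem bump_apply (hρ : IsProfile ρ) (a x : ℝ) : bump hρ a x = (approxDelta ρ a x : ℂ) := rfl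

theorem integral_norm_bump_le (hρ : IsProfile ρ) (a : ℝ) :
    ∫ x, ‖bump hρ a x‖ ≤ ∫ x, |ρ x| := by
  have h1 : ∀ x, ‖bump hρ a x‖ = |a|⁻¹ * |ρ (x / a)| := by
    intro x
    rw [bump_apply, Complex.norm_real, Real.norm_eq_abs, approxDelta, abs_mul, abs_inv]
  simp only [h1]
  rw [integral_const_mul, Measure.integral_comp_div (fun x => |ρ x|) a, smul_eq_mul, ← mul_assoc]
  refine mul_le_of_le_one_left (integral_nonneg fun _ => abs_nonneg _) ?_
  -- This also covers `a = 0`; the suprema of the mollifiers therefore have one bound for all `a`.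
  exact inv_mul_le_one

theorem norm_fourier_bump_le (hρ : IsProfile ρ) (a x : ℝ) :
    ‖𝓕 (bump hρ a) x‖ ≤ ∫ x, |ρ x| := by
  rw [SchwartzMap.fourier_coe]
  exact (VectorFourier.norm_fourierIntegral_le_integral_norm _ _ _ _ _).trans
    (integral_norm_bump_le hρ a)

theorem fourier_bump (hρ : IsProfile ρ) {a : ℝ} (ha : 0 < a) (x : ℝ) :
    𝓕 (bump hρ a) x = 𝓕 (bump hρ 1) (a * x) := by
  rw [SchwartzMap.fourier_coe, SchwartzMap.fourier_coe, Real.fourier_real_eq_integral_exp_smul,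
    Real.fourier_real_eq_integral_exp_smul]
  have h := Measure.integral_comp_div
    (fun v : ℝ => Complex.exp (↑(-2 * Real.pi * v * (a * x)) * Complex.I) • bump hρ 1 v) a
  rw [abs_of_pos ha, ← inv_smul_eq_iff₀ ha.ne', ← integral_smul] at h
  rw [← h]
  refine integral_congr_ae (Eventually.of_forall fun v => ?_)
  simp only [bump_apply, approxDelta]
  rw [smul_comm, inv_one, one_mul, div_one]
  congr 1
  · congr 3
    field_simp
  · rw [Complex.ofReal_mul]
    rfl

/-- By scaling, the transform at `x` is that of the profile at `a x`, which tends to its value at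
`0`, the integral of the profile. -/
theorem tendsto_fourier_bump (hρ : IsProfile ρ) (x : ℝ) :
    Tendsto (fun a => 𝓕 (bump hρ a) x) (𝓝[>] 0) (𝓝 1) := by
  have h0 : 𝓕 (bump hρ 1) 0 = 1 := by
    rw [SchwartzMap.fourier_coe, Real.fourier_real_eq_integral_exp_smul]
    have : ∀ v : ℝ, Complex.exp (↑(-2 * Real.pi * v * 0) * Complex.I) • bump hρ 1 v =
        ((ρ v : ℝ) : ℂ) := by
      intro v
      simp [bump_apply, approxDelta]
    simp only [this]
    rw [integral_complex_ofReal, hρ.integral_eq_one, Complex.ofReal_one]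
  have h1 : Tendsto (fun a : ℝ => 𝓕 (bump hρ 1) (a * x)) (𝓝[>] 0) (𝓝 1) := by
    have h2 : Continuous fun a : ℝ => 𝓕 (bump hρ 1) (a * x) :=
      (𝓕 (bump hρ 1)).continuous.comp (continuous_id.mul continuous_const)
    have h3 := h2.tendsto 0
    rw [zero_mul, h0] at h3
    exact h3.mono_left nhdsWithin_le_nhds
  refine h1.congr' ?_
  filter_upwards [self_mem_nhdsWithin] with a ha
  exact (fourier_bump hρ ha x).symm

/-- The multiplier that corresponds to the regularization of the delta functions. -/
def mollifier (hρ : IsProfile ρ) (a : ℝ) : Multiplier where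
  toFun p := 𝓕 (bump hρ a) p.1 * 𝓕 (bump hρ a) p.2
  measurable := by
    have := (𝓕 (bump hρ a)).continuous
    exact (by fun_prop : Continuous fun p : ℝ × ℝ =>
      𝓕 (bump hρ a) p.1 * 𝓕 (bump hρ a) p.2).measurable
  sup := (∫ x, |ρ x|).toNNReal ^ 2
  enorm_le p := by
    have h : ∀ x, ‖𝓕 (bump hρ a) x‖ₑ ≤ (∫ x, |ρ x|).toNNReal := fun x => by
      rw [← ofReal_norm]
      exact ENNReal.ofReal_le_ofReal (norm_fourier_bump_le hρ a x)
    rw [enorm_mul, sq, ENNReal.coe_mul]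
    exact mul_le_mul' (h _) (h _)
  l2 := (eLpNorm (𝓕 (bump hρ a) : 𝓢(ℝ, ℂ)) 2 volume).toNNReal ^ 2
  lintegral_le := by
    have hm : Measurable fun x => ‖𝓕 (bump hρ a) x‖ₑ ^ 2 :=
      (𝓕 (bump hρ a)).continuous.measurable.enorm.pow_const 2
    simp only [enorm_mul, mul_pow]
    rw [Measure.volume_eq_prod, lintegral_prod_mul hm.aemeasurable hm.aemeasurable,
      ← sq_eLpNorm_two, ENNReal.coe_pow, ENNReal.coe_toNNReal
        ((𝓕 (bump hρ a)).memLp 2 volume).eLpNorm_ne_top]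
    exact le_of_eq (by ring)

theorem isApprox_mollifier (hρ : IsProfile ρ) : IsApprox (𝓝[>] 0) (mollifier hρ) where
  sup_le := ⟨_, fun _ => le_rfl⟩
  tendsto p := by
    have := (tendsto_fourier_bump hρ p.1).mul (tendsto_fourier_bump hρ p.2)
    rwa [one_mul] at this

end profile

end

/-! ### The regularized collision terms as operators with a multiplier. -/

section

variable {k : ℕ}

theorem integral_comp_of_measurePreserving {α β : Type*} [MeasurableSpace α] [MeasurableSpace β]
    {μ : Measure α} {ν : Measure β} {S : α → β} (hS : MeasurePreserving S μ ν) {f : β → ℂ}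
    (hf : AEStronglyMeasurable f ν) : ∫ w, f w ∂ν = ∫ q, f (S q) ∂μ := by
  rw [← hS.map_eq, integral_map hS.aemeasurable (by rwa [hS.map_eq])]

theorem memLp_two_mul_prod {α β : Type*} [MeasurableSpace α] [MeasurableSpace β]
    {μ : Measure α} {ν : Measure β} [SFinite μ] [SFinite ν] {f : α → ℂ} {g : β → ℂ}
    (hf : MemLp f 2 μ) (hg : MemLp g 2 ν) :
    MemLp (fun q : α × β => f q.1 * g q.2) 2 (μ.prod ν) := by
  have hm : AEStronglyMeasurable (fun q : α × β => f q.1 * g q.2) (μ.prod ν) :=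
    (hf.aestronglyMeasurable.comp_fst).mul hg.aestronglyMeasurable.comp_snd
  rw [memLp_two_iff_integrable_sq_norm hm]
  have h := ((memLp_two_iff_integrable_sq_norm hf.aestronglyMeasurable).1 hf).mul_prod
    ((memLp_two_iff_integrable_sq_norm hg.aestronglyMeasurable).1 hg)
  simpa [mul_pow] using h

theorem fourierInv_schwartz_memLp (Φ : 𝓢(Pts k, ℂ)) : MemLp (𝓕⁻ (Φ : Pts k → ℂ)) 2 volume := by
  rw [← SchwartzMap.fourierInv_coe]
  exact (𝓕⁻ Φ).memLp 2 volume

theorem Multiplier.memLp (M : Multiplier) : MemLp M.toFun 2 volume :=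
  ⟨M.measurable.aestronglyMeasurable, M.eLpNorm_le.trans_lt ENNReal.coe_lt_top⟩

/-- `kappa` is exactly the quotient of the weights after and before the contraction; all particles
other than `i` cancel. -/
theorem sobolevSymbol_collapsePts (ε : ℝ) (i : Idx k) (ζ : Pts k) (p : ℝ × ℝ) :
    sobolevSymbol ε (collapsePts i (ζ, p)) * kappa ε (ζ i) p = sobolevSymbol ε ζ := by
  have hw := weight_pos ε
  rw [sobolevSymbol_eq, sobolevSymbol_eq, Fintype.prod_sum_type, Fin.prod_univ_castSucc,
    Fin.prod_univ_castSucc, collapsePts_inl_last, collapsePts_inr_last]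
  have h1 : (∏ j : Idx k, weight ε (collapsePts i (ζ, p) (up j))) * weight ε (ζ i) =
      weight ε (ζ i - p.1 - p.2) * ∏ j : Idx k, weight ε (ζ j) := by
    rw [← Finset.mul_prod_erase _ _ (Finset.mem_univ i),
      ← Finset.mul_prod_erase _ (fun j => weight ε (ζ j)) (Finset.mem_univ i), collapsePts_up_self]
    have h2 : ∏ j ∈ Finset.univ.erase i, weight ε (collapsePts i (ζ, p) (up j)) =
        ∏ j ∈ Finset.univ.erase i, weight ε (ζ j) :=
      Finset.prod_congr rfl fun j hj => by rw [collapsePts_up_of_ne (Finset.ne_of_mem_erase hj)]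
    rw [h2]
    ring
  rw [Fintype.prod_sum_type] at h1
  simp only [up_inl, up_inr] at h1
  rw [kappa, ← mul_div_assoc, div_eq_iff (mul_pos (mul_pos (hw _) (hw _)) (hw _)).ne']
  linear_combination weight ε p.1 * weight ε p.2 * h1

theorem invSymbol_collapsePts {ε : ℝ} (hε : 0 ≤ ε) (i : Idx k) (ζ : Pts k) (p : ℝ × ℝ) :
    invSymbol ε (collapsePts i (ζ, p)) = invSymbol ε ζ * kappa ε (ζ i) p := by
  have h1 := one_le_sobolevSymbol hε ζ
  have h2 := one_le_sobolevSymbol hε (collapsePts i (ζ, p))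
  rw [invSymbol, invSymbol, ← Complex.ofReal_mul, ← sobolevSymbol_collapsePts ε i ζ p]
  congr 1
  have h3 : kappa ε (ζ i) p ≠ 0 := by
    intro h
    rw [← sobolevSymbol_collapsePts ε i ζ p, h, mul_zero] at h1
    linarith
  field_simp

section pairing

variable {ρ : ℝ → ℝ} (hρ : IsProfile ρ) (a : ℝ) (Φ : 𝓢(Pts k, ℂ)) (i : Idx k)

/-- The test function of `k + 1` particles that corresponds to testing the regularized contraction
with particle `i`. -/
def contractTest (w : Pts (k + 1)) : ℂ :=
  Φ (initPts w) * (bump hρ a (w (up i) - w (Sum.inl (Fin.last k))) *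
    bump hρ a (w (up i) - w (Sum.inr (Fin.last k))))

theorem continuous_contractTest : Continuous (contractTest hρ a Φ i) := by
  have h1 := Φ.continuous
  have h2 := (bump hρ a).continuous
  have h3 : Continuous (initPts : Pts (k + 1) → Pts k) :=
    (PiLp.continuous_toLp 2 _).comp (by fun_prop)
  unfold contractTest
  fun_prop

theorem contractTest_spreadPts (q : Pts k × (ℝ × ℝ)) :
    contractTest hρ a Φ i (spreadPts i q) = Φ q.1 * (bump hρ a q.2.1 * bump hρ a q.2.2) := by
  have h : initPts (spreadPts i q) = q.1 := by
    ext j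
    rcases j with j | j <;> simp [initPts, spreadPts]
  rw [contractTest, h]
  simp [spreadPts]

theorem integrable_contractTest : Integrable (contractTest hρ a Φ i) := by
  have h1 := Φ.integrable (μ := volume).mul_prod
    (((bump hρ a).integrable (μ := volume)).mul_prod ((bump hρ a).integrable (μ := volume)))
  refine ((measurePreserving_spreadPts i).integrable_comp
    (continuous_contractTest hρ a Φ i).aestronglyMeasurable).1 ?_
  refine h1.congr (Eventually.of_forall fun q => ?_)
  exact (contractTest_spreadPts hρ a Φ i q).symm

theorem memLp_contractTest : MemLp (contractTest hρ a Φ i) 2 volume := by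
  have h1 := memLp_two_mul_prod (Φ.memLp 2 volume) (memLp_two_mul_prod
    ((bump hρ a).memLp 2 volume) ((bump hρ a).memLp 2 volume))
  rw [← (measurePreserving_spreadPts i).map_eq]
  refine (memLp_map_measure_iff (continuous_contractTest hρ a Φ i).aestronglyMeasurable
    (measurePreserving_spreadPts i).aemeasurable).2 ?_
  refine (memLp_congr_ae (Eventually.of_forall fun q => ?_)).1 h1
  exact (contractTest_spreadPts hρ a Φ i q).symm

/-- In the coordinates `spreadPts` the test function is a product and, by
`inner_spreadPts_collapsePts`, so is the exponential. The bumps contribute the mollifying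
multiplier. -/
theorem fourierInv_contractTest (ζ : Pts k) (p : ℝ × ℝ) :
    𝓕⁻ (contractTest hρ a Φ i) (collapsePts i (ζ, p)) =
      𝓕⁻ (Φ : Pts k → ℂ) ζ * (mollifier hρ a).toFun p := by
  rw [Real.fourierInv_eq', integral_comp_of_measurePreserving (measurePreserving_spreadPts i)]
  · have h1 : ∀ q : Pts k × (ℝ × ℝ), Complex.exp (↑(2 * Real.pi *
        inner ℝ (spreadPts i q) (collapsePts i (ζ, p))) * Complex.I) •
        contractTest hρ a Φ i (spreadPts i q) =
        (Complex.exp (↑(2 * Real.pi * inner ℝ q.1 ζ) * Complex.I) • Φ q.1) *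
        ((Complex.exp (↑(-2 * Real.pi * q.2.1 * p.1) * Complex.I) • bump hρ a q.2.1) *
        (Complex.exp (↑(-2 * Real.pi * q.2.2 * p.2) * Complex.I) • bump hρ a q.2.2)) := by
      intro q
      rw [contractTest_spreadPts, inner_spreadPts_collapsePts]
      simp only [smul_eq_mul]
      have : Complex.exp (↑(2 * Real.pi * (inner ℝ q.1 ζ + (-(q.2.1 * p.1) + -(q.2.2 * p.2)))) *
          Complex.I) = Complex.exp (↑(2 * Real.pi * inner ℝ q.1 ζ) * Complex.I) *
          (Complex.exp (↑(-2 * Real.pi * q.2.1 * p.1) * Complex.I) *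
          Complex.exp (↑(-2 * Real.pi * q.2.2 * p.2) * Complex.I)) := by
        rw [← Complex.exp_add, ← Complex.exp_add]
        congr 1
        push_cast
        ring
      rw [this]
      ring
    simp only [h1]
    rw [integral_prod_mul (fun z : Pts k => Complex.exp (↑(2 * Real.pi * inner ℝ z ζ) *
        Complex.I) • Φ z) (fun q : ℝ × ℝ =>
        (Complex.exp (↑(-2 * Real.pi * q.1 * p.1) * Complex.I) • bump hρ a q.1) *
        (Complex.exp (↑(-2 * Real.pi * q.2 * p.2) * Complex.I) • bump hρ a q.2)),
      Measure.volume_eq_prod ℝ ℝ,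
      integral_prod_mul (fun v : ℝ => Complex.exp (↑(-2 * Real.pi * v * p.1) * Complex.I) •
        bump hρ a v) (fun v : ℝ => Complex.exp (↑(-2 * Real.pi * v * p.2) * Complex.I) •
        bump hρ a v), ← Real.fourierInv_eq', ← Real.fourier_real_eq_integral_exp_smul,
      ← Real.fourier_real_eq_integral_exp_smul]
    rfl
  · have := continuous_contractTest hρ a Φ i
    exact (by fun_prop : Continuous fun v : Pts (k + 1) => Complex.exp (↑(2 * Real.pi *
        inner ℝ v (collapsePts i (ζ, p))) * Complex.I) • contractTest hρ a Φ i v).aestronglyMeasurable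

theorem memLp_fourierInv_contractTest : MemLp (𝓕⁻ (contractTest hρ a Φ i)) 2 volume := by
  have hc : Continuous (𝓕⁻ (contractTest hρ a Φ i)) :=
    VectorFourier.fourierIntegral_continuous Real.continuous_fourierChar
      (continuous_inner.neg) (integrable_contractTest hρ a Φ i)
  have h1 := memLp_two_mul_prod (fourierInv_schwartz_memLp Φ) (mollifier hρ a).memLp
  rw [← (measurePreserving_collapsePts i).map_eq]
  refine (memLp_map_measure_iff hc.aestronglyMeasurable
    (measurePreserving_collapsePts i).aemeasurable).2 ?_
  refine (memLp_congr_ae (Eventually.of_forall fun q => ?_)).1 h1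
  exact (fourierInv_contractTest hρ a Φ i q.1 q.2).symm

/-- Parseval in the coordinates `collapsePts`. The operator already carries the sign of particle
`i`, which is removed here since each half of the commutator is tested without sign. -/
theorem integral_contractTest_mul_synth {ε : ℝ} (hε : 0 ≤ ε) (g : Kernel (k + 1)) :
    (∫ w, contractTest hρ a Φ i w * synth hε g w) =
      sgn i * ∫ z, Φ z * synth hε (collisionOp hε (mollifier hρ a) i 0 g) z := by
  have hm := (memLp_fourierInv_contractTest hρ a Φ i).integrable_mul
    (Lp.memLp (unweight hε g))
  have h0 : (∫ w, 𝓕⁻ (contractTest hρ a Φ i) w * unweight hε g w) =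
      ∫ q, 𝓕⁻ (contractTest hρ a Φ i) (collapsePts i q) * unweight hε g (collapsePts i q) :=
    integral_comp_of_measurePreserving (measurePreserving_collapsePts i) hm.aestronglyMeasurable
  have hi : Integrable (fun q => 𝓕⁻ (contractTest hρ a Φ i) (collapsePts i q) *
      unweight hε g (collapsePts i q)) (volume.prod volume) :=
    (measurePreserving_collapsePts i).integrable_comp_of_integrable hm
  rw [synth_apply, synth_apply, integral_mul_fourierInv (integrable_contractTest hρ a Φ i)
    (memLp_contractTest hρ a Φ i) (memLp_fourierInv_contractTest hρ a Φ i),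
    integral_mul_fourierInv Φ.integrable (Φ.memLp 2 volume) (fourierInv_schwartz_memLp Φ),
    h0, Measure.volume_eq_prod (Pts k) (ℝ × ℝ), integral_prod _ hi,
    ← integral_const_mul]
  refine integral_congr_ae ?_
  filter_upwards [unweight_ae_eq hε (collisionOp hε (mollifier hρ a) i 0 g),
    collapseOp_ae_eq (isSymbol_symbol hε (mollifier hρ a) i 0) i g,
    ae_collapsePts i (unweight_ae_eq hε g)] with ζ h1 h2 h3
  rw [h1, collisionOp, h2, collapseFun]
  have hs : (sgn i : ℂ) * sgn i = 1 := by
    rcases i with i | i <;> simp [sgn]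
  calc _ = ∫ p, (sgn i * (𝓕⁻ (Φ : Pts k → ℂ) ζ * invSymbol ε ζ)) *
        (symbol ε (mollifier hρ a) i 0 (ζ i) p * g (collapsePts i (ζ, p))) := by
        refine integral_congr_ae ?_
        filter_upwards [h3] with p h4
        rw [fourierInv_contractTest, h4, invSymbol_collapsePts hε]
        simp only [symbol, zero_mul, Complex.ofReal_zero, mul_zero, neg_zero, Complex.exp_zero]
        linear_combination (-(𝓕⁻ (Φ : Pts k → ℂ) ζ * (mollifier hρ a).toFun p *
          (invSymbol ε ζ * kappa ε (ζ i) p * g (collapsePts i (ζ, p))))) * hs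
    _ = _ := by
        rw [integral_const_mul]
        ring

theorem integrable_contractTest_mul (f : Kernel (k + 1)) :
    Integrable fun w => contractTest hρ a Φ i w * f w :=
  (memLp_contractTest hρ a Φ i).integrable_mul (Lp.memLp f)

end pairing

theorem collisionPairing_eq {ρ : ℝ → ℝ} (hρ : IsProfile ρ) (a : ℝ) (j : Fin k)
    (γ : Kernel (k + 1)) (Φ : 𝓢(Pts k, ℂ)) :
    collisionPairing ρ a j γ Φ = (∫ w, contractTest hρ a Φ (Sum.inl j) w * γ w) -
      ∫ w, contractTest hρ a Φ (Sum.inr j) w * γ w := by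
  rw [collisionPairing, ← integral_sub (integrable_contractTest_mul hρ a Φ _ γ)
    (integrable_contractTest_mul hρ a Φ _ γ)]
  refine integral_congr_ae (Eventually.of_forall fun w => ?_)
  simp only [contractTest, bump_apply, up, Sum.map_inl, Sum.map_inr]
  push_cast
  ring

/-- For every `a` the regularization is exactly the insertion of a multiplier, so the limit `a → 0`
is covered by the convergence of multipliers to `1`. -/
theorem collisionPairing_synth {ρ : ℝ → ℝ} (hρ : IsProfile ρ) (a : ℝ) (j : Fin k) {ε : ℝ}
    (hε : 0 ≤ ε) (g : Kernel (k + 1)) (Φ : 𝓢(Pts k, ℂ)) (t : ℝ) :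
    collisionPairing ρ a j (synth hε (flow t g)) Φ =
      testOp Φ (Φ.memLp 2 volume) (synth hε (flow t
        (collisionOp hε (mollifier hρ a) (Sum.inl j) t g +
          collisionOp hε (mollifier hρ a) (Sum.inr j) t g))) := by
  have h : ∀ i : Idx k, (∫ z, Φ z * synth hε (collisionOp hε (mollifier hρ a) i 0 (flow t g)) z) =
      testOp Φ (Φ.memLp 2 volume) (synth hε (flow t (collisionOp hε (mollifier hρ a) i t g))) := by
    intro i
    rw [collisionOp_eq _ _ _ t, flow_flow, add_neg_cancel, flow_zero, testOp_apply]
  rw [collisionPairing_eq hρ, integral_contractTest_mul_synth, integral_contractTest_mul_synth,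
    h, h, map_add, map_add, map_add]
  simp [sgn]

end

/-! ### Bosonic and Hermitian symmetry of the collision terms. -/

section

variable {k : ℕ}

theorem permOp_flow (σ τ : Equiv.Perm (Fin k)) (t : ℝ) (f : Kernel k) :
    permOp σ τ (flow t f) = flow t (permOp σ τ f) := by
  refine Lp.ext ?_
  filter_upwards [permOp_ae_eq σ τ (flow t f),
    (measurePreserving_permPts σ τ).quasiMeasurePreserving.ae (flow_ae_eq t f),
    flow_ae_eq t (permOp σ τ f), permOp_ae_eq σ τ f] with ζ h1 h2 h3 h4
  have h5 : freeSymbol t (permPts σ τ ζ) = freeSymbol t ζ := by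
    have e1 : ∑ j, permPts σ τ ζ (Sum.inl j) ^ 2 = ∑ j, ζ (Sum.inl j) ^ 2 :=
      Equiv.sum_comp σ fun j => ζ (Sum.inl j) ^ 2
    have e2 : ∑ j, permPts σ τ ζ (Sum.inr j) ^ 2 = ∑ j, ζ (Sum.inr j) ^ 2 :=
      Equiv.sum_comp τ fun j => ζ (Sum.inr j) ^ 2
    rw [freeSymbol, freeSymbol, e1, e2]
  rw [h1, h2, h3, h4, h5]

theorem adjOp_flow (t : ℝ) (f : Kernel k) : adjOp (flow t f) = flow t (adjOp f) := by
  refine Lp.ext ?_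
  filter_upwards [adjOp_ae_eq (flow t f),
    measurePreserving_neg_swap.quasiMeasurePreserving.ae (flow_ae_eq t f),
    flow_ae_eq t (adjOp f), adjOp_ae_eq f] with ζ h1 h2 h3 h4
  have h5 : (starRingEnd ℂ) (freeSymbol t (-swapPts ζ)) = freeSymbol t ζ := by
    have e1 : ∀ j, (-swapPts ζ) (Sum.inl j) ^ 2 = ζ (Sum.inr j) ^ 2 := fun j => neg_sq _
    have e2 : ∀ j, (-swapPts ζ) (Sum.inr j) ^ 2 = ζ (Sum.inl j) ^ 2 := fun j => neg_sq _
    simp only [freeSymbol, e1, e2]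
    rw [← Complex.exp_conj, map_neg, map_mul, Complex.conj_I, Complex.conj_ofReal]
    congr 1
    push_cast
    ring
  rw [h1, h2, h3, h4, map_mul, h5]

theorem collapsePts_neg_swap (i : Idx k) (ζ : Pts k) (q : ℝ × ℝ) :
    collapsePts i (-swapPts ζ, -q.swap) = -swapPts (collapsePts i.swap (ζ, q)) := by
  have hup : ∀ l : Idx k, (up l).swap = up l.swap := by
    rintro (l | l) <;> rfl
  have hneg : ∀ (m : ℕ) (z : Pts m) (l : Idx m), (-swapPts z) l = -z l.swap := fun _ _ _ => rfl
  refine pts_ext fun j => Idx.cases (P := fun j => collapsePts i (-swapPts ζ, -q.swap) j =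
      (-swapPts (collapsePts i.swap (ζ, q))) j) ?_ ?_ ?_ j
  · intro l
    rw [hneg, hup]
    by_cases h : l = i
    · subst h
      rw [collapsePts_up_self, collapsePts_up_self, hneg]
      simp
      ring
    · rw [collapsePts_up_of_ne h, collapsePts_up_of_ne (fun h' => h (Sum.swap_leftInverse.injective h')),
        hneg]
  · rw [hneg]
    simp
  · rw [hneg]
    simp

theorem sgn_swap (i : Idx k) : sgn i.swap = -sgn i := by
  rcases i with i | i <;> simp [sgn]

/-- The reflection preserves the weights, and the exchange of variables reverses both the sign of
the particle and the phase. Conjugation restores the phase, and the sign survives. -/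
theorem conj_symbol_neg_swap {ε : ℝ} {M : Multiplier}
    (hM : ∀ q, (starRingEnd ℂ) (M.toFun (-q.swap)) = M.toFun q) (i : Idx k) (s z : ℝ) (q : ℝ × ℝ) :
    (starRingEnd ℂ) (symbol ε M i s (-z) (-q.swap)) = -symbol ε M i.swap s z q := by
  have h1 : phase i (-z) (-q.swap) = -phase i.swap z q := by
    simp only [phase, sgn_swap, Prod.fst_neg, Prod.snd_neg, Prod.fst_swap, Prod.snd_swap]
    ring
  have h2 : kappa ε (-z) (-q.swap) = kappa ε z q := by
    simp only [kappa, Prod.fst_neg, Prod.snd_neg, Prod.fst_swap, Prod.snd_swap, weight_neg]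
    rw [show -z - -q.2 - -q.1 = -(z - q.1 - q.2) by ring, weight_neg, mul_right_comm]
  rw [symbol, symbol, h1, h2, sgn_swap, map_mul, map_mul, map_mul, hM, Complex.conj_ofReal,
    Complex.conj_ofReal, ← Complex.exp_conj, map_neg, map_mul, Complex.conj_I, Complex.conj_ofReal]
  push_cast
  rw [show -(-Complex.I * ((s : ℂ) * -(phase i.swap z q : ℂ))) =
    -(Complex.I * ((s : ℂ) * (phase i.swap z q : ℂ))) by ring]
  ring

/-- The adjoint exchanges the two halves of the commutator, hence the minus sign; it is compensated
later by `conj β = -β`. -/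
theorem adjOp_collisionOp {ε : ℝ} (hε : 0 ≤ ε) {M : Multiplier}
    (hM : ∀ q, (starRingEnd ℂ) (M.toFun (-q.swap)) = M.toFun q) (i : Idx k) (s : ℝ)
    (f : Kernel (k + 1)) :
    adjOp (collisionOp hε M i s f) = -collisionOp hε M i.swap s (adjOp f) := by
  have hmp : MeasurePreserving (fun q : ℝ × ℝ => -q.swap) volume volume :=
    (Measure.measurePreserving_neg (volume : Measure (ℝ × ℝ))).comp
      (Measure.measurePreserving_swap (μ := (volume : Measure ℝ)) (ν := (volume : Measure ℝ)))
  have hme : MeasurableEmbedding (fun q : ℝ × ℝ => -q.swap) :=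
    (MeasurableEquiv.prodComm.trans (MeasurableEquiv.neg (ℝ × ℝ))).measurableEmbedding
  refine Lp.ext ?_
  filter_upwards [adjOp_ae_eq (collisionOp hε M i s f),
    measurePreserving_neg_swap.quasiMeasurePreserving.ae
      (collapseOp_ae_eq (isSymbol_symbol hε M i s) i f),
    Lp.coeFn_neg (collisionOp hε M i.swap s (adjOp f)),
    collapseOp_ae_eq (isSymbol_symbol hε M i.swap s) i.swap (adjOp f),
    collapseFun_congr_ae (a := symbol ε M i.swap s) i.swap (adjOp_ae_eq f)] with ζ h1 h2 h3 h4 h5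
  rw [h1, h3, Pi.neg_apply, collisionOp, collisionOp, h2, h4, h5, collapseFun, collapseFun,
    ← integral_conj, ← integral_neg, ← hmp.integral_comp hme]
  refine integral_congr_ae (Eventually.of_forall fun q => ?_)
  have h6 : (-swapPts ζ) i = -ζ i.swap := rfl
  simp only [map_mul]
  rw [h6, conj_symbol_neg_swap hM, collapsePts_neg_swap, neg_mul]

theorem Multiplier.conj_box_neg_swap (n : ℕ) (q : ℝ × ℝ) :
    (starRingEnd ℂ) ((Multiplier.box n).toFun (-q.swap)) = (Multiplier.box n).toFun q := by
  have h : ‖-q.swap‖ = ‖q‖ := by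
    rw [norm_neg, Prod.norm_def, Prod.norm_def, max_comm]
    rfl
  by_cases hq : ‖q‖ ≤ n
  · simp [Multiplier.box, hq, h]
  · simp [Multiplier.box, hq, h]

section limit

variable {ε : ℝ} (hε : 0 < ε) {a b : ℝ}

/-- The curve with a given initial value and derivative. -/
def curve {F : Type} [NormedAddCommGroup F] [NormedSpace ℂ F]
    (x : F × Lp F 1 (timeMeasure a b)) (r : ℝ) : F := x.1 + primitive x.2 r

theorem continuous_curve {F : Type} [NormedAddCommGroup F] [NormedSpace ℂ F]
    (x : F × Lp F 1 (timeMeasure a b)) : Continuous (curve x) :=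
  continuous_const.add (continuous_primitive x.2)

theorem map_curve {F : Type} [NormedAddCommGroup F] [NormedSpace ℂ F] [CompleteSpace F]
    (L : F →L[ℝ] F) {x : F × Lp F 1 (timeMeasure a b)} (h1 : L x.1 = x.1)
    (h2 : ∀ᵐ s ∂(timeMeasure a b), L (x.2 s) = x.2 s) (r : ℝ) : L (curve x r) = curve x r := by
  rw [curve, map_add, h1]
  congr 1
  rw [primitive, ← L.intervalIntegral_comp_comm (intervalIntegrable_coe _ _ _)]
  refine intervalIntegral.integral_congr_ae ?_
  filter_upwards [h2] with s hs _ using hs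

/-- A relation between the cut-off collision terms along the curve is a relation in the space of
sources, passes to the limit there and then holds for almost every time. -/
theorem ae_map_dataLim (hab : b ≤ a + 1) (L : Kernel k →L[ℝ] Kernel k) (c : ℝ) {i i' : Idx k}
    {x : Kernel (k + 1) × Source Kernel a b (k + 1)}
    (h : ∀ n, ∀ r ∈ Set.Ioc a b, L (collisionOp hε.le (Multiplier.box n) i r (curve x r)) =
      c • collisionOp hε.le (Multiplier.box n) i' r (curve x r)) :
    ∀ᵐ r ∂(timeMeasure a b), L (dataLim hε hab i x r) = c • dataLim hε hab i' x r := by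
  have h1 : ∀ n, L.compLpL 1 (timeMeasure a b) (dataOp hε hab (Multiplier.box n) i x) =
      c • dataOp hε hab (Multiplier.box n) i' x := by
    intro n
    refine Lp.ext ?_
    filter_upwards [L.coeFn_compLpL (dataOp hε hab (Multiplier.box n) i x),
      dataOp_ae_eq hε hab (Multiplier.box n) i x, dataOp_ae_eq hε hab (Multiplier.box n) i' x,
      Lp.coeFn_smul c (dataOp hε hab (Multiplier.box n) i' x),
      ae_restrict_mem measurableSet_Ioc] with r h1 h2 h3 h4 hr
    rw [h1, h4, Pi.smul_apply, h2, h3]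
    exact h n r hr
  have h2 : L.compLpL 1 (timeMeasure a b) (dataLim hε hab i x) = c • dataLim hε hab i' x := by
    refine tendsto_nhds_unique (((L.compLpL 1 (timeMeasure a b)).continuous.tendsto _).comp
      (tendsto_dataOp_box hε hab i x)) ?_
    have h3 := (tendsto_dataOp_box hε hab i' x).const_smul c
    exact h3.congr fun n => (h1 n).symm
  filter_upwards [L.coeFn_compLpL (dataLim hε hab i x), Lp.coeFn_smul c (dataLim hε hab i' x)]
    with r h3 h4
  rw [← h3, h2, h4]
  rfl

/-- The right-hand side of the hierarchy for the derivative of a curve. -/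
def collisionSum (hab : b ≤ a + 1) (β : ℂ) (x : Kernel (k + 1) × Source Kernel a b (k + 1)) :
    Source Kernel a b k :=
  β • ∑ i, dataLim hε hab i x

theorem collisionSum_ae_eq (hab : b ≤ a + 1) (β : ℂ)
    (x : Kernel (k + 1) × Source Kernel a b (k + 1)) :
    ∀ᵐ r ∂(timeMeasure a b), collisionSum hε hab β x r = β • ∑ i, dataLim hε hab i x r := by
  rw [collisionSum]
  filter_upwards [Lp.coeFn_smul β (∑ i, dataLim hε hab i x),
    Lp.coeFn_finsetSum Finset.univ fun i => dataLim hε hab i x] with r h1 h2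
  rw [h1, Pi.smul_apply, h2, Finset.sum_apply]

theorem ae_permOp_collisionSum (hab : b ≤ a + 1) (β : ℂ)
    {x : Kernel (k + 1) × Source Kernel a b (k + 1)} (σ τ : Equiv.Perm (Fin k))
    (hx : ∀ r ∈ Set.Ioc a b, permOp (extPerm σ) (extPerm τ) (curve x r) = curve x r) :
    ∀ᵐ r ∂(timeMeasure a b),
      permOp σ τ (collisionSum hε hab β x r) = collisionSum hε hab β x r := by
  have h1 : ∀ i : Idx k, ∀ᵐ r ∂(timeMeasure a b), permOp σ τ (dataLim hε hab i x r) =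
      dataLim hε hab (Sum.map σ τ i) x r := by
    intro i
    have := ae_map_dataLim hε hab ((permOp σ τ).restrictScalars ℝ) 1 (i := i)
      (i' := Sum.map σ τ i) (x := x) (fun n r hr => by
        rw [ContinuousLinearMap.coe_restrictScalars', permOp_collisionOp, hx r hr, one_smul])
    simpa using this
  filter_upwards [collisionSum_ae_eq hε hab β x, ae_all_iff.2 h1] with r h2 h3
  rw [h2, map_smul, map_sum]
  simp only [h3]
  congr 1
  exact Equiv.sum_comp (Equiv.sumCongr σ τ) fun i => dataLim hε hab i x r

theorem adjOp_smul (β : ℂ) (f : Kernel k) : adjOp (β • f) = (starRingEnd ℂ) β • adjOp f := by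
  refine Lp.ext ?_
  filter_upwards [adjOp_ae_eq (β • f), measurePreserving_neg_swap.quasiMeasurePreserving.ae
    (Lp.coeFn_smul β f), adjOp_ae_eq f, Lp.coeFn_smul ((starRingEnd ℂ) β) (adjOp f)]
    with ζ h1 h2 h3 h5
  rw [h1, h2, h5, Pi.smul_apply, Pi.smul_apply, h3, smul_eq_mul, smul_eq_mul, map_mul]

theorem ae_adjOp_dataLim (hab : b ≤ a + 1) {x : Kernel (k + 1) × Source Kernel a b (k + 1)}
    (hx : ∀ r ∈ Set.Ioc a b, adjOp (curve x r) = curve x r) (i : Idx k) :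
    ∀ᵐ r ∂(timeMeasure a b), adjOp (dataLim hε hab i x r) = -dataLim hε hab i.swap x r := by
  have h : ∀ n, ∀ r ∈ Set.Ioc a b, adjOp (collisionOp hε.le (Multiplier.box n) i r (curve x r)) =
      (-1 : ℝ) • collisionOp hε.le (Multiplier.box n) i.swap r (curve x r) := fun n r hr => by
    rw [adjOp_collisionOp hε.le (Multiplier.conj_box_neg_swap n), hx r hr, neg_one_smul]
  filter_upwards [ae_map_dataLim hε hab adjOp (-1) h] with r hr
  rw [hr, neg_one_smul]

theorem ae_adjOp_collisionSum (hab : b ≤ a + 1) {β : ℂ} (hβ : (starRingEnd ℂ) β = -β)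
    {x : Kernel (k + 1) × Source Kernel a b (k + 1)}
    (hx : ∀ r ∈ Set.Ioc a b, adjOp (curve x r) = curve x r) :
    ∀ᵐ r ∂(timeMeasure a b), adjOp (collisionSum hε hab β x r) = collisionSum hε hab β x r := by
  have h1 := ae_all_iff.2 (ae_adjOp_dataLim hε hab hx)
  have h0 : ∀ g : Idx k → Kernel k, ∑ i : Idx k, -g i.swap = -∑ i, g i := fun g => by
    rw [Finset.sum_neg_distrib]
    exact congrArg _ (Equiv.sum_comp (Equiv.sumComm (Fin k) (Fin k)) g)
  filter_upwards [collisionSum_ae_eq hε hab β x, h1] with r h2 h3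
  rw [h2, adjOp_smul, hβ, map_sum, Finset.sum_congr rfl fun i _ => h3 i,
    h0 (fun i => dataLim hε hab i x r), smul_neg, neg_smul, neg_neg]

theorem norm_dataLim_le (hab : b ≤ a + 1) (i : Idx k)
    (x : Kernel (k + 1) × Source Kernel a b (k + 1)) :
    ‖dataLim hε hab i x‖ ≤ timeConst hε a b * (‖x.1‖ + ‖x.2‖) := by
  have h0 : ∀ f : Kernel (k + 1), ∀ n, ‖(Multiplier.box n).mul f‖ₑ ≤ ‖f‖ₑ := fun f n => by
    have := enorm_mul_le (Multiplier.box n) f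
    rwa [show (Multiplier.box n).sup = 1 from rfl, ENNReal.coe_one, one_mul] at this
  refine le_of_tendsto (tendsto_dataOp_box hε hab i x).norm (Eventually.of_forall fun n => ?_)
  have h1 : ‖dataOp hε hab (Multiplier.box n) i x‖ₑ ≤
      timeConst hε a b * (‖x.1‖ₑ + ‖x.2‖ₑ) := by
    refine (enorm_dataOp_le hε hab _ i x).trans (mul_le_mul_right (add_le_add (h0 _ _) ?_) _)
    rw [enorm_eq_lintegral]
    exact lintegral_mono fun s => h0 _ _
  rw [enorm_eq_nnnorm, enorm_eq_nnnorm, enorm_eq_nnnorm] at h1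
  exact_mod_cast h1

end limit

end

/-! ### Picard iterates and uniqueness in the interaction picture. -/

section

variable {k : ℕ} {ε : ℝ} (hε : 0 < ε) {a b : ℝ}

theorem collisionSum_sub (hab : b ≤ a + 1) (β : ℂ)
    (x y : Kernel (k + 1) × Source Kernel a b (k + 1)) :
    collisionSum hε hab β x - collisionSum hε hab β y = collisionSum hε hab β (x - y) := by
  rw [collisionSum, collisionSum, collisionSum, ← smul_sub, ← Finset.sum_sub_distrib]
  simp only [map_sub]

theorem collisionSum_zero_left (hab : b ≤ a + 1) (β : ℂ) (e : Source Kernel a b (k + 1)) :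
    collisionSum hε hab β (0, e) = β • ∑ i, collapseLim hε hab k i e := rfl

/-- The extension of a sequence of sources by zero at `k = 0`. -/
def consZero {A : ℕ → Type} [∀ k, Zero (A k)] (d : ∀ n, A (n + 1)) : ∀ k, A k
  | 0 => 0
  | n + 1 => d n

/-- The iterates of the linear part of the hierarchy. -/
def picard (hab : b ≤ a + 1) (β : ℂ) (d : ∀ n, Source Kernel a b (n + 1)) :
    ℕ → ∀ n, Source Kernel a b (n + 1)
  | 0 => d
  | m + 1 => fun n => collisionSum hε hab β (0, picard hab β d m (n + 1))

theorem picard_succ (hab : b ≤ a + 1) (β : ℂ) (d : ∀ n, Source Kernel a b (n + 1)) (m n : ℕ) :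
    picard hε hab β d (m + 1) n = collisionSum hε hab β (0, picard hε hab β d m (n + 1)) := rfl

/-- The hierarchy starts at `k = 1` whereas `iterSum` is indexed from `0`. Each level depends only
on higher ones, so the artificial zero entry never enters. -/
theorem picard_eq_smul_iterSum (hab : b ≤ a + 1) (β : ℂ) (d : ∀ n, Source Kernel a b (n + 1))
    (m : ℕ) : ∀ n, picard hε hab β d m n =
      β ^ m • iterSum (collapseLim hε hab) (consZero d) m (n + 1) := by
  induction m with
  | zero => intro n; simp [iterSum, consZero, picard]
  | succ m ih =>
    intro n
    have h1 : iterSum (collapseLim hε hab) (consZero d) (m + 1) (n + 1) =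
      ∑ i, collapseLim hε hab (n + 1) i (iterSum (collapseLim hε hab) (consZero d) m (n + 1 + 1)) :=
      rfl
    have h2 : ∀ i, collapseLim hε hab (n + 1) i (picard hε hab β d m (n + 1)) =
        β ^ m • collapseLim hε hab (n + 1) i
          (iterSum (collapseLim hε hab) (consZero d) m (n + 1 + 1)) := fun i =>
      (congrArg (collapseLim hε hab (n + 1) i) (ih (n + 1))).trans (map_smul _ _ _)
    rw [picard_succ, collisionSum_zero_left, h1, pow_succ', mul_smul,
      Finset.sum_congr rfl fun i _ => h2 i, ← Finset.smul_sum]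

theorem norm_picard_le (hab : b ≤ a + 1) (β : ℂ) {d : ∀ n, Source Kernel a b (n + 1)}
    (hs : ∀ n σ τ, ∀ᵐ s ∂(timeMeasure a b), permOp σ τ (d n s) = d n s) (m n : ℕ) :
    ‖picard hε hab β d m n‖ ≤
      8 ^ (n + 1) * (8 * ‖β‖ * timeConst hε a b) ^ m * ‖d (n + m)‖ := by
  have hs' : ∀ k σ τ, ∀ᵐ s ∂(timeMeasure a b), permOp σ τ (consZero (A := Source Kernel a b) d k s) =
      consZero (A := Source Kernel a b) d k s := by
    intro k σ τ
    cases k with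
    | zero =>
      have h0 : (consZero (A := Source Kernel a b) d 0) = 0 := rfl
      rw [h0]
      filter_upwards [Lp.coeFn_zero (Kernel 0) 1 (timeMeasure a b)] with s h
      rw [h, Pi.zero_apply, map_zero]
    | succ n => exact hs n σ τ
  have h2 : ‖consZero (A := Source Kernel a b) d (n + 1 + m)‖ = ‖d (n + m)‖ := by
    rw [Nat.add_right_comm]
    rfl
  rw [picard_eq_smul_iterSum, norm_smul, norm_pow, ← h2]
  refine (mul_le_mul_of_nonneg_left (norm_iterSum_collapseLim_le hε hab hs' m (n + 1))
    (by positivity)).trans (le_of_eq ?_)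
  simp only [mul_pow]
  ring

/-- The hierarchy with vanishing data has only the trivial solution on short time intervals. -/
theorem eq_zero_of_hierarchy (hab : b ≤ a + 1) {β : ℂ} {d : ∀ n, Source Kernel a b (n + 1)}
    (hd : ∀ n, d n = collisionSum hε hab β (0, d (n + 1)))
    (hs : ∀ n σ τ, ∀ᵐ s ∂(timeMeasure a b), permOp σ τ (d n s) = d n s) {C ξ : ℝ} (hξ : 0 < ξ)
    (hb : ∀ n, ‖d n‖ ≤ C * ξ⁻¹ ^ n) (hsmall : 8 * ‖β‖ * timeConst hε a b < ξ) (n : ℕ) :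
    d n = 0 := by
  -- A homogeneous solution is its own `m`-th iterate for every `m`, so the bound on the iterates
  -- forces it below every multiple of `q^m`.
  have hp : ∀ m n, picard hε hab β d m n = d n := by
    intro m
    induction m with
    | zero => exact fun _ => rfl
    | succ m ih =>
      intro n
      rw [picard_succ, ih, ← hd]
  set q : ℝ := 8 * ‖β‖ * timeConst hε a b / ξ with hq
  have hq0 : 0 ≤ q := by positivity
  have hq1 : q < 1 := (div_lt_one hξ).2 hsmall
  have h1 : ∀ m, ‖d n‖ ≤ 8 ^ (n + 1) * C * ξ⁻¹ ^ n * q ^ m := by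
    intro m
    have h2 := norm_picard_le hε hab β hs m n
    rw [hp] at h2
    refine (h2.trans (mul_le_mul_of_nonneg_left (hb _) (by positivity))).trans (le_of_eq ?_)
    rw [hq, div_eq_mul_inv, pow_add]
    simp only [mul_pow]
    ring
  have h3 := (tendsto_pow_atTop_nhds_zero_of_lt_one hq0 hq1).const_mul (8 ^ (n + 1) * C * ξ⁻¹ ^ n)
  rw [mul_zero] at h3
  exact norm_le_zero_iff.1 (ge_of_tendsto' h3 h1)

/-- Solutions of the hierarchy in the interaction picture, with the weights removed: `g n` is a
curve of kernels of `n + 1` particles with derivative `E n`. -/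
structure IsMild (β : ℂ) (T ξ : ℝ) (g E : ∀ n, ℝ → Kernel (n + 1)) : Prop where
  integrable : ∀ n, IntegrableOn (E n) (Set.Ioc 0 T)
  eq_add : ∀ n, ∀ t ∈ Set.Icc 0 T, g n t = g n 0 + ∫ s in Set.Ioc 0 t, E n s
  symm : ∀ n σ τ, ∀ t ∈ Set.Icc 0 T, permOp σ τ (g n t) = g n t
  bound : ∃ C : ℝ, ∀ n, ∫ s in Set.Ioc 0 T, ‖E n s‖ ≤ C * ξ⁻¹ ^ n
  -- The equation is required on all subintervals of length at most one, where the limiting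
  -- collision operator is defined, restarted from the value at the left endpoint.
  hierarchy : ∀ a b, 0 ≤ a → b ≤ T → ∀ (hab : b ≤ a + 1) (e : ∀ n, Source Kernel a b (n + 1)),
    (∀ n, e n =ᵐ[timeMeasure a b] E n) →
      ∀ n, e n = collisionSum hε hab β (g (n + 1) a, e (n + 1))

section mild

variable {β : ℂ} {T : ℝ}

theorem curve_eq {g E : ∀ n, ℝ → Kernel (n + 1)}
    (hE : ∀ n, IntegrableOn (E n) (Set.Ioc 0 T))
    (hg : ∀ n, ∀ t ∈ Set.Icc 0 T, g n t = g n 0 + ∫ s in Set.Ioc 0 t, E n s)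
    (ha : 0 ≤ a) (hb : b ≤ T) {n : ℕ} {e : Source Kernel a b (n + 1)}
    (he : e =ᵐ[timeMeasure a b] E n) {r : ℝ} (hr : r ∈ Set.Icc a b) :
    curve (g n a, e) r = g n r := by
  have h1 : ∫ s in Set.Ioc a r, e s = ∫ s in Set.Ioc a r, E n s :=
    integral_congr_ae (ae_restrict_of_ae_restrict_of_subset (Set.Ioc_subset_Ioc_right hr.2) he)
  have h2 : ∫ s in Set.Ioc 0 r, E n s = (∫ s in Set.Ioc 0 a, E n s) + ∫ s in Set.Ioc a r, E n s := by
    rw [← Set.Ioc_union_Ioc_eq_Ioc ha hr.1]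
    refine setIntegral_union (Set.Ioc_disjoint_Ioc_of_le le_rfl) measurableSet_Ioc
      ((hE n).mono_set (Set.Ioc_subset_Ioc_right (hr.1.trans (hr.2.trans hb))))
      ((hE n).mono_set (Set.Ioc_subset_Ioc ha (hr.2.trans hb)))
  have h3 : primitive e r = ∫ s in Set.Ioc a r, E n s :=
    (CollisionFamily.primitive_eq_setIntegral e hr).trans h1
  change g n a + primitive e r = g n r
  rw [h3, hg n a ⟨ha, hr.1.trans (hr.2.trans hb)⟩,
    hg n r ⟨ha.trans hr.1, hr.2.trans hb⟩, h2, add_assoc]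

theorem norm_source_le {E : ℝ → Kernel k} (hE : IntegrableOn E (Set.Ioc 0 T))
    (ha : 0 ≤ a) (hb : b ≤ T) {e : Source Kernel a b k} (he : e =ᵐ[timeMeasure a b] E) :
    ‖e‖ ≤ ∫ s in Set.Ioc 0 T, ‖E s‖ := by
  rw [L1.norm_eq_integral_norm, integral_congr_ae (he.mono fun s hs => congrArg norm hs)]
  exact setIntegral_mono_set hE.norm (Eventually.of_forall fun _ => norm_nonneg _)
    (Set.Ioc_subset_Ioc ha hb).eventuallyLE

variable {hε}

theorem IsMild.ae_symm {ξ : ℝ} {g E : ∀ n, ℝ → Kernel (n + 1)} (h : IsMild hε β T ξ g E)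
    (ha : 0 ≤ a) (hb : b ≤ T) (hab : b ≤ a + 1) {e : ∀ n, Source Kernel a b (n + 1)}
    (he : ∀ n, e n =ᵐ[timeMeasure a b] E n) (n : ℕ) (σ τ : Equiv.Perm (Fin (n + 1))) :
    ∀ᵐ s ∂(timeMeasure a b), permOp σ τ (e n s) = e n s := by
  rw [h.hierarchy a b ha hb hab e he n]
  refine ae_permOp_collisionSum hε hab β σ τ fun r hr => ?_
  rw [curve_eq h.integrable h.eq_add ha hb (he (n + 1)) ⟨hr.1.le, hr.2⟩]
  exact h.symm _ _ _ _ ⟨ha.trans hr.1.le, hr.2.trans hb⟩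

/-- The difference of the derivatives solves the hierarchy with zero data and grows at most
geometrically in `n`. The two solutions may belong to different spaces, so the rate is governed by
the smaller of `ξ` and `ξ'`. -/
theorem IsMild.eq_on_step {ξ ξ' : ℝ} (hξ : 0 < ξ) (hξ' : 0 < ξ')
    {g E g' E' : ∀ n, ℝ → Kernel (n + 1)} (h : IsMild hε β T ξ g E) (h' : IsMild hε β T ξ' g' E')
    (ha : 0 ≤ a) (hb : b ≤ T) (hle : a ≤ b) (hab : b ≤ a + 1)
    (hsmall : 8 * ‖β‖ * timeConst hε a b < min ξ ξ') (h0 : ∀ n, g n a = g' n a) (n : ℕ) :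
    g n b = g' n b := by
  have hi : ∀ n, Integrable (E n) (timeMeasure a b) := fun n =>
    (h.integrable n).mono_set (Set.Ioc_subset_Ioc ha hb)
  have hi' : ∀ n, Integrable (E' n) (timeMeasure a b) := fun n =>
    (h'.integrable n).mono_set (Set.Ioc_subset_Ioc ha hb)
  let e : ∀ n, Source Kernel a b (n + 1) := fun n => (hi n).toL1
  let e' : ∀ n, Source Kernel a b (n + 1) := fun n => (hi' n).toL1
  have he : ∀ n, e n =ᵐ[timeMeasure a b] E n := fun n => (hi n).coeFn_toL1
  have he' : ∀ n, e' n =ᵐ[timeMeasure a b] E' n := fun n => (hi' n).coeFn_toL1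
  obtain ⟨C, hC⟩ := h.bound
  obtain ⟨C', hC'⟩ := h'.bound
  have hm : 0 < min ξ ξ' := lt_min hξ hξ'
  have hC0 : 0 ≤ C := by
    have := (integral_nonneg fun s => norm_nonneg (E 0 s)).trans (hC 0)
    simpa using this
  have hC0' : 0 ≤ C' := by
    have := (integral_nonneg fun s => norm_nonneg (E' 0 s)).trans (hC' 0)
    simpa using this
  have key : ∀ n, e n - e' n = 0 := by
    refine eq_zero_of_hierarchy hε hab (β := β) (C := C + C') (ξ := min ξ ξ') (fun n => ?_)
      (fun n σ τ => ?_) hm (fun n => ?_) hsmall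
    · rw [h.hierarchy a b ha hb hab e he n, h'.hierarchy a b ha hb hab e' he' n, collisionSum_sub,
        h0, Prod.mk_sub_mk, sub_self]
    · filter_upwards [h.ae_symm ha hb hab he n σ τ, h'.ae_symm ha hb hab he' n σ τ,
        Lp.coeFn_sub (e n) (e' n)] with s h1 h2 h3
      rw [h3, Pi.sub_apply, map_sub, h1, h2]
    · have h1 := (norm_source_le (h.integrable n) ha hb (he n)).trans (hC n)
      have h2 := (norm_source_le (h'.integrable n) ha hb (he' n)).trans (hC' n)
      have h3 : ξ⁻¹ ^ n ≤ (min ξ ξ')⁻¹ ^ n := by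
        gcongr
        exact min_le_left _ _
      have h4 : ξ'⁻¹ ^ n ≤ (min ξ ξ')⁻¹ ^ n := by
        gcongr
        exact min_le_right _ _
      calc _ ≤ ‖e n‖ + ‖e' n‖ := norm_sub_le _ _
        _ ≤ C * (min ξ ξ')⁻¹ ^ n + C' * (min ξ ξ')⁻¹ ^ n :=
            add_le_add (h1.trans (by gcongr)) (h2.trans (by gcongr))
        _ = _ := by ring
  rw [← curve_eq h.integrable h.eq_add ha hb (he n) ⟨hle, le_rfl⟩,
    ← curve_eq h'.integrable h'.eq_add ha hb (he' n) ⟨hle, le_rfl⟩, sub_eq_zero.1 (key n), h0]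

theorem tendsto_timeConst : Tendsto (fun τ : ℝ => (timeConst hε 0 τ : ℝ)) (𝓝[>] 0) (𝓝 0) := by
  have h : Continuous fun τ : ℝ => (timeConst hε 0 τ : ℝ) := by
    unfold timeConst
    push_cast
    fun_prop
  have h1 := (h.tendsto 0).mono_left (nhdsWithin_le_nhds (s := Set.Ioi 0))
  simpa [timeConst] using h1

theorem exists_timeConst_lt (β : ℂ) {η : ℝ} (hη : 0 < η) :
    ∃ τ : ℝ, 0 < τ ∧ τ ≤ 1 ∧ 8 * ‖β‖ * timeConst hε 0 τ < η := by
  have h := (tendsto_timeConst (hε := hε)).const_mul (8 * ‖β‖)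
  rw [mul_zero] at h
  have h2 : ∀ᶠ τ : ℝ in 𝓝[>] 0, τ ∈ Set.Ioc (0 : ℝ) 1 := Ioc_mem_nhdsGT one_pos
  obtain ⟨τ, h3, h4⟩ := ((h.eventually_lt_const hη).and h2).exists
  exact ⟨τ, h4.1, h4.2, h3⟩

theorem timeConst_mono {a b τ : ℝ} (h : b - a ≤ τ) : timeConst hε a b ≤ timeConst hε 0 τ := by
  unfold timeConst
  have h1 : b - a ≤ τ - 0 := by rwa [sub_zero]
  exact mul_le_mul_right (NNReal.sqrt_le_sqrt.2 (Real.toNNReal_le_toNNReal h1)) _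

/-- The admissible step length depends only on `β`, `ξ`, `ξ'` and the collapse constant, so finitely
many equal steps reach any `t`. -/
theorem IsMild.eq {ξ ξ' : ℝ} (hξ : 0 < ξ) (hξ' : 0 < ξ')
    {g E g' E' : ∀ n, ℝ → Kernel (n + 1)} (h : IsMild hε β T ξ g E) (h' : IsMild hε β T ξ' g' E')
    (h0 : ∀ n, g n 0 = g' n 0) {t : ℝ} (ht : t ∈ Set.Icc 0 T) (n : ℕ) : g n t = g' n t := by
  obtain ⟨τ, hτ, hτ1, hs⟩ := exists_timeConst_lt (hε := hε) β (lt_min hξ hξ')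
  have key : ∀ m : ℕ, ∀ t ∈ Set.Icc 0 T, t ≤ m * τ → ∀ n, g n t = g' n t := by
    intro m
    induction m with
    | zero =>
      intro t ht h1 n
      rw [Nat.cast_zero, zero_mul] at h1
      rw [le_antisymm h1 ht.1, h0]
    | succ m ih =>
      intro t ht h1 n
      by_cases h2 : t ≤ m * τ
      · exact ih t ht h2 n
      · rw [not_le] at h2
        push_cast at h1
        have hm : (m : ℝ) * τ ∈ Set.Icc 0 T := ⟨by positivity, h2.le.trans ht.2⟩
        refine h.eq_on_step hξ hξ' h' hm.1 ht.2 h2.le (by linarith) ?_ (ih _ hm le_rfl) n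
        refine lt_of_le_of_lt ?_ hs
        have : (timeConst hε (m * τ) t : ℝ) ≤ timeConst hε 0 τ := by
          exact_mod_cast timeConst_mono (by linarith)
        gcongr
  obtain ⟨m, hm⟩ := exists_nat_ge (t / τ)
  exact key m t ht ((div_le_iff₀ hτ).1 hm) n

end mild

end

/-! ### Measurability of the weighted transform; identification of the collision term. -/

section

variable {k : ℕ}

section analyze

instance : SecondCountableTopology (Kernel k) :=
  haveI : Fact ((2 : ℝ≥0∞) ≠ ∞) := ⟨ENNReal.ofNat_ne_top⟩
  Lp.SecondCountableTopology

instance : PolishSpace (Kernel k) := inferInstance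

variable {ε : ℝ}

/-- The weighted Fourier transform, with value zero if it is not square integrable. -/
def analyze (hε : 0 ≤ ε) : Kernel k → Kernel k := Function.extend (synth hε) id 0

theorem analyze_synth (hε : 0 ≤ ε) (g : Kernel k) : analyze hε (synth hε g) = g :=
  (synth_injective hε).extend_apply _ _ _

theorem synth_analyze (hε : 0 ≤ ε) {γ : Kernel k} (h : sobolevNorm ε γ < ∞) : synth hε (analyze hε γ) = γ := by
  obtain ⟨g, rfl⟩ := exists_synth_eq hε h
  rw [analyze_synth]

theorem enorm_analyze (hε : 0 ≤ ε) {γ : Kernel k} (h : sobolevNorm ε γ < ∞) :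
    ‖analyze hε γ‖ₑ = sobolevNorm ε γ := by
  rw [← sobolevNorm_synth hε, synth_analyze hε h]

/-- By the Lusin–Souslin theorem a continuous injection between Polish spaces has a measurable
inverse on its Borel range. Collision terms are given only as measurable curves in the unweighted
space and have to be pulled back. -/
theorem measurableEmbedding_synth (hε : 0 ≤ ε) :
    @MeasurableEmbedding _ _ (borel (Kernel k)) (borel (Kernel k)) (synth hε) := by
  let _ : MeasurableSpace (Kernel k) := borel _
  have _ : BorelSpace (Kernel k) := ⟨rfl⟩
  have h : Continuous (synth hε : Kernel k → Kernel k) := (synth hε).continuous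
  exact h.measurableEmbedding (synth_injective hε)

theorem measurable_analyze (hε : 0 ≤ ε) : Measurable[borel (Kernel k), borel (Kernel k)] (analyze hε) := by
  let _ : MeasurableSpace (Kernel k) := borel _
  have _ : BorelSpace (Kernel k) := ⟨rfl⟩
  exact (measurableEmbedding_synth hε).measurable_extend measurable_id measurable_const

theorem measurable_sobolevNorm (hε : 0 ≤ ε) : Measurable[borel (Kernel k)] (sobolevNorm ε) := by
  let _ : MeasurableSpace (Kernel k) := borel _
  have _ : BorelSpace (Kernel k) := ⟨rfl⟩
  have h1 : MeasurableSet (Set.range (synth hε : Kernel k → Kernel k)) :=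
    (measurableEmbedding_synth hε).measurableSet_range
  classical
  have h2 : sobolevNorm ε = (Set.range (synth hε : Kernel k → Kernel k)).piecewise
      (fun γ => ‖analyze hε γ‖ₑ) (fun _ => ∞) := by
    ext γ
    by_cases h : γ ∈ Set.range (synth hε : Kernel k → Kernel k)
    · rw [Set.piecewise_eq_of_mem _ _ _ h]
      obtain ⟨g, rfl⟩ := h
      rw [analyze_synth, sobolevNorm_synth]
    · rw [Set.piecewise_eq_of_notMem _ _ _ h]
      by_contra h'
      exact h (exists_synth_eq hε (lt_top_iff_ne_top.2 h'))
  rw [h2]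
  exact Measurable.piecewise h1 (measurable_analyze hε).enorm measurable_const

theorem aestronglyMeasurable_analyze (hε : 0 ≤ ε) {μ : Measure ℝ} {F : ℝ → Kernel k}
    (hF : AEStronglyMeasurable F μ) : AEStronglyMeasurable (fun t => analyze hε (F t)) μ := by
  let _ : MeasurableSpace (Kernel k) := borel _
  have _ : BorelSpace (Kernel k) := ⟨rfl⟩
  exact ((measurable_analyze hε).comp_aemeasurable hF.aemeasurable).aestronglyMeasurable

theorem ae_sobolevNorm_lt_top (hε : 0 ≤ ε) {μ : Measure ℝ} {F : ℝ → Kernel k}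
    (hF : AEStronglyMeasurable F μ) (h : ∫⁻ t, sobolevNorm ε (F t) ∂μ < ∞) :
    ∀ᵐ t ∂μ, sobolevNorm ε (F t) < ∞ := by
  let _ : MeasurableSpace (Kernel k) := borel _
  have _ : BorelSpace (Kernel k) := ⟨rfl⟩
  exact ae_lt_top' ((measurable_sobolevNorm hε).comp_aemeasurable hF.aemeasurable) h.ne

end analyze

theorem exists_isProfile : ∃ ρ : ℝ → ℝ, IsProfile ρ := by
  let f : ContDiffBump (0 : ℝ) := ⟨1, 2, one_pos, one_lt_two⟩
  exact ⟨f.normed volume, f.contDiff_normed, f.hasCompactSupport_normed, f.integral_normed⟩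

/-- A measurable curve of kernels vanishes if it vanishes when tested against Schwartz functions. -/
theorem ae_eq_zero_of_forall_schwartz {μ : Measure ℝ} {H : ℝ → Kernel k}
    (h : ∀ Φ : 𝓢(Pts k, ℂ), ∀ᵐ t ∂μ, testOp Φ (Φ.memLp 2 volume) (H t) = 0) : H =ᵐ[μ] 0 := by
  have h1 : ∀ c : Kernel k, ∀ᵐ t ∂μ, inner ℂ (conjOp c) (H t) = 0 := by
    intro c
    refine kernel_induction (p := fun c => ∀ᵐ t ∂μ, inner ℂ (conjOp c) (H t) = 0) c ?_ h
    -- The exceptional null set depends on the test function; sequences involve only countably many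
    -- such sets, so the property is closed.
    refine IsSeqClosed.isClosed fun u c hu hc => ?_
    filter_upwards [ae_all_iff.2 hu] with t ht
    have h2 : Tendsto (fun n => inner ℂ (conjOp (u n)) (H t)) atTop
        (𝓝 (inner ℂ (conjOp c) (H t))) :=
      ((conjOp.continuous.tendsto c).comp hc).inner tendsto_const_nhds
    simp only [ht] at h2
    exact tendsto_nhds_unique h2 tendsto_const_nhds
  refine ae_eq_zero_of_forall_inner (𝕜 := ℂ) fun c => ?_
  have h2 : conjOp (conjOp c) = c := by
    refine Lp.ext ?_
    filter_upwards [conjOp_ae_eq (conjOp c), conjOp_ae_eq c] with z h3 h4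
    rw [h3, h4, Complex.conj_conj]
  have h3 := h1 (conjOp c)
  rw [h2] at h3
  exact h3

section collision

variable {ε : ℝ} (hε : 0 < ε) {a b : ℝ}

/-- The collision term of a curve, in terms of its weighted Fourier transform. -/
def collisionTerm (hab : b ≤ a + 1) (j : Fin k) (x : Kernel (k + 1) × Source Kernel a b (k + 1))
    (r : ℝ) : Kernel k :=
  flow r (dataLim hε hab (Sum.inl j) x r + dataLim hε hab (Sum.inr j) x r)

theorem aestronglyMeasurable_flow {μ : Measure ℝ} {f : ℝ → Kernel k}
    (hf : AEStronglyMeasurable f μ) : AEStronglyMeasurable (fun r => flow r (f r)) μ :=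
by
  have h : AEStronglyMeasurable (fun r : ℝ => (r, f r)) μ :=
    aestronglyMeasurable_id.prodMk hf
  have h2 := continuous_flow.comp_aestronglyMeasurable h
  exact h2

theorem aestronglyMeasurable_collisionTerm (hab : b ≤ a + 1) (j : Fin k)
    (x : Kernel (k + 1) × Source Kernel a b (k + 1)) :
    AEStronglyMeasurable (collisionTerm hε hab j x) (timeMeasure a b) :=
  aestronglyMeasurable_flow ((Lp.aestronglyMeasurable _).add (Lp.aestronglyMeasurable _))

variable {ρ : ℝ → ℝ} (Φ : 𝓢(Pts k, ℂ))

theorem collisionPairing_ae_eq (hρ : IsProfile ρ) (hab : b ≤ a + 1) (j : Fin k)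
    (x : Kernel (k + 1) × Source Kernel a b (k + 1)) (α : ℝ) :
    (fun r => collisionPairing ρ α j (synth hε.le (flow r (curve x r))) Φ) =ᵐ[timeMeasure a b]
      fun r => testOp Φ (Φ.memLp 2 volume) (synth hε.le (flow r
        (dataOp hε hab (mollifier hρ α) (Sum.inl j) x r +
          dataOp hε hab (mollifier hρ α) (Sum.inr j) x r))) := by
  filter_upwards [dataOp_ae_eq hε hab (mollifier hρ α) (Sum.inl j) x,
    dataOp_ae_eq hε hab (mollifier hρ α) (Sum.inr j) x] with r h1 h2
  rw [collisionPairing_synth hρ, h1, h2]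
  rfl

theorem aestronglyMeasurable_collisionPairing (hρ : IsProfile ρ) (hab : b ≤ a + 1) (j : Fin k)
    (x : Kernel (k + 1) × Source Kernel a b (k + 1)) (α : ℝ) :
    AEStronglyMeasurable (fun r => collisionPairing ρ α j (synth hε.le (flow r (curve x r))) Φ)
      (timeMeasure a b) := by
  refine AEStronglyMeasurable.congr ?_ (collisionPairing_ae_eq hε Φ hρ hab j x α).symm
  exact ((testOp Φ (Φ.memLp 2 volume)).continuous.comp (synth hε.le).continuous)
    |>.comp_aestronglyMeasurable (aestronglyMeasurable_flow
      ((Lp.aestronglyMeasurable _).add (Lp.aestronglyMeasurable _)))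

/-- The pairing is a bounded functional of the mollified collision terms, uniformly in time because
the flow is isometric, and these converge as sources. -/
theorem tendsto_collisionPairing (hρ : IsProfile ρ) (hab : b ≤ a + 1) (j : Fin k)
    (x : Kernel (k + 1) × Source Kernel a b (k + 1)) :
    Tendsto (fun α => ∫⁻ r in Set.Ioc a b,
      ‖collisionPairing ρ α j (synth hε.le (flow r (curve x r))) Φ -
        testOp Φ (Φ.memLp 2 volume) (synth hε.le (collisionTerm hε hab j x r))‖ₑ)
      (𝓝[>] 0) (𝓝 0) := by
  set L : Kernel k →L[ℂ] ℂ := (testOp Φ (Φ.memLp 2 volume)).comp (synth hε.le) with hL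
  have hlim : ∀ i : Idx k, Tendsto (fun α => ‖dataOp hε hab (mollifier hρ α) i x -
      dataLim hε hab i x‖ₑ) (𝓝[>] 0) (𝓝 0) := by
    intro i
    have := ((tendsto_dataOp hε (isApprox_mollifier hρ) hab i x).sub_const
      (dataLim hε hab i x)).enorm
    rwa [sub_self, enorm_zero] at this
  have hlim2 : Tendsto (fun α => ‖L‖ₑ * (‖dataOp hε hab (mollifier hρ α) (Sum.inl j) x -
      dataLim hε hab (Sum.inl j) x‖ₑ + ‖dataOp hε hab (mollifier hρ α) (Sum.inr j) x -
      dataLim hε hab (Sum.inr j) x‖ₑ)) (𝓝[>] 0) (𝓝 0) := by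
    have := ENNReal.Tendsto.const_mul ((hlim (Sum.inl j)).add (hlim (Sum.inr j)))
      (Or.inr (enorm_ne_top (x := L)))
    simpa using this
  refine tendsto_of_tendsto_of_tendsto_of_le_of_le tendsto_const_nhds hlim2 (fun _ => zero_le)
    fun α => ?_
  dsimp only
  rw [enorm_eq_lintegral, enorm_eq_lintegral, ← lintegral_add_left
    (Lp.stronglyMeasurable _).enorm, ← lintegral_const_mul' _ _ enorm_ne_top]
  refine lintegral_mono_ae ?_
  filter_upwards [collisionPairing_ae_eq hε Φ hρ hab j x α,
    Lp.coeFn_sub (dataOp hε hab (mollifier hρ α) (Sum.inl j) x) (dataLim hε hab (Sum.inl j) x),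
    Lp.coeFn_sub (dataOp hε hab (mollifier hρ α) (Sum.inr j) x) (dataLim hε hab (Sum.inr j) x)]
    with r h1 h2 h3
  have h4 : ∀ u v u' v' : Kernel k, ‖L (flow r (u + v)) - L (flow r (u' + v'))‖ₑ ≤
      ‖L‖ₑ * (‖u - u'‖ₑ + ‖v - v'‖ₑ) := by
    intro u v u' v'
    rw [← map_sub, ← map_sub, add_sub_add_comm]
    refine (L.le_opENorm _).trans (mul_le_mul_right ?_ _)
    rw [← ofReal_norm, norm_flow, ofReal_norm]
    exact enorm_add_le _ _
  rw [h1, h2, h3]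
  exact h4 _ _ _ _

/-- Limits in `L¹` are unique, and Schwartz functions separate points, so any collision term
admitted by the definition is the one constructed through multipliers. One profile is enough. -/
theorem ae_eq_collisionTerm {T : ℝ} (ha : 0 ≤ a) (hb : b ≤ T) (hab : b ≤ a + 1) {j : Fin k}
    {x : Kernel (k + 1) × Source Kernel a b (k + 1)} {γ : ℝ → Kernel (k + 1)} {F : ℝ → Kernel k}
    (hγ : ∀ r ∈ Set.Ioc a b, γ r = synth hε.le (flow r (curve x r)))
    (hF : AEStronglyMeasurable F (volume.restrict (Set.Icc 0 T))) (h : IsCollision T j γ F) :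
    ∀ᵐ r ∂(timeMeasure a b), F r = synth hε.le (collisionTerm hε hab j x r) := by
  obtain ⟨ρ, hρ⟩ := exists_isProfile
  have key : (fun r => F r - synth hε.le (collisionTerm hε hab j x r)) =ᵐ[timeMeasure a b] 0 := by
    refine ae_eq_zero_of_forall_schwartz fun Φ => ?_
    set p : ℝ → ℝ → ℂ := fun α r => collisionPairing ρ α j (synth hε.le (flow r (curve x r))) Φ
    set u : ℝ → ℂ := fun r => testOp Φ (Φ.memLp 2 volume) (F r)
    set v : ℝ → ℂ := fun r =>
      testOp Φ (Φ.memLp 2 volume) (synth hε.le (collisionTerm hε hab j x r))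
    have hp : ∀ α, AEStronglyMeasurable (p α) (timeMeasure a b) :=
      aestronglyMeasurable_collisionPairing hε Φ hρ hab j x
    have hv : AEStronglyMeasurable v (timeMeasure a b) :=
      ((testOp Φ (Φ.memLp 2 volume)).continuous.comp (synth hε.le).continuous)
        |>.comp_aestronglyMeasurable (aestronglyMeasurable_collisionTerm hε hab j x)
    have h1 : Tendsto (fun α => ∫⁻ r in Set.Ioc a b, ‖p α r - u r‖ₑ) (𝓝[>] 0) (𝓝 0) := by
      refine tendsto_of_tendsto_of_tendsto_of_le_of_le tendsto_const_nhds (h ρ hρ Φ)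
        (fun _ => zero_le) fun α => ?_
      refine le_trans ?_ (lintegral_mono_set
        (fun r hr => ⟨ha.trans hr.1.le, hr.2.trans hb⟩ : Set.Ioc a b ⊆ Set.Icc 0 T))
      refine setLIntegral_mono' measurableSet_Ioc fun r hr => ?_
      rw [hγ r hr, ← testOp_apply (Φ.memLp 2 volume)]
    have h2 : Tendsto (fun α => ∫⁻ r in Set.Ioc a b, ‖p α r - v r‖ₑ) (𝓝[>] 0) (𝓝 0) :=
      tendsto_collisionPairing hε Φ hρ hab j x
    have h3 := h1.add h2
    rw [add_zero] at h3
    have h4 : ∫⁻ r in Set.Ioc a b, ‖u r - v r‖ₑ = 0 := by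
      refine le_antisymm (ge_of_tendsto' h3 fun α => ?_) zero_le
      have h5 : AEMeasurable (fun r => ‖p α r - v r‖ₑ) (timeMeasure a b) := ((hp α).sub hv).enorm
      rw [← lintegral_add_right' _ h5]
      refine lintegral_mono fun r => ?_
      rw [← edist_eq_enorm_sub, ← edist_eq_enorm_sub, ← edist_eq_enorm_sub]
      rw [edist_comm (p α r) (u r)]
      exact edist_triangle _ _ _
    have hsub : Set.Ioc a b ⊆ Set.Icc 0 T := fun r hr => ⟨ha.trans hr.1.le, hr.2.trans hb⟩
    have h5 : AEStronglyMeasurable u (timeMeasure a b) := 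
      (testOp Φ (Φ.memLp 2 volume)).continuous.comp_aestronglyMeasurable (hF.mono_measure
        (Measure.restrict_mono hsub le_rfl))
    have h6 := (lintegral_eq_zero_iff' (h5.sub hv).enorm).1 h4
    filter_upwards [h6] with r hr
    rw [map_sub]
    exact enorm_eq_zero.1 hr
  filter_upwards [key] with r hr
  exact sub_eq_zero.1 hr

end collision

end

/-! ### Passage from solutions to the interaction picture. -/

section

variable {k : ℕ}

theorem integrable_flow_neg {μ : Measure ℝ} {f : ℝ → Kernel k} (hf : Integrable f μ) :
    Integrable (fun s => flow (-s) (f s)) μ := by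
  have h : AEStronglyMeasurable (fun s : ℝ => (-s, f s)) μ :=
    (continuous_neg.aestronglyMeasurable).prodMk hf.1
  have h2 := (continuous_flow (k := k)).comp_aestronglyMeasurable h
  have h3 : ∀ᵐ s ∂μ, ‖f s‖ = ‖flow (-s) (f s)‖ := Eventually.of_forall fun s => (norm_flow _ _).symm
  exact hf.congr' h2 h3

theorem flow_injective (t : ℝ) : Function.Injective (flow t : Kernel k → Kernel k) := by
  intro f g h
  have h2 := congrArg (flow (-t)) h
  rwa [flow_flow, flow_flow, neg_add_cancel, flow_zero, flow_zero] at h2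

theorem synth_flow_integral {ε : ℝ} (hε : 0 ≤ ε) (t : ℝ) {S : Set ℝ} {G : ℝ → Kernel k}
    (hG : IntegrableOn G S) :
    synth hε (flow t (∫ s in S, flow (-s) (G s))) =
      ∫ s in S, freeEvolution (t - s) (synth hε (G s)) := by
  have h := ((synth hε).comp (flow t)).integral_comp_comm (integrable_flow_neg hG)
  refine h.symm.trans (integral_congr_ae (Eventually.of_forall fun s => ?_))
  change synth hε (flow t (flow (-s) (G s))) = freeEvolution (t - s) (synth hε (G s))
  rw [freeEvolution_synth, flow_flow, sub_eq_add_neg]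

theorem sum_idx {A : Type*} [AddCommMonoid A] (f : Idx k → A) :
    ∑ i, f i = ∑ j, (f (Sum.inl j) + f (Sum.inr j)) := by
  rw [Fintype.sum_sum_type, Finset.sum_add_distrib]

section solution

variable {ε : ℝ} (hε : 0 < ε) {b₀ T ξ : ℝ}

/-- The derivative in the interaction picture of a solution with collision terms `synth (G j)`. -/
def derivTerm (β : ℂ) (G : Fin k → ℝ → Kernel k) (s : ℝ) : Kernel k :=
  β • ∑ j, flow (-s) (G j s)

theorem integrable_derivTerm {μ : Measure ℝ} (β : ℂ) {G : Fin k → ℝ → Kernel k}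
    (hG : ∀ j, Integrable (G j) μ) : Integrable (derivTerm β G) μ :=
  (integrable_finsetSum _ fun j _ => integrable_flow_neg (hG j)).smul β

theorem integral_norm_derivTerm_le {μ : Measure ℝ} (β : ℂ) {G : Fin k → ℝ → Kernel k}
    (hG : ∀ j, Integrable (G j) μ) :
    ∫ s, ‖derivTerm β G s‖ ∂μ ≤ ‖β‖ * ∑ j, ∫ s, ‖G j s‖ ∂μ := by
  rw [← integral_finsetSum _ fun j _ => (hG j).norm, ← integral_const_mul]
  refine integral_mono (integrable_derivTerm β hG).norm
    ((integrable_finsetSum _ fun j _ => (hG j).norm).const_mul _) fun s => ?_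
  change ‖β • ∑ j, flow (-s) (G j s)‖ ≤ ‖β‖ * ∑ j, ‖G j s‖
  rw [norm_smul]
  refine mul_le_mul_of_nonneg_left ((norm_sum_le _ _).trans (le_of_eq ?_)) (norm_nonneg _)
  exact Finset.sum_congr rfl fun j _ => norm_flow _ _

theorem integral_derivTerm (β : ℂ) {S : Set ℝ} {G : Fin k → ℝ → Kernel k}
    (hG : ∀ j, IntegrableOn (G j) S) :
    ∫ s in S, derivTerm β G s = β • ∑ j, ∫ s in S, flow (-s) (G j s) := by
  unfold derivTerm
  rw [integral_smul, integral_finsetSum _ fun j _ => integrable_flow_neg (hG j)]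

theorem duhamel_eq (hε' : 0 ≤ ε) (f : Kernel k) {F G : Fin k → ℝ → Kernel k} {t : ℝ} (ht : 0 ≤ t)
    (hG : ∀ j, IntegrableOn (G j) (Set.Ioc 0 t))
    (hFG : ∀ j, ∀ᵐ s ∂(volume.restrict (Set.Ioc 0 t)), F j s = synth hε' (G j s)) :
    freeEvolution t (synth hε' f) - (Complex.I * (b₀ : ℂ)) •
        ∑ j, ∫ s in (0 : ℝ)..t, freeEvolution (t - s) (F j s) =
      synth hε' (flow t (f + ∫ s in Set.Ioc 0 t, derivTerm (-(Complex.I * (b₀ : ℂ))) G s)) := by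
  have h1 : ∀ j, ∫ s in (0 : ℝ)..t, freeEvolution (t - s) (F j s) =
      synth hε' (flow t (∫ s in Set.Ioc 0 t, flow (-s) (G j s))) := by
    intro j
    rw [synth_flow_integral hε' t (hG j), intervalIntegral.integral_of_le ht]
    refine integral_congr_ae ?_
    filter_upwards [hFG j] with s hs
    rw [hs]
  rw [Finset.sum_congr rfl fun j _ => h1 j, integral_derivTerm _ hG, map_add, map_add, map_smul,
    map_smul, map_sum, map_sum, freeEvolution_synth, neg_smul, sub_eq_add_neg]

theorem derivTerm_collisionTerm {a b : ℝ} (hab : b ≤ a + 1) (β : ℂ)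
    (x : Kernel (k + 1) × Source Kernel a b (k + 1)) (r : ℝ) :
    derivTerm β (fun j => collisionTerm hε hab j x) r = β • ∑ i, dataLim hε hab i x r := by
  rw [sum_idx, derivTerm]
  congr 1
  refine Finset.sum_congr rfl fun j _ => ?_
  rw [collisionTerm, flow_flow, neg_add_cancel, flow_zero]

/-- A solution of the hierarchy, in the interaction picture. -/
theorem exists_isMild (hξ : 0 < ξ) {f : ∀ n, Kernel (n + 1)} {Γ₀ : KernelSeq} {Γ : ℝ → KernelSeq}
    (hf : ∀ n, synth hε.le (f n) = Γ₀ n) (h : IsSolution ε ξ b₀ T Γ₀ Γ) :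
    ∃ g E, IsMild hε (-(Complex.I * (b₀ : ℂ))) T ξ g E ∧ (∀ n, g n 0 = f n) ∧
      ∀ t ∈ Set.Icc 0 T, ∀ n, Γ t n = synth hε.le (flow t (g n t)) := by
  obtain ⟨hmem, -, F, hFm, hFs, hFc, hduh⟩ := h
  set β : ℂ := -(Complex.I * (b₀ : ℂ)) with hβ
  set K : ℝ≥0∞ := ∑' n : ℕ, ENNReal.ofReal (ξ ^ (n + 1)) *
      ∑ j : Fin (n + 1), ∫⁻ t in Set.Icc 0 T, sobolevNorm ε (F n j t) with hK
  have hle : ∀ n, ENNReal.ofReal (ξ ^ (n + 1)) *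
      ∑ j : Fin (n + 1), ∫⁻ t in Set.Icc 0 T, sobolevNorm ε (F n j t) ≤ K := fun n =>
    ENNReal.le_tsum n
  have hsum : ∀ n, ∑ j : Fin (n + 1), ∫⁻ t in Set.Icc 0 T, sobolevNorm ε (F n j t) < ∞ := fun n =>
    ENNReal.lt_top_of_mul_ne_top_right ((hle n).trans_lt hFs).ne
      (ENNReal.ofReal_pos.2 (pow_pos hξ _)).ne'
  have hint : ∀ n j, ∫⁻ t in Set.Icc 0 T, sobolevNorm ε (F n j t) < ∞ := fun n j =>
    (Finset.single_le_sum (f := fun j => ∫⁻ t in Set.Icc 0 T, sobolevNorm ε (F n j t))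
      (fun _ _ => zero_le) (Finset.mem_univ j)).trans_lt (hsum n)
  have hae := fun n j => ae_sobolevNorm_lt_top hε.le (hFm n j) (hint n j)
  -- The weighted transforms of the given collision terms. They are integrable because the positive
  -- factor `ξ^(n+1)` can be divided out of the finite sum, level by level.
  let G : ∀ n, Fin (n + 1) → ℝ → Kernel (n + 1) := fun n j t => analyze hε.le (F n j t)
  have hFG : ∀ n j, ∀ᵐ t ∂(volume.restrict (Set.Icc 0 T)), F n j t = synth hε.le (G n j t) :=
    fun n j => (hae n j).mono fun t ht => (synth_analyze hε.le ht).symm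
  have hGn : ∀ n j, ∫⁻ t in Set.Icc 0 T, ‖G n j t‖ₑ =
      ∫⁻ t in Set.Icc 0 T, sobolevNorm ε (F n j t) := fun n j =>
    lintegral_congr_ae ((hae n j).mono fun t ht => enorm_analyze hε.le ht)
  have hGi : ∀ n j, IntegrableOn (G n j) (Set.Icc 0 T) := fun n j =>
    ⟨aestronglyMeasurable_analyze hε.le (hFm n j), (hGn n j).trans_lt (hint n j)⟩
  have hGi' : ∀ n j, IntegrableOn (G n j) (Set.Ioc 0 T) := fun n j =>
    (hGi n j).mono_set Set.Ioc_subset_Icc_self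
  let E : ∀ n, ℝ → Kernel (n + 1) := fun n => derivTerm β (G n)
  -- The curve is defined by integrating its derivative; Duhamel's formula then shows that it
  -- represents the given solution.
  let g : ∀ n, ℝ → Kernel (n + 1) := fun n t => f n + ∫ s in Set.Ioc 0 t, E n s
  have hg0 : ∀ n, g n 0 = f n := fun n => by simp [g]
  have hEi : ∀ n, IntegrableOn (E n) (Set.Ioc 0 T) := fun n => integrable_derivTerm β (hGi' n)
  have hg : ∀ n, ∀ t ∈ Set.Icc 0 T, g n t = g n 0 + ∫ s in Set.Ioc 0 t, E n s := fun n t _ => by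
    rw [hg0]
  have hΓ : ∀ t ∈ Set.Icc 0 T, ∀ n, Γ t n = synth hε.le (flow t (g n t)) := by
    intro t ht n
    have hsub : Set.Ioc 0 t ⊆ Set.Icc 0 T := fun s hs => ⟨hs.1.le, hs.2.trans ht.2⟩
    rw [hduh n t ht, ← hf n]
    exact duhamel_eq hε.le (f n) ht.1 (fun j => (hGi n j).mono_set hsub)
      fun j => ae_restrict_of_ae_restrict_of_subset hsub (hFG n j)
  refine ⟨g, E, ⟨hEi, hg, ?_, ?_, ?_⟩, hg0, hΓ⟩
  · intro n σ τ t ht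
    have h1 := (hmem t ht).1 n
    rw [hΓ t ht n, isBosonic_synth_iff] at h1
    have h2 := h1 σ τ
    rw [permOp_flow] at h2
    exact flow_injective t h2
  -- `K` carries the weight `ξ^(n+1)` at index `n`; the extra `ξ⁻¹` accounts for this shift.
  · refine ⟨‖β‖ * (K.toReal * ξ⁻¹), fun n => ?_⟩
    have h1 : ∑ j, ∫ s in Set.Icc 0 T, ‖G n j s‖ ≤ K.toReal * ξ⁻¹ ^ (n + 1) := by
      have h2 : ∑ j, ∫ s in Set.Icc 0 T, ‖G n j s‖ =
          (∑ j : Fin (n + 1), ∫⁻ t in Set.Icc 0 T, sobolevNorm ε (F n j t)).toReal := by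
        rw [ENNReal.toReal_sum fun j _ => (hint n j).ne]
        refine Finset.sum_congr rfl fun j _ => ?_
        rw [← hGn, integral_norm_eq_lintegral_enorm (hGi n j).1]
      have h3 := ENNReal.toReal_mono hFs.ne (hle n)
      rw [ENNReal.toReal_mul, ENNReal.toReal_ofReal (pow_pos hξ _).le, ← h2] at h3
      rw [inv_pow, ← div_eq_mul_inv, le_div_iff₀ (pow_pos hξ _), mul_comm]
      exact h3
    calc ∫ s in Set.Ioc 0 T, ‖E n s‖ ≤ ‖β‖ * ∑ j, ∫ s in Set.Ioc 0 T, ‖G n j s‖ :=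
          integral_norm_derivTerm_le β (hGi' n)
      _ ≤ ‖β‖ * (K.toReal * ξ⁻¹ ^ (n + 1)) := by
          refine mul_le_mul_of_nonneg_left (le_trans (Finset.sum_le_sum fun j _ => ?_) h1)
            (norm_nonneg _)
          rw [integral_Icc_eq_integral_Ioc]
      _ = _ := by ring
  -- The prescribed collision terms and the constructed ones agree almost everywhere after
  -- synthesis; injectivity of `synth` transfers this to the derivatives.
  · intro a b ha hb hab e he n
    refine Lp.ext ?_
    have hsub : Set.Ioc a b ⊆ Set.Icc 0 T := fun r hr => ⟨ha.trans hr.1.le, hr.2.trans hb⟩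
    have hc : ∀ r ∈ Set.Ioc a b, Γ r (n + 1) =
        synth hε.le (flow r (curve (g (n + 1) a, e (n + 1)) r)) := by
      intro r hr
      rw [hΓ r (hsub hr), curve_eq hEi hg ha hb (he (n + 1)) ⟨hr.1.le, hr.2⟩]
    have h1 : ∀ j, ∀ᵐ r ∂(timeMeasure a b), F n j r =
        synth hε.le (collisionTerm hε hab j (g (n + 1) a, e (n + 1)) r) := fun j =>
      ae_eq_collisionTerm hε ha hb hab hc (hFm n j) (hFc n j)
    have h2 : ∀ j, ∀ᵐ r ∂(timeMeasure a b), F n j r = synth hε.le (G n j r) := fun j =>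
      ae_restrict_of_ae_restrict_of_subset hsub (hFG n j)
    filter_upwards [he n, collisionSum_ae_eq hε hab β (g (n + 1) a, e (n + 1)),
      ae_all_iff.2 h1, ae_all_iff.2 h2] with r h3 h4 h5 h6
    rw [h3, h4, ← derivTerm_collisionTerm]
    change β • ∑ j, flow (-r) (G n j r) = β • ∑ j, flow (-r) _
    congr 1
    refine Finset.sum_congr rfl fun j _ => ?_
    rw [synth_injective hε.le ((h6 j).symm.trans (h5 j))]

end solution

end

/-! ### Existence of the collision sources by a Neumann series. -/

section

variable {k : ℕ} {ε : ℝ} (hε : 0 < ε) {a b : ℝ}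

theorem ae_permOp_collisionSum_of_symm (hab : b ≤ a + 1) (β : ℂ)
    {x : Kernel (k + 1) × Source Kernel a b (k + 1)} (h1 : ∀ σ τ, permOp σ τ x.1 = x.1)
    (h2 : ∀ σ τ, ∀ᵐ s ∂(timeMeasure a b), permOp σ τ (x.2 s) = x.2 s)
    (σ τ : Equiv.Perm (Fin k)) :
    ∀ᵐ s ∂(timeMeasure a b),
      permOp σ τ (collisionSum hε hab β x s) = collisionSum hε hab β x s :=
  ae_permOp_collisionSum hε hab β σ τ fun r _ =>
    map_curve ((permOp (extPerm σ) (extPerm τ)).restrictScalars ℝ) (h1 _ _) (h2 _ _) r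

theorem ae_adjOp_collisionSum_of_adj (hab : b ≤ a + 1) {β : ℂ} (hβ : (starRingEnd ℂ) β = -β)
    {x : Kernel (k + 1) × Source Kernel a b (k + 1)} (h1 : adjOp x.1 = x.1)
    (h2 : ∀ᵐ s ∂(timeMeasure a b), adjOp (x.2 s) = x.2 s) :
    ∀ᵐ s ∂(timeMeasure a b), adjOp (collisionSum hε hab β x s) = collisionSum hε hab β x s :=
  ae_adjOp_collisionSum hε hab hβ fun r _ => map_curve adjOp h1 h2 r

theorem ae_permOp_picard (hab : b ≤ a + 1) (β : ℂ) {d : ∀ n, Source Kernel a b (n + 1)}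
    (hs : ∀ n σ τ, ∀ᵐ s ∂(timeMeasure a b), permOp σ τ (d n s) = d n s) (m : ℕ) :
    ∀ n σ τ, ∀ᵐ s ∂(timeMeasure a b),
      permOp σ τ (picard hε hab β d m n s) = picard hε hab β d m n s := by
  induction m with
  | zero => exact hs
  | succ m ih =>
    intro n σ τ
    rw [picard_succ]
    exact ae_permOp_collisionSum_of_symm hε hab β (fun _ _ => map_zero _) (ih (n + 1)) σ τ

theorem ae_adjOp_picard (hab : b ≤ a + 1) {β : ℂ} (hβ : (starRingEnd ℂ) β = -β)
    {d : ∀ n, Source Kernel a b (n + 1)}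
    (hs : ∀ n, ∀ᵐ s ∂(timeMeasure a b), adjOp (d n s) = d n s) (m : ℕ) :
    ∀ n, ∀ᵐ s ∂(timeMeasure a b), adjOp (picard hε hab β d m n s) = picard hε hab β d m n s := by
  induction m with
  | zero => exact hs
  | succ m ih =>
    intro n
    rw [picard_succ]
    exact ae_adjOp_collisionSum_of_adj hε hab hβ (map_zero _) (ih (n + 1))

/-- Symmetries expressed as fixed-point equations pass from the iterates to the sum of the series.
-/
theorem ae_map_eq_of_hasSum (L : Kernel k →L[ℝ] Kernel k) {u : ℕ → Source Kernel a b k}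
    {e : Source Kernel a b k} (h : HasSum u e)
    (hu : ∀ m, ∀ᵐ s ∂(timeMeasure a b), L (u m s) = u m s) :
    ∀ᵐ s ∂(timeMeasure a b), L (e s) = e s := by
  have h1 : ∀ m, L.compLpL 1 (timeMeasure a b) (u m) = u m := fun m =>
    Lp.ext ((L.coeFn_compLpL (u m)).trans (hu m))
  have h2 : HasSum (fun m => L.compLpL 1 (timeMeasure a b) (u m))
      (L.compLpL 1 (timeMeasure a b) e) := (L.compLpL 1 (timeMeasure a b)).hasSum h
  simp only [h1] at h2
  have h3 := L.coeFn_compLpL e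
  rw [h2.unique h] at h3
  exact h3.symm

theorem hasSum_collisionSum (hab : b ≤ a + 1) (β : ℂ) {u : ℕ → Source Kernel a b (k + 1)}
    {e : Source Kernel a b (k + 1)} (h : HasSum u e) :
    HasSum (fun m => collisionSum hε hab β (0, u m)) (collisionSum hε hab β (0, e)) := by
  have h1 : ∀ i : Idx k, HasSum (fun m => collapseLim hε hab k i (u m))
      (collapseLim hε hab k i e) := fun i => (collapseLim hε hab k i).hasSum h
  have h2 := (hasSum_sum fun i (_ : i ∈ Finset.univ) => h1 i).const_smul β
  exact h2

theorem collisionSum_add (hab : b ≤ a + 1) (β : ℂ)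
    (x y : Kernel (k + 1) × Source Kernel a b (k + 1)) :
    collisionSum hε hab β (x + y) = collisionSum hε hab β x + collisionSum hε hab β y := by
  rw [collisionSum, collisionSum, collisionSum, ← smul_add, ← Finset.sum_add_distrib]
  simp only [map_add]

theorem norm_collisionSum_free_le (hab : b ≤ a + 1) (β : ℂ) (f : Kernel (k + 1)) :
    ‖collisionSum hε hab β (f, 0)‖ ≤ ‖β‖ * (2 * k * (timeConst hε a b * ‖f‖)) := by
  rw [collisionSum, norm_smul]
  refine mul_le_mul_of_nonneg_left ?_ (norm_nonneg _)
  refine (norm_sum_le_of_le _ fun i _ => norm_dataLim_free_le hε hab i f).trans (le_of_eq ?_)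
  have h : Fintype.card (Idx k) = 2 * k := by simp [two_mul]
  rw [Finset.sum_const, Finset.card_univ, h, nsmul_eq_mul]
  push_cast
  ring

/-- Continuity of the linear part lets it act termwise and shift the series by one. -/
theorem eq_of_hasSum_picard (hab : b ≤ a + 1) (β : ℂ) {d e : ∀ n, Source Kernel a b (n + 1)}
    (h : ∀ n, HasSum (fun m => picard hε hab β d m n) (e n)) (n : ℕ) :
    e n = d n + collisionSum hε hab β (0, e (n + 1)) := by
  have h1 : HasSum (fun m => picard hε hab β d (m + 1) n) (collisionSum hε hab β (0, e (n + 1))) :=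
    hasSum_collisionSum hε hab β (h (n + 1))
  exact (h n).unique (HasSum.zero_add (f := fun m => picard hε hab β d m n) h1)

theorem ae_map_zero (L : Kernel k →L[ℝ] Kernel k) :
    ∀ᵐ s ∂(timeMeasure a b), L ((0 : Source Kernel a b k) s) = (0 : Source Kernel a b k) s := by
  filter_upwards [Lp.coeFn_zero (Kernel k) 1 (timeMeasure a b)] with s h
  rw [h, Pi.zero_apply, map_zero]

/-- The hierarchy has a solution on short time intervals. -/
theorem exists_source (hab : b ≤ a + 1) (β : ℂ) {f : ∀ n, Kernel (n + 1)} {C ξ : ℝ} (hξ : 0 < ξ)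
    (hs : ∀ n σ τ, permOp σ τ (f n) = f n) (hf : ∀ n, ‖f n‖ ≤ C * ξ⁻¹ ^ n)
    (hsmall : 8 * ‖β‖ * timeConst hε a b ≤ ξ / 4) :
    ∃ e : ∀ n, Source Kernel a b (n + 1),
      (∀ n, e n = collisionSum hε hab β (f (n + 1), e (n + 1))) ∧
      (∀ n σ τ, ∀ᵐ s ∂(timeMeasure a b), permOp σ τ (e n s) = e n s) ∧
      ((starRingEnd ℂ) β = -β → (∀ n, adjOp (f n) = f n) →
        ∀ n, ∀ᵐ s ∂(timeMeasure a b), adjOp (e n s) = e n s) ∧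
      ∃ A : ℝ, ∀ n, ‖e n‖ ≤ A * (16 * ξ⁻¹) ^ n := by
  set c : ℝ := (timeConst hε a b : ℝ) with hc
  have hC : 0 ≤ C := by simpa using (norm_nonneg _).trans (hf 0)
  -- The collision term of the freely evolving data is the inhomogeneity of the fixed-point equation
  -- for `e`.
  let d : ∀ n, Source Kernel a b (n + 1) := fun n => collisionSum hε hab β (f (n + 1), 0)
  set D : ℝ := ‖β‖ * (2 * (c * (C * ξ⁻¹))) with hD
  have hD0 : 0 ≤ D := by positivity
  have hd : ∀ n, ‖d n‖ ≤ D * (2 * ξ⁻¹) ^ n := by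
    intro n
    have h1 : ((n + 1 : ℕ) : ℝ) ≤ 2 ^ n := by exact_mod_cast Nat.lt_two_pow_self
    calc ‖d n‖ ≤ ‖β‖ * (2 * ((n + 1 : ℕ) : ℝ) * (c * ‖f (n + 1)‖)) :=
          norm_collisionSum_free_le hε hab β _
      _ ≤ ‖β‖ * (2 * 2 ^ n * (c * (C * ξ⁻¹ ^ (n + 1)))) := by
          gcongr
          exact hf (n + 1)
      _ = _ := by rw [hD]; ring
  have hds : ∀ n σ τ, ∀ᵐ s ∂(timeMeasure a b), permOp σ τ (d n s) = d n s := by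
    intro n
    exact ae_permOp_collisionSum_of_symm hε hab β (hs (n + 1)) fun σ τ =>
      ae_map_zero ((permOp σ τ).restrictScalars ℝ)
  -- The ratio `1/2` is `ξ/4 · 2/ξ`. The loss `16` per particle is `8` from the bound on the
  -- iterates times `2` from `n + 1 ≤ 2^n` in the bound for `d`.
  have hu : ∀ m n, ‖picard hε hab β d m n‖ ≤ 8 * D * (16 * ξ⁻¹) ^ n * (1 / 2) ^ m := by
    intro m n
    calc _ ≤ 8 ^ (n + 1) * (8 * ‖β‖ * c) ^ m * ‖d (n + m)‖ := norm_picard_le hε hab β hds m n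
      _ ≤ 8 ^ (n + 1) * (ξ / 4) ^ m * (D * (2 * ξ⁻¹) ^ (n + m)) := by
          gcongr
          exact hd _
      _ = 8 * D * ((8 * (2 * ξ⁻¹)) ^ n) * (ξ / 4 * (2 * ξ⁻¹)) ^ m := by
          simp only [mul_pow, pow_add]
          ring
      _ = _ := by
          congr 2
          · ring
          · field_simp
            norm_num
  have hgeo : ∀ n, HasSum (fun m : ℕ => 8 * D * (16 * ξ⁻¹) ^ n * (1 / 2) ^ m)
      (8 * D * (16 * ξ⁻¹) ^ n * 2) := fun n => hasSum_geometric_two.mul_left _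
  have hsum : ∀ n, HasSum (fun m => picard hε hab β d m n) (∑' m, picard hε hab β d m n) := fun n =>
    (Summable.of_norm_bounded (hgeo n).summable fun m => hu m n).hasSum
  obtain ⟨e, he⟩ : ∃ e : ∀ n, Source Kernel a b (n + 1),
      ∀ n, HasSum (fun m => picard hε hab β d m n) (e n) := ⟨_, hsum⟩
  refine ⟨e, fun n => ?_, fun n σ τ => ?_, fun hβ hadj n => ?_, 16 * D, fun n => ?_⟩
  · rw [eq_of_hasSum_picard hε hab β he n, ← collisionSum_add, Prod.mk_add_mk, add_zero, zero_add]
  · exact ae_map_eq_of_hasSum ((permOp σ τ).restrictScalars ℝ) (he n) fun m =>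
      ae_permOp_picard hε hab β hds m n σ τ
  · refine ae_map_eq_of_hasSum adjOp (he n) fun m => ae_adjOp_picard hε hab hβ (fun n => ?_) m n
    exact ae_adjOp_collisionSum_of_adj hε hab hβ (hadj (n + 1)) (ae_map_zero adjOp)
  · rw [← (he n).tsum_eq]
    refine (tsum_of_norm_bounded (hgeo n) fun m => hu m n).trans (le_of_eq ?_)
    ring

end

/-! ### Construction of the solution from data and sources. -/

section

variable {k : ℕ} {ε : ℝ} (hε : 0 < ε) {b₀ T : ℝ}

theorem tsum_lt_top_of_le_geometric {u : ℕ → ℝ≥0∞} {K : ℝ}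
    (h : ∀ n, u n ≤ ENNReal.ofReal (K * (1 / 2) ^ n)) : ∑' n, u n < ∞ :=
  (ENNReal.tsum_le_tsum h).trans_lt (summable_geometric_two.mul_left K).tsum_ofReal_lt_top

/-- The solution of the hierarchy with given data and sources. -/
def solution (f : ∀ n, Kernel (n + 1)) (e : ∀ n, Source Kernel 0 T (n + 1)) (t : ℝ) : KernelSeq :=
  fun n => synth hε.le (flow t (curve (f n, e n) t))

theorem norm_curve_le {F : Type} [NormedAddCommGroup F] [NormedSpace ℂ F]
    (x : F × Lp F 1 (timeMeasure 0 T)) {t : ℝ} (ht : 0 ≤ t) : ‖curve x t‖ ≤ ‖x.1‖ + ‖x.2‖ :=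
  (norm_add_le _ _).trans (add_le_add le_rfl (norm_primitive_le x.2 ht))

theorem lintegral_collisionTerm_le (hT : T ≤ 0 + 1) (j : Fin k)
    (x : Kernel (k + 1) × Source Kernel 0 T (k + 1)) :
    ∫⁻ t in Set.Icc 0 T, ‖collisionTerm hε hT j x t‖ₑ ≤
      ENNReal.ofReal (2 * timeConst hε 0 T * (‖x.1‖ + ‖x.2‖)) := by
  have h1 : ∀ t, ‖collisionTerm hε hT j x t‖ₑ ≤
      ‖dataLim hε hT (Sum.inl j) x t‖ₑ + ‖dataLim hε hT (Sum.inr j) x t‖ₑ := by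
    intro t
    rw [collisionTerm, ← ofReal_norm, norm_flow, ofReal_norm]
    exact enorm_add_le _ _
  have h2 : ∀ i : Idx k, ‖dataLim hε hT i x‖ₑ ≤
      ENNReal.ofReal (timeConst hε 0 T * (‖x.1‖ + ‖x.2‖)) := by
    intro i
    rw [← ofReal_norm]
    exact ENNReal.ofReal_le_ofReal (norm_dataLim_le hε hT i x)
  rw [setLIntegral_congr Ioc_ae_eq_Icc.symm]
  refine (lintegral_mono h1).trans ?_
  rw [lintegral_add_left (Lp.stronglyMeasurable _).enorm, ← enorm_eq_lintegral,
    ← enorm_eq_lintegral]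
  refine (add_le_add (h2 _) (h2 _)).trans (le_of_eq ?_)
  rw [← ENNReal.ofReal_add (by positivity) (by positivity)]
  congr 1
  ring

/-- Dominated convergence for the counting measure: each level is continuous in time, and the
weighted norms have a summable majorant independent of time. -/
theorem tendsto_seqNorm_synth (hε' : 0 ≤ ε) {ξ : ℝ} {u : ∀ n, ℝ → Kernel (n + 1)}
    (hu : ∀ n, Continuous (u n)) {S : Set ℝ} {B : ℕ → ℝ≥0∞} (hB : ∑' n, B n < ∞)
    (h : ∀ t ∈ S, ∀ n, ENNReal.ofReal (ξ ^ (n + 1)) * ‖u n t‖ₑ ≤ B n) {t : ℝ} (ht : t ∈ S) :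
    Tendsto (fun s => seqNorm ε ξ
      ((fun n => synth hε' (u n s) : KernelSeq) - (fun n => synth hε' (u n t) : KernelSeq)))
      (𝓝[S] t) (𝓝 0) := by
  have h1 : ∀ s, seqNorm ε ξ
      ((fun n => synth hε' (u n s) : KernelSeq) - (fun n => synth hε' (u n t) : KernelSeq)) =
      ∫⁻ n, ENNReal.ofReal (ξ ^ (n + 1)) * ‖u n s - u n t‖ₑ ∂Measure.count := by
    intro s
    rw [lintegral_count, seqNorm]
    refine tsum_congr fun n => ?_
    rw [Pi.sub_apply, ← map_sub, sobolevNorm_synth]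
  simp only [h1]
  have h2 : Tendsto (fun s => ∫⁻ n, ENNReal.ofReal (ξ ^ (n + 1)) * ‖u n s - u n t‖ₑ ∂Measure.count)
      (𝓝[S] t) (𝓝 (∫⁻ _ : ℕ, 0 ∂Measure.count)) := by
    refine tendsto_lintegral_filter_of_dominated_convergence (fun n => B n + B n)
      (Eventually.of_forall fun s => measurable_of_countable _) ?_ ?_
      (Eventually.of_forall fun n => ?_)
    · filter_upwards [self_mem_nhdsWithin] with s hs
      refine Eventually.of_forall fun n => ?_
      refine (mul_le_mul_right enorm_sub_le _).trans ?_
      rw [mul_add]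
      exact add_le_add (h s hs n) (h t ht n)
    · rw [lintegral_count, ENNReal.tsum_add]
      exact (ENNReal.add_lt_top.2 ⟨hB, hB⟩).ne
    · have h3 : Tendsto (fun s => ‖u n s - u n t‖ₑ) (𝓝[S] t) (𝓝 0) := by
        have h4 := ((((hu n).tendsto t).mono_left nhdsWithin_le_nhds).sub_const (u n t)).enorm
          (l := 𝓝[S] t)
        rwa [sub_self, enorm_zero] at h4
      have h5 := ENNReal.Tendsto.const_mul (a := ENNReal.ofReal (ξ ^ (n + 1))) h3
        (Or.inr ENNReal.ofReal_ne_top)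
      rwa [mul_zero] at h5
  rwa [lintegral_zero] at h2

theorem continuous_flow_curve (x : Kernel k × Source Kernel 0 T k) :
    Continuous fun t => flow t (curve x t) := by
  have h : Continuous fun t : ℝ => (t, curve x t) := continuous_id.prodMk (continuous_curve x)
  have h2 := (continuous_flow (k := k)).comp h
  exact h2

theorem isCollision_curve (hT : T ≤ 0 + 1) (j : Fin k)
    (x : Kernel (k + 1) × Source Kernel 0 T (k + 1)) :
    IsCollision T j (fun t => synth hε.le (flow t (curve x t)))
      (fun t => synth hε.le (collisionTerm hε hT j x t)) := by
  intro ρ hρ Φ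
  refine (tendsto_collisionPairing hε Φ hρ hT j x).congr fun α => ?_
  rw [setLIntegral_congr Ioc_ae_eq_Icc]
  simp only [testOp_apply]

theorem aestronglyMeasurable_synth_collisionTerm (hT : T ≤ 0 + 1) (j : Fin k)
    (x : Kernel (k + 1) × Source Kernel 0 T (k + 1)) :
    AEStronglyMeasurable (fun t => synth hε.le (collisionTerm hε hT j x t))
      (volume.restrict (Set.Icc 0 T)) := by
  rw [← restrict_Ioc_eq_restrict_Icc]
  exact (synth hε.le).continuous.comp_aestronglyMeasurable
    (aestronglyMeasurable_collisionTerm hε hT j x)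

theorem integrableOn_collisionTerm (hT : T ≤ 0 + 1) (j : Fin k)
    (x : Kernel (k + 1) × Source Kernel 0 T (k + 1)) :
    IntegrableOn (collisionTerm hε hT j x) (Set.Ioc 0 T) := by
  refine ⟨aestronglyMeasurable_collisionTerm hε hT j x, ?_⟩
  exact ((lintegral_mono_set Set.Ioc_subset_Icc_self).trans
    (lintegral_collisionTerm_le hε hT j x)).trans_lt ENNReal.ofReal_lt_top

theorem solution_eq_duhamel (hT : T ≤ 0 + 1) {f : ∀ n, Kernel (n + 1)}
    {e : ∀ n, Source Kernel 0 T (n + 1)}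
    (he : ∀ n, e n = collisionSum hε hT (-(Complex.I * (b₀ : ℂ))) (f (n + 1), e (n + 1)))
    (n : ℕ) {t : ℝ} (ht : t ∈ Set.Icc 0 T) :
    solution hε f e t n = freeEvolution t (synth hε.le (f n)) - (Complex.I * (b₀ : ℂ)) •
      ∑ j, ∫ s in (0 : ℝ)..t, freeEvolution (t - s)
        (synth hε.le (collisionTerm hε hT j (f (n + 1), e (n + 1)) s)) := by
  rw [duhamel_eq hε.le (f n) (G := fun j => collisionTerm hε hT j (f (n + 1), e (n + 1))) ht.1
    (fun j => (integrableOn_collisionTerm hε hT j _).mono_set (Set.Ioc_subset_Ioc_right ht.2))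
    fun j => Eventually.of_forall fun s => rfl]
  have h1 : primitive (e n) t = ∫ s in Set.Ioc 0 t, derivTerm (-(Complex.I * (b₀ : ℂ)))
      (fun j => collisionTerm hε hT j (f (n + 1), e (n + 1))) s := by
    refine (CollisionFamily.primitive_eq_setIntegral (e n) ht).trans (integral_congr_ae ?_)
    refine ae_restrict_of_ae_restrict_of_subset (Set.Ioc_subset_Ioc_right ht.2) ?_
    have h2 := collisionSum_ae_eq hε hT (-(Complex.I * (b₀ : ℂ))) (f (n + 1), e (n + 1))
    rw [← he n] at h2
    filter_upwards [h2] with s hs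
    rw [hs, derivTerm_collisionTerm]
  rw [← h1]
  rfl

/-- Since `ξ/64 · 16/ξ = 1/4`, half of the decay pays for the `n + 1 ≤ 2^n` collision terms at this
level and `2^(-n)` remains. -/
theorem collision_term_le (hT : T ≤ 0 + 1) {ξ A : ℝ} (hξ : 0 < ξ) {n : ℕ}
    {x : Kernel (n + 2) × Source Kernel 0 T (n + 2)}
    (hA : ‖x.1‖ + ‖x.2‖ ≤ A * (16 * ξ⁻¹) ^ (n + 1)) :
    ENNReal.ofReal ((ξ / 64) ^ (n + 1)) * ∑ j : Fin (n + 1), ∫⁻ t in Set.Icc 0 T,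
        sobolevNorm ε (synth hε.le (collisionTerm hε hT j x t)) ≤
      ENNReal.ofReal (2 * timeConst hε 0 T * A * (1 / 2) ^ n) := by
  have hA0 : 0 ≤ A := by
    have h := (add_nonneg (norm_nonneg x.1) (norm_nonneg x.2)).trans hA
    exact nonneg_of_mul_nonneg_left h (by positivity)
  have h1 : ∀ j : Fin (n + 1), ∫⁻ t in Set.Icc 0 T,
      sobolevNorm ε (synth hε.le (collisionTerm hε hT j x t)) ≤
      ENNReal.ofReal (2 * timeConst hε 0 T * (A * (16 * ξ⁻¹) ^ (n + 1))) := by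
    intro j
    simp only [sobolevNorm_synth]
    refine (lintegral_collisionTerm_le hε hT j x).trans (ENNReal.ofReal_le_ofReal ?_)
    gcongr
  have h2 : ((n + 1 : ℕ) : ℝ) ≤ 2 ^ n := by exact_mod_cast Nat.lt_two_pow_self
  refine (mul_le_mul_right (Finset.sum_le_sum fun j _ => h1 j) _).trans ?_
  rw [Finset.sum_const, Finset.card_univ, Fintype.card_fin, nsmul_eq_mul, ← ENNReal.ofReal_natCast,
    ← ENNReal.ofReal_mul (by positivity), ← ENNReal.ofReal_mul (by positivity)]
  refine ENNReal.ofReal_le_ofReal ?_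
  calc _ = 2 * timeConst hε 0 T * A * ((n + 1 : ℕ) : ℝ) * (ξ / 64 * (16 * ξ⁻¹)) ^ (n + 1) := by
        rw [mul_pow (ξ / 64)]
        ring
    _ ≤ 2 * timeConst hε 0 T * A * 2 ^ n * (ξ / 64 * (16 * ξ⁻¹)) ^ (n + 1) := by gcongr
    _ = 2 * timeConst hε 0 T * A * (2 ^ n * (1 / 4) ^ (n + 1)) := by
        rw [show ξ / 64 * (16 * ξ⁻¹) = 1 / 4 by field_simp; norm_num]
        ring
    _ ≤ 2 * timeConst hε 0 T * A * (1 / 2) ^ n := by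
        gcongr
        rw [pow_succ, ← mul_assoc, ← mul_pow]
        norm_num

/-- Data and sources grow at most like `(16/ξ)^n`. The weight `ξ/64` leaves geometric decay, uniform
in time, for both the curve and its collision terms. -/
theorem isSolution_solution (hT : T ≤ 0 + 1) {ξ A : ℝ} (hξ : 0 < ξ)
    {f : ∀ n, Kernel (n + 1)} {e : ∀ n, Source Kernel 0 T (n + 1)}
    (he : ∀ n, e n = collisionSum hε hT (-(Complex.I * (b₀ : ℂ))) (f (n + 1), e (n + 1)))
    (hfs : ∀ n σ τ, permOp σ τ (f n) = f n)
    (hes : ∀ n σ τ, ∀ᵐ s ∂(timeMeasure 0 T), permOp σ τ (e n s) = e n s)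
    (hA : ∀ n, ‖f n‖ + ‖e n‖ ≤ A * (16 * ξ⁻¹) ^ n) :
    IsSolution ε (ξ / 64) b₀ T (fun n => synth hε.le (f n)) (solution hε f e) := by
  have hA0 : 0 ≤ A := by
    have h := (add_nonneg (norm_nonneg (f 0)) (norm_nonneg (e 0))).trans (hA 0)
    simpa using h
  have hgeo : ∀ n : ℕ, (ξ / 64) ^ (n + 1) * (A * (16 * ξ⁻¹) ^ n) ≤ A * ξ * (1 / 2) ^ n := by
    intro n
    have h1 : (ξ / 64) ^ (n + 1) * (A * (16 * ξ⁻¹) ^ n) =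
        A * (ξ / 64) * (ξ / 64 * (16 * ξ⁻¹)) ^ n := by
      rw [mul_pow (ξ / 64)]
      ring
    have h2 : ξ / 64 * (16 * ξ⁻¹) = 1 / 4 := by
      field_simp
      norm_num
    rw [h1, h2]
    gcongr ?_ * ?_
    · gcongr
      linarith
    · gcongr
      norm_num
  have hnorm : ∀ t, 0 ≤ t → ∀ n, ‖curve (f n, e n) t‖ ≤ A * (16 * ξ⁻¹) ^ n := fun t ht n =>
    (norm_curve_le (f n, e n) ht).trans (hA n)
  have hterm : ∀ t, 0 ≤ t → ∀ n, ENNReal.ofReal ((ξ / 64) ^ (n + 1)) *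
      ‖flow t (curve (f n, e n) t)‖ₑ ≤ ENNReal.ofReal (A * ξ * (1 / 2) ^ n) := by
    intro t ht n
    rw [← ofReal_norm, norm_flow, ← ENNReal.ofReal_mul (by positivity)]
    refine ENNReal.ofReal_le_ofReal (le_trans ?_ (hgeo n))
    exact mul_le_mul_of_nonneg_left (hnorm t ht n) (by positivity)
  refine ⟨fun t ht => ⟨fun n => ?_, ?_⟩, fun t ht => ?_,
    fun n j t => synth hε.le (collisionTerm hε hT j (f (n + 1), e (n + 1)) t), fun n j => ?_, ?_,
    fun n j ρ hρ Φ => ?_, fun n t ht => ?_⟩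
  · refine (isBosonic_synth_iff hε.le _).2 fun σ τ => ?_
    rw [permOp_flow]
    exact congrArg _ (map_curve (x := (f n, e n)) ((permOp σ τ).restrictScalars ℝ)
      (hfs n σ τ) (hes n σ τ) t)
  · refine tsum_lt_top_of_le_geometric (K := A * ξ) fun n => ?_
    rw [solution, sobolevNorm_synth]
    exact hterm t ht.1 n
  · refine tendsto_seqNorm_synth hε.le (fun n => continuous_flow_curve (f n, e n)) (S := Set.Icc 0 T)
      (B := fun n => ENNReal.ofReal (A * ξ * (1 / 2) ^ n))
      (tsum_lt_top_of_le_geometric fun n => le_rfl) (fun t ht n => ?_) ht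
    exact hterm t ht.1 n
  · exact aestronglyMeasurable_synth_collisionTerm hε hT j _
  · exact tsum_lt_top_of_le_geometric (K := 2 * timeConst hε 0 T * A) fun n =>
      collision_term_le hε hT hξ (hA (n + 1))
  · exact isCollision_curve hε hT j (f (n + 1), e (n + 1)) ρ hρ Φ
  · exact solution_eq_duhamel hε hT he n ht

/-- The weighted Fourier transforms of a sequence of finite norm. -/
theorem exists_data {ξ : ℝ} (hξ : 0 < ξ) {Γ₀ : KernelSeq} (h : MemH ε ξ Γ₀) :
    ∃ f : ∀ n, Kernel (n + 1), (∀ n, synth hε.le (f n) = Γ₀ n) ∧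
      (∀ n σ τ, permOp σ τ (f n) = f n) ∧ ∃ C : ℝ, ∀ n, ‖f n‖ ≤ C * ξ⁻¹ ^ n := by
  have hle : ∀ n, ENNReal.ofReal (ξ ^ (n + 1)) * sobolevNorm ε (Γ₀ n) ≤ seqNorm ε ξ Γ₀ := fun n =>
    ENNReal.le_tsum n
  have hlt : ∀ n, sobolevNorm ε (Γ₀ n) < ∞ := fun n =>
    ENNReal.lt_top_of_mul_ne_top_right ((hle n).trans_lt h.2).ne
      (ENNReal.ofReal_pos.2 (pow_pos hξ _)).ne'
  have hs : ∀ n, synth hε.le (analyze hε.le (Γ₀ n)) = Γ₀ n := fun n => synth_analyze hε.le (hlt n)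
  refine ⟨fun n => analyze hε.le (Γ₀ n), hs, fun n => ?_, (seqNorm ε ξ Γ₀).toReal * ξ⁻¹, fun n => ?_⟩
  · rw [← isBosonic_synth_iff hε.le, hs]
    exact h.1 n
  · have h1 := ENNReal.toReal_mono h.2.ne (hle n)
    rw [ENNReal.toReal_mul, ENNReal.toReal_ofReal (pow_pos hξ _).le, ← enorm_analyze hε.le (hlt n),
      toReal_enorm] at h1
    rw [mul_assoc, ← pow_succ', inv_pow, ← div_eq_mul_inv, le_div_iff₀ (pow_pos hξ _), mul_comm]
    exact h1

theorem adjOp_solution {f : ∀ n, Kernel (n + 1)} {e : ∀ n, Source Kernel 0 T (n + 1)}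
    (hf : ∀ n, adjOp (f n) = f n) (he : ∀ n, ∀ᵐ s ∂(timeMeasure 0 T), adjOp (e n s) = e n s)
    (t : ℝ) (n : ℕ) : IsHermitianKernel (solution hε f e t n) := by
  refine (isHermitianKernel_synth_iff hε.le _).2 ?_
  rw [adjOp_flow]
  exact congrArg _ (map_curve (x := (f n, e n)) adjOp (hf n) (he n) t)

end

end GPHierarchy

end
-- Existence, uniqueness and Hermitian symmetry.
theorem mainTheorem8 (ε : ℝ) (hε : 0 < ε) (b₀ : ℝ)
    (ξ₁ : ℝ) (hξ₁ : ξ₁ ∈ Set.Ioo (0 : ℝ) 1)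
    (Γ₀ : GPHierarchy.KernelSeq) (hΓ₀ : GPHierarchy.MemH ε ξ₁ Γ₀) :
    ∃ T : ℝ, 0 < T ∧ ∃ ξ₂ : ℝ, 0 < ξ₂ ∧ ξ₂ ≤ ξ₁ ∧
      ∃ Γ : ℝ → GPHierarchy.KernelSeq,
        GPHierarchy.IsSolution ε ξ₂ b₀ T Γ₀ Γ ∧
        (∀ ξ ∈ Set.Ioo (0 : ℝ) 1, ∀ Γ' : ℝ → GPHierarchy.KernelSeq,
          GPHierarchy.IsSolution ε ξ b₀ T Γ₀ Γ' →
            ∀ t ∈ Set.Icc 0 T, Γ' t = Γ t) ∧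
        ((∀ n, GPHierarchy.IsHermitianKernel (Γ₀ n)) →
          ∀ t ∈ Set.Icc 0 T, ∀ n, GPHierarchy.IsHermitianKernel (Γ t n)) := by
  have hξ : 0 < ξ₁ := hξ₁.1
  obtain ⟨f, hf, hfs, C, hC⟩ := GPHierarchy.exists_data hε hξ hΓ₀
  obtain rfl : (fun n => GPHierarchy.synth hε.le (f n)) = Γ₀ := funext hf
  set β : ℂ := -(Complex.I * (b₀ : ℂ)) with hβ
  -- The threshold `ξ₁/4` gives the Neumann series the ratio `1/2`, and `T ≤ 1` is the length for
  -- which the collapse estimate is stated.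
  obtain ⟨T, hT0, hT1, hsmall⟩ :=
    GPHierarchy.exists_timeConst_lt (hε := hε) β (show 0 < ξ₁ / 4 by positivity)
  have hT : T ≤ 0 + 1 := by rwa [zero_add]
  obtain ⟨e, he, hes, hea, A, hA⟩ := GPHierarchy.exists_source hε hT β hξ hfs hC hsmall.le
  have hC0 : 0 ≤ C := by simpa using (norm_nonneg _).trans (hC 0)
  have hsol := GPHierarchy.isSolution_solution (A := C + A) hε hT hξ he hfs hes fun n => by
    rw [add_mul]
    refine add_le_add ((hC n).trans ?_) (hA n)
    have : 0 < ξ₁⁻¹ := inv_pos.2 hξ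
    gcongr
    linarith
  refine ⟨T, hT0, ξ₁ / 64, by positivity, by linarith, _, hsol, fun ξ hξ' Γ' hΓ' t ht => ?_,
    fun h t _ n => ?_⟩
  -- Both solutions are viewed in the interaction picture with the same initial value. Their spaces
  -- may differ, and `T` need not be small relative to `ξ`.
  · obtain ⟨g, E, hg, hg0, hgΓ⟩ :=
      GPHierarchy.exists_isMild hε (show 0 < ξ₁ / 64 by positivity) (fun _ => rfl) hsol
    obtain ⟨g', E', hg', hg0', hgΓ'⟩ := GPHierarchy.exists_isMild hε hξ'.1 (fun _ => rfl) hΓ'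
    funext n
    rw [hgΓ t ht, hgΓ' t ht, hg'.eq hξ'.1 (show 0 < ξ₁ / 64 by positivity) hg
      (fun n => (hg0' n).trans (hg0 n).symm) ht n]
  · have hfa : ∀ n, GPHierarchy.adjOp (f n) = f n := fun n =>
      (GPHierarchy.isHermitianKernel_synth_iff hε.le _).1 (h n)
    refine GPHierarchy.adjOp_solution hε hfa (hea ?_ hfa) t n
    -- `β` is purely imaginary because `b₀` is real.
    rw [hβ, map_neg, map_mul, Complex.conj_I, Complex.conj_ofReal]
    ring
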